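/- **Definitions.** A *polygon* (an $n$-gon, $n\ge 3$) in $\mathbb E^3$ is given by a cyclic sequence of $n$ distinct points and consists of these points (its vertices) and the segments joining consecutive ones (its edges). A (finite) *geometric polyhedron* $P$ in $\mathbb E^3$ consists of a finite set of points (vertices), a set of segments joining vertices (edges) and a set of polygons made up of these segments (faces), such that the edge graph is connected, the vertex-figure at every vertex $v$ (the graph on the neighbours of $v$ in which $u,w$ are joined if $\{u,v\},\{v,w\}$ are edges of a common face) is connected, and each edge lies in exactly two faces. Let $\Gamma(P)$ be the automorphism group of the underlying abstract polyhedron, i.e. of the set of vertices, edges and faces partially ordered by incidence, and let $G(P)$ be the group of isometries of $\mathbb E^3$ that map $P$ to itself, viewed as a subgroup of $\Gamma(P)$. A flag is a maximal chain of the partially ordered set. $P$ is *regular* (regular of index $1$) if $G(P)$ is transitive on flags. $P$ is a *regular polyhedron of index $2$* if $\Gamma(P)$ is transitive on flags and $|\Gamma(P):G(P)|=2$. A *Petrie polygon* of $P$ is a polygon along edges of $P$ such that any two, but no three, consecutive edges belong to a common face; the *Petrie dual* of $P$ has the same vertices and edges as $P$, and the Petrie polygons of $P$ as faces. **Lemma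 10.** Let $Q$ be one of the $18$ finite regular polyhedra, i.e. one of the five Platonic solids or the four Kepler–Poinsot polyhedra or the Petrie dual of one of these nine, with centre at the origin $o$ of $\mathbb E^3$ (up to similarity). For a real number $\lambda>0$, $\lambda\ne1$, construct $P_\lambda$ from $Q$ as follows. * If $Q$ is not the cube or its Petrie dual, put $v^\diamond=\lambda v$ and $Q^\diamond=\lambda Q$. The vertices of $P_\lambda$ are those of $Q$ and of $Q^\diamond$; each pair of edges $\{v_0,v_1\}$ of $Q$ and $\{v_0^\diamond,v_1^\diamond\}$ of $Q^\diamond$ is replaced by the two edges $\{v_0,v_1^\diamond\}$ and $\{v_0^\diamond,v_1\}$; the faces of $P_\lambda$ are the polygons $(v_0,v_1^\diamond,v_2,v_3^\diamond,\dots)$ obtained by tracing the face boundaries $(v_0,v_1,\dots,v_{p-1})$ of $Q$, alternating between $Q$ and $Q^\diamond$, until the path closes up (so a $p$-gonal face of $Q$ gives one $2p$-gon if $p$ is odd, and two $p$-gons if $p$ is even). * If $Q$ is the cube or its Petrie dual, then the vertices of $Q$ are those of two regular tetrahedra $S$ and $-S$; $P_\lambda$ is obtained from $Q$ by replacing each vertex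 $v$ of $-S$ by $\lambda v$, keeping the vertices of $S$ and the combinatorics of the edges and faces. Then $Q$ is a regular geometric polyhedron, and for every $\lambda>0$, $\lambda\neq1$, the figure $P_\lambda$ is a geometric polyhedron that is regular of index $2$; its vertices form exactly two orbits under $G(P_\lambda)$, and none of its faces is planar. Moreover, the $P_\lambda$ form an infinite family up to similarity: if $P_\lambda$ and $P_\mu$ are similar (with $\lambda,\mu>0$ and $\lambda,\mu\ne1$), then $\mu=\lambda$ or $\mu=\lambda^{-1}$. -/

import Mathlib

/-- Euclidean 3-space. -/
abbrev E3 : Type := EuclideanSpace ℝ (Fin 3)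

/-! ### Polygons and skeletal polyhedra -/

/-- The (closed) polygon with the cyclic sequence of vertices `v`, given by its set of edges;
the line segment joining `x` and `y` is represented by the unordered pair `s(x, y)`. -/
def polygon {p : ℕ} (v : ZMod p → E3) : Set (Sym2 E3) :=
  Set.range fun i => s(v i, v (i + 1))

/-- `F` is the edge set of a `p`-gon with `p ≥ 3` distinct vertices. -/
def IsPolygon (p : ℕ) (F : Set (Sym2 E3)) : Prop :=
  3 ≤ p ∧ ∃ v : ZMod p → E3, Function.Injective v ∧ F = polygon v

/-- The vertices of a polygon given by its edges. -/
def polygonVertices (F : Set (Sym2 E3)) : Set E3 :=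
  {x | ∃ e ∈ F, x ∈ e}

/-- The data of a skeletal figure in space: points (vertices), line segments (edges), and
polygons (faces), each polygon being given by its set of edges. -/
@[ext] structure Skeletal where
  verts : Set E3
  edges : Set (Sym2 E3)
  faces : Set (Set (Sym2 E3))

namespace Skeletal

/-- The edge graph. -/
def edgeGraph (P : Skeletal) : SimpleGraph P.verts where
  Adj x y := x ≠ y ∧ s((x : E3), (y : E3)) ∈ P.edges
  symm := ⟨fun x y h => ⟨h.1.symm, by rw [Sym2.eq_swap]; exact h.2⟩⟩
  loopless := ⟨fun _ h => h.1 rfl⟩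

/-- The vertex-figure at `v`: its nodes are the neighbours of `v` in the edge graph, and two of
them, `u` and `w`, are joined if `{u, v}` and `{v, w}` are edges of a common face. -/
def vertexFigure (P : Skeletal) (v : P.verts) :
    SimpleGraph {u : P.verts // P.edgeGraph.Adj v u} where
  Adj u w := u ≠ w ∧
    ∃ F ∈ P.faces, s((u.1 : E3), (v : E3)) ∈ F ∧ s((v : E3), (w.1 : E3)) ∈ F
  symm := ⟨fun u w h => ⟨h.1.symm, by
    obtain ⟨F, hF, h1, h2⟩ := h.2
    exact ⟨F, hF, by rw [Sym2.eq_swap]; exact h2, by rw [Sym2.eq_swap]; exact h1⟩⟩⟩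
  loopless := ⟨fun _ h => h.1 rfl⟩

/-- A (finite) geometric polyhedron in Euclidean 3-space. -/
structure IsPolyhedron (P : Skeletal) : Prop where
  finite_verts : P.verts.Finite
  edge_spec : ∀ e ∈ P.edges, ¬ e.IsDiag ∧ ∀ x ∈ e, x ∈ P.verts
  face_spec : ∀ F ∈ P.faces, (∃ p, IsPolygon p F) ∧ F ⊆ P.edges
  connected : P.edgeGraph.Connected
  vertexFigure_connected : ∀ v, (P.vertexFigure v).Connected
  two_faces : ∀ e ∈ P.edges, {F | F ∈ P.faces ∧ e ∈ F}.ncard = 2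

/-! ### The underlying abstract polyhedron and its automorphisms -/

/-- The proper elements (vertices, edges, faces) of the underlying abstract polyhedron. -/
inductive Cell (P : Skeletal) : Type
  | vertex (v : P.verts)
  | edge (e : P.edges)
  | face (F : P.faces)

/-- Incidence of the proper elements. -/
def Cell.Incident {P : Skeletal} : Cell P → Cell P → Prop
  | .vertex v, .vertex w => v = w
  | .vertex v, .edge e => (v : E3) ∈ (e : Sym2 E3)
  | .vertex v, .face F => (v : E3) ∈ polygonVertices F
  | .edge e, .edge d => e = d
  | .edge e, .face F => (e : Sym2 E3) ∈ (F : Set (Sym2 E3))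
  | .face F, .face G => F = G
  | _, _ => False

instance (P : Skeletal) : PartialOrder (Cell P) where
  le := Cell.Incident
  le_refl a := by cases a <;> simp [Cell.Incident]
  le_trans a b c hab hbc := by
    cases a <;> cases b <;> cases c <;> simp_all [Cell.Incident, polygonVertices]
    exact ⟨_, hbc, hab⟩
  le_antisymm a b hab hba := by
    cases a <;> cases b <;> simp_all [Cell.Incident]

/-- The combinatorial automorphism group: all automorphisms of the partially ordered set of
proper elements. -/
abbrev Aut (P : Skeletal) : Type := Cell P ≃o Cell P

/-! ### Images and geometric symmetries -/

/-- The image of a figure under a map of the ambient space acting on the vertices. -/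
def map (f : E3 → E3) (P : Skeletal) : Skeletal where
  verts := f '' P.verts
  edges := Sym2.map f '' P.edges
  faces := (fun F => Sym2.map f '' F) '' P.faces

theorem map_id (P : Skeletal) : P.map id = P := by
  ext <;> simp [map]

theorem map_map (f g : E3 → E3) (P : Skeletal) : (P.map f).map g = P.map (g ∘ f) := by
  ext x
  · simp [map]
  · simp [map, Sym2.map_map]
  · simp [map, Set.image_image, Sym2.map_map]

/-- The (geometric) symmetry group: all isometries of space that map the figure to itself. -/
def symmetryGroup (P : Skeletal) : Subgroup (E3 ≃ᵢ E3) where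
  carrier := {g | P.map g = P}
  one_mem' := P.map_id
  mul_mem' {a b} ha hb := by
    have h : P.map (a ∘ b) = P := by
      rw [← map_map, show P.map b = P from hb, show P.map a = P from ha]
    exact h
  inv_mem' {a} ha := by
    have h : (P.map a).map (a⁻¹ : E3 ≃ᵢ E3) = P := by
      rw [map_map]
      convert P.map_id using 2
      funext x
      exact a.symm_apply_apply x
    rwa [show P.map a = P from ha] at h

theorem mem_of_map_eq {P : Skeletal} {f : E3 → E3} (h : P.map f = P) :
    (∀ v ∈ P.verts, f v ∈ P.verts) ∧ (∀ e ∈ P.edges, Sym2.map f e ∈ P.edges) ∧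
      ∀ F ∈ P.faces, Sym2.map f '' F ∈ P.faces := by
  refine ⟨fun v hv => ?_, fun e he => ?_, fun F hF => ?_⟩
  · have : f v ∈ (P.map f).verts := ⟨v, hv, rfl⟩
    rwa [h] at this
  · have : Sym2.map f e ∈ (P.map f).edges := ⟨e, he, rfl⟩
    rwa [h] at this
  · have : Sym2.map f '' F ∈ (P.map f).faces := ⟨F, hF, rfl⟩
    rwa [h] at this

/-- The action of a symmetry on vertices, edges and faces. -/
noncomputable def symmetryAct (P : Skeletal) (g : P.symmetryGroup) : Cell P → Cell P
  | .vertex v => .vertex ⟨(g : E3 ≃ᵢ E3) v, (mem_of_map_eq g.2).1 _ v.2⟩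
  | .edge e => .edge ⟨Sym2.map (g : E3 ≃ᵢ E3) e, (mem_of_map_eq g.2).2.1 _ e.2⟩
  | .face F => .face ⟨Sym2.map (g : E3 ≃ᵢ E3) '' F, (mem_of_map_eq g.2).2.2 _ F.2⟩

theorem symmetryAct_one (P : Skeletal) (x : Cell P) : P.symmetryAct 1 x = x := by
  cases x with
  | vertex v => rfl
  | edge e =>
    have h : Sym2.map (id : E3 → E3) e = e := by simp
    exact congrArg Cell.edge (Subtype.ext h)
  | face F =>
    have h : Sym2.map (id : E3 → E3) '' F = F := by simp
    exact congrArg Cell.face (Subtype.ext h)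

theorem symmetryAct_mul (P : Skeletal) (g h : P.symmetryGroup) (x : Cell P) :
    P.symmetryAct (g * h) x = P.symmetryAct g (P.symmetryAct h x) := by
  have key : ∀ e : Sym2 E3, Sym2.map ((g * h : P.symmetryGroup) : E3 ≃ᵢ E3) e =
      Sym2.map (g : E3 ≃ᵢ E3) (Sym2.map (h : E3 ≃ᵢ E3) e) := by
    intro e
    rw [Sym2.map_map]
    rfl
  cases x with
  | vertex v => rfl
  | edge e => simp only [symmetryAct, key]
  | face F => simp only [symmetryAct, Set.image_image, key]

theorem symmetryAct_mono (P : Skeletal) (g : P.symmetryGroup) {x y : Cell P} (hxy : x ≤ y) :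
    P.symmetryAct g x ≤ P.symmetryAct g y := by
  change Cell.Incident _ _
  replace hxy : Cell.Incident x y := hxy
  cases x <;> cases y <;> simp only [Cell.Incident, symmetryAct, polygonVertices] at hxy ⊢
  · rw [hxy]
  · exact Sym2.mem_map.2 ⟨_, hxy, rfl⟩
  · obtain ⟨e, he, hv⟩ := hxy
    exact ⟨_, ⟨e, he, rfl⟩, Sym2.mem_map.2 ⟨_, hv, rfl⟩⟩
  · rw [hxy]
  · exact ⟨_, hxy, rfl⟩
  · rw [hxy]

/-- The homomorphism by which symmetries are viewed as automorphisms of the underlying abstract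
polyhedron. -/
noncomputable def symmetryToAut (P : Skeletal) : P.symmetryGroup →* P.Aut where
  toFun g :=
    { toFun := P.symmetryAct g
      invFun := P.symmetryAct g⁻¹
      left_inv := fun x => by rw [← symmetryAct_mul, inv_mul_cancel, symmetryAct_one]
      right_inv := fun x => by rw [← symmetryAct_mul, mul_inv_cancel, symmetryAct_one]
      map_rel_iff' := by
        intro x y
        refine ⟨fun h => ?_, fun h => P.symmetryAct_mono g h⟩
        have := P.symmetryAct_mono g⁻¹ h
        simpa [← symmetryAct_mul, symmetryAct_one] using this }
  map_one' := by
    ext x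
    exact P.symmetryAct_one x
  map_mul' g h := by
    ext x
    exact P.symmetryAct_mul g h x

/-- The index of a figure: the index of its symmetry group in its automorphism group. -/
noncomputable def index (P : Skeletal) : ℕ := P.symmetryToAut.range.index

/-- A geometric polyhedron is (geometrically) regular if its symmetry group is transitive on the
flags (maximal chains of the underlying abstract polyhedron). -/
def IsRegular (P : Skeletal) : Prop :=
  P.IsPolyhedron ∧ ∀ Φ Ψ : Flag (Cell P), ∃ g : P.symmetryGroup, P.symmetryToAut g • Φ = Ψ

/-- A geometric polyhedron is combinatorially regular if the automorphism group of the underlying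
abstract polyhedron is transitive on the flags. -/
def IsCombinatoriallyRegular (P : Skeletal) : Prop :=
  P.IsPolyhedron ∧ ∀ Φ Ψ : Flag (Cell P), ∃ γ : P.Aut, γ • Φ = Ψ

/-- Regular polyhedra of index 2. -/
def IsRegularOfIndexTwo (P : Skeletal) : Prop :=
  P.IsCombinatoriallyRegular ∧ P.index = 2

/-- The set of vertex orbits under the symmetry group. -/
def vertexOrbits (P : Skeletal) : Set (Set E3) :=
  {O | ∃ v ∈ P.verts, O = {w | ∃ g ∈ P.symmetryGroup, g v = w}}

/-- Similarity of figures. -/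
def Similar (P P' : Skeletal) : Prop :=
  ∃ r : ℝ, 0 < r ∧ ∃ g : E3 ≃ᵢ E3, P' = P.map fun x => r • g x

/-! ### Petrie duals -/

/-- `F` is a Petrie polygon of `P`: a polygon along edges of `P` such that any two, but no three,
consecutive edges belong to a common face. -/
def IsPetriePolygon (P : Skeletal) (F : Set (Sym2 E3)) : Prop :=
  ∃ p : ℕ, 3 ≤ p ∧ ∃ v : ZMod p → E3, Function.Injective v ∧ F = polygon v ∧ F ⊆ P.edges ∧
    ∀ i : ZMod p,
      (∃ G ∈ P.faces, s(v i, v (i + 1)) ∈ G ∧ s(v (i + 1), v (i + 2)) ∈ G) ∧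
      ¬ ∃ G ∈ P.faces, s(v i, v (i + 1)) ∈ G ∧ s(v (i + 1), v (i + 2)) ∈ G ∧
          s(v (i + 2), v (i + 3)) ∈ G

/-- The Petrie dual: same vertices and edges, the faces being the Petrie polygons. -/
def petrieDual (P : Skeletal) : Skeletal where
  verts := P.verts
  edges := P.edges
  faces := {F | P.IsPetriePolygon F}

/-! ### The Platonic solids and the Kepler-Poinsot polyhedra -/

/-- The figure with vertex set `V`, whose edges join the pairs of distinct points of `V` with inner
product `c`, and whose faces are all planar `p`-gons formed by such edges. -/
def ofVertices (V : Set E3) (c : ℝ) (p : ℕ) : Skeletal where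
  verts := V
  edges := {e | ∃ x ∈ V, ∃ y ∈ V, x ≠ y ∧ inner ℝ x y = c ∧ e = s(x, y)}
  faces := {F | IsPolygon p F ∧
    (∀ e ∈ F, ∃ x ∈ V, ∃ y ∈ V, x ≠ y ∧ inner ℝ x y = c ∧ e = s(x, y)) ∧
    Coplanar ℝ (polygonVertices F)}

end Skeletal

/-- The vertices of the cube. -/
def cubeVerts : Set E3 :=
  {x | ∀ i, x i = 1 ∨ x i = -1}

/-- The vertices of one of the two regular tetrahedra inscribed in the cube. -/
def tetrahedronVerts : Set E3 :=
  {x | x ∈ cubeVerts ∧ x 0 * x 1 * x 2 = 1}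

/-- The vertices of the octahedron. -/
def octahedronVerts : Set E3 :=
  {x | ∃ s : ℝ, (s = 1 ∨ s = -1) ∧ (x = !₂[s, 0, 0] ∨ x = !₂[0, s, 0] ∨ x = !₂[0, 0, s])}

/-- The points `(0, ±a, ±b)` and their cyclic shifts. -/
def cyclicPoints (a b : ℝ) : Set E3 :=
  {x | ∃ s t : ℝ, (s = 1 ∨ s = -1) ∧ (t = 1 ∨ t = -1) ∧
    (x = !₂[0, s * a, t * b] ∨ x = !₂[t * b, 0, s * a] ∨ x = !₂[s * a, t * b, 0])}

/-- The vertices of the icosahedron. -/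
def icosahedronVerts : Set E3 :=
  cyclicPoints 1 Real.goldenRatio

/-- The vertices of the dodecahedron. -/
def dodecahedronVerts : Set E3 :=
  cubeVerts ∪ cyclicPoints Real.goldenRatio⁻¹ Real.goldenRatio

/-- Names of the five Platonic solids and the four Kepler-Poinsot polyhedra. -/
inductive ClassicalPolyhedron : Type
  | tetrahedron
  | octahedron
  | cube
  | icosahedron
  | dodecahedron
  | greatDodecahedron
  | smallStellatedDodecahedron
  | greatIcosahedron
  | greatStellatedDodecahedron

namespace ClassicalPolyhedron

/-- The Platonic solids and the Kepler-Poinsot polyhedra, centred at the origin. The four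
Kepler-Poinsot polyhedra have the vertices of the icosahedron or dodecahedron; the edges of the
great dodecahedron are those of the icosahedron, and those of the other three are the second
longest segments between vertices (diameters being the longest). -/
noncomputable def toSkeletal : ClassicalPolyhedron → Skeletal
  | tetrahedron => .ofVertices tetrahedronVerts (-1) 3
  | octahedron => .ofVertices octahedronVerts 0 3
  | cube => .ofVertices cubeVerts 1 4
  | icosahedron => .ofVertices icosahedronVerts Real.goldenRatio 3
  | dodecahedron => .ofVertices dodecahedronVerts √5 5
  | greatDodecahedron => .ofVertices icosahedronVerts Real.goldenRatio 5
  | smallStellatedDodecahedron => .ofVertices icosahedronVerts (-Real.goldenRatio) 5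
  | greatIcosahedron => .ofVertices icosahedronVerts (-Real.goldenRatio) 3
  | greatStellatedDodecahedron => .ofVertices dodecahedronVerts (-√5) 5

end ClassicalPolyhedron

namespace Skeletal

/-! ### The two constructions -/

/-- The points `v 0, t v 1, v 2, t v 3, …` met when the closed polygon `v` is traced repeatedly,
alternating between `v` and its homothetic copy `t v`. -/
def alternate {p : ℕ} (v : ZMod p → E3) (t : ℝ) (j : ℤ) : E3 :=
  if Even j then v (j : ZMod p) else t • v (j : ZMod p)

/-- The crossing of `Q` with its homothetic copy `t Q`: the vertices are those of `Q` and `t Q`;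
each pair of edges `{x, y}`, `{t x, t y}` is replaced by the pair `{x, t y}`, `{t x, y}`; the
faces are the polygons that track the faces of `Q`, alternating between `Q` and `t Q`. For a
`p`-gonal face this is one `2 p`-gon when `p` is odd, and two `p`-gons when `p` is even (one for each
choice of the vertex `v 0`). -/
def cross (Q : Skeletal) (t : ℝ) : Skeletal where
  verts := Q.verts ∪ {x | ∃ y ∈ Q.verts, x = t • y}
  edges := {e | ∃ x y, s(x, y) ∈ Q.edges ∧ e = s(x, t • y)}
  faces := {F | ∃ p : ℕ, 3 ≤ p ∧ ∃ v : ZMod p → E3, Function.Injective v ∧ polygon v ∈ Q.faces ∧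
    F = Set.range fun j : ℤ => s(alternate v t j, alternate v t (j + 1))}

open scoped Classical in
/-- Rescaling of a figure on the vertices of the cube: the vertices of one inscribed tetrahedron
are fixed, those of the other one are multiplied by `t`. -/
noncomputable def rescaleHalf (Q : Skeletal) (t : ℝ) : Skeletal :=
  Q.map fun x => if x ∈ tetrahedronVerts then x else t • x

end Skeletal

/-- The one-parameter family of figures constructed from `Q`, where `Q` is the classical polyhedron
with name `k` or its Petrie dual. -/
noncomputable def indexTwoFamily (k : ClassicalPolyhedron) (Q : Skeletal) (t : ℝ) : Skeletal :=
  match k with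
  | .cube => Q.rescaleHalf t
  | _ => Q.cross t

/-! A flag amounts to a face with a way of running round it: a periodic sequence `w : ℤ → E3` whose
point `w 0`, edge `s(w 0, w 1)` and edge set are the three cells (`Skeletal.Tracks`). Connectedness
of the edge graph and of the vertex-figures shows that an automorphism fixing one flag is trivial
(`eq_one_of_carries`), so an automorphism is known from the image of one tracing. Regularity of `Q`
is proved by linear isometries that preserve `Q` and carry one tracing to all others; these and a
few metric facts form `CentredRegular`.

The vertices of `Q` lie on a sphere of radius `R` about their centroid `0`. Those of the constructed
figure lie on the spheres of radii `R` and `t * R`, with centroid `0`, and its edges join the two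
spheres. A symmetry fixes the centroid, hence preserves norms and cannot exchange the spheres. The
isometries of `Q` (for the cube, those respecting its 2-colouring) are transitive on the flags with
vertex on the first sphere, and the remaining flags are reached by permutations of space that are
combinatorial automorphisms but not isometries: for the crossing, the interchange of the spheres
comes in; for the cube, symmetries are conjugated by the rescaling. So the index is 2 and the vertex
orbits are the two layers (`TwoLayered.isRegularOfIndexTwo`, `TwoLayered.vertexOrbits_ncard`). A
similarity also respects centroids, so the ratio of the radii is an invariant up to inversion.

The edge graph of the crossing is the bipartite double cover of that of `Q`, connected when the
latter is not bipartite. All classical polyhedra but the cube have faces of odd length; the cube is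
bipartite, which is why one colour class is rescaled instead.

If a face of the new figure lay in a plane with normal `n`, then `n` would have a constant inner
product `k` with it. The even and the odd vertices of the original face have equal or opposite sums,
which forces `k = 0` when `t ≠ 1`; then `n` is orthogonal to three independent vertices
(`alt_not_coplanar`).

There remain the eighteen polyhedra. In each of the nine classical ones, two consecutive edges of a
face form a corner with a fixed Gram matrix, so a linear isometry carries a base corner to any
other; comparing inner products shows that it preserves the vertex set (`CornerSystem`). The
coordinates lie in ℤ[φ], so all conditions are finite exact computations. Petrie duals are handled
in general: a Petrie polygon is determined by a corner, and its corners are those of the faces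
(`CentredRegular.petrieDual`). -/

/-! ### Closed polygons as periodic sequences -/

/-- The sequence `w` runs round a closed polygon with `p` distinct vertices. -/
def IsCyc (p : ℕ) (w : ℤ → E3) : Prop :=
  3 ≤ p ∧ ∀ i j, w i = w j ↔ (p : ℤ) ∣ i - j

/-- The edges met by a sequence of points. -/
def cycEdges (w : ℤ → E3) : Set (Sym2 E3) :=
  Set.range fun i : ℤ => s(w i, w (i + 1))

theorem mem_cycEdges (w : ℤ → E3) (i : ℤ) : s(w i, w (i + 1)) ∈ cycEdges w :=
  ⟨i, rfl⟩

theorem mem_cycEdges' {w : ℤ → E3} {i j : ℤ} (h : j = i + 1) : s(w i, w j) ∈ cycEdges w :=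
  ⟨i, by rw [h]⟩

theorem mem_cycEdges_symm {w : ℤ → E3} {i j : ℤ} (h : i = j + 1) : s(w i, w j) ∈ cycEdges w := by
  rw [Sym2.eq_swap]
  exact mem_cycEdges' h

theorem cycEdges_shift (w : ℤ → E3) (k : ℤ) : cycEdges (fun j => w (k + j)) = cycEdges w := by
  ext e
  constructor
  · rintro ⟨i, rfl⟩
    exact mem_cycEdges' (by ring)
  · rintro ⟨i, rfl⟩
    exact ⟨i - k, by
      show s(w (k + (i - k)), w (k + (i - k + 1))) = _
      congr 2 <;> ring_nf⟩

theorem cycEdges_reflect (w : ℤ → E3) (k : ℤ) : cycEdges (fun j => w (k - j)) = cycEdges w := by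
  ext e
  constructor
  · rintro ⟨i, rfl⟩
    exact mem_cycEdges_symm (by ring)
  · rintro ⟨i, rfl⟩
    refine ⟨k - i - 1, ?_⟩
    show s(w (k - (k - i - 1)), w (k - (k - i - 1 + 1))) = _
    rw [Sym2.eq_swap]
    congr 2 <;> ring_nf

theorem image_cycEdges (f : E3 → E3) (w : ℤ → E3) :
    Sym2.map f '' cycEdges w = cycEdges (fun j => f (w j)) := by
  unfold cycEdges
  rw [← Set.range_comp]
  rfl

theorem polygonVertices_cycEdges (w : ℤ → E3) : polygonVertices (cycEdges w) = Set.range w := by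
  ext x
  constructor
  · rintro ⟨_, ⟨i, rfl⟩, hx⟩
    rcases Sym2.mem_iff.1 hx with rfl | rfl
    exacts [⟨_, rfl⟩, ⟨_, rfl⟩]
  · rintro ⟨i, rfl⟩
    exact ⟨_, mem_cycEdges w i, Sym2.mem_mk_left _ _⟩

namespace IsCyc

variable {p q : ℕ} {w a b : ℤ → E3}

theorem apply_ne (h : IsCyc p w) {i j : ℤ} (hij : ¬ (p : ℤ) ∣ i - j) : w i ≠ w j :=
  fun e => hij ((h.2 i j).1 e)

theorem ne_add (h : IsCyc p w) (i : ℤ) {j : ℤ} {k : ℤ} (hj : j = i + k) (h1 : 0 < k) (h2 : k < 3) :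
    w i ≠ w j := by
  refine h.apply_ne fun hd => ?_
  have h3 : (3 : ℤ) ≤ p := by exact_mod_cast h.1
  have := Int.le_of_dvd (by omega) ((Int.dvd_neg).2 hd)
  omega

theorem ne_succ (h : IsCyc p w) (i : ℤ) : w i ≠ w (i + 1) :=
  h.ne_add i rfl (by norm_num) (by norm_num)

theorem ne_succ_succ (h : IsCyc p w) (i : ℤ) : w i ≠ w (i + 2) :=
  h.ne_add i rfl (by norm_num) (by norm_num)

theorem shift (h : IsCyc p w) (k : ℤ) : IsCyc p fun j => w (k + j) :=
  ⟨h.1, fun i j => by rw [h.2]; ring_nf⟩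

theorem reflect (h : IsCyc p w) (k : ℤ) : IsCyc p fun j => w (k - j) :=
  ⟨h.1, fun i j => by rw [h.2, ← Int.dvd_neg]; ring_nf⟩

theorem comp (h : IsCyc p w) {f : E3 → E3} (hf : Set.InjOn f (Set.range w)) :
    IsCyc p fun j => f (w j) :=
  ⟨h.1, fun i j => by rw [← h.2]; exact hf.eq_iff ⟨i, rfl⟩ ⟨j, rfl⟩⟩

/-- The next edge of `b` is an edge of `a` at the current point, so it leads either onward along `a`
or back to the previous point; going back would make `b n` and `b (n + 2)` coincide. -/
theorem eq_nat (ha : IsCyc p a) (hb : IsCyc q b) (hE : cycEdges b ⊆ cycEdges a)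
    (h0 : a 0 = b 0) (h1 : a 1 = b 1) (n : ℕ) : a n = b n ∧ a (n + 1) = b (n + 1) := by
  induction n with
  | zero => simpa using ⟨h0, h1⟩
  | succ n ih =>
    obtain ⟨e0, e1⟩ := ih
    push_cast
    refine ⟨e1, ?_⟩
    obtain ⟨k, hk⟩ := hE (mem_cycEdges b (n + 1))
    rcases Sym2.eq_iff.1 hk with ⟨hk1, hk2⟩ | ⟨hk1, hk2⟩
    · rw [← hk2, ha.2]
      rw [← e1, ha.2] at hk1
      have : (p : ℤ) ∣ -(k - (n + 1)) := Int.dvd_neg.2 hk1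
      convert this using 1
      ring
    · exfalso
      rw [← e1, ha.2] at hk2
      have : a k = a n := by
        rw [ha.2]
        convert hk2 using 1
        ring
      rw [this, e0] at hk1
      refine hb.ne_succ_succ n ?_
      rw [hk1]
      ring_nf

/-- A closed polygon is traced in one way once its first two points are given. -/
theorem eq_of_cycEdges (ha : IsCyc p a) (hb : IsCyc q b) (hE : cycEdges a = cycEdges b)
    (h0 : a 0 = b 0) (h1 : a 1 = b 1) : a = b := by
  funext i
  obtain ⟨n, rfl | rfl⟩ := i.eq_nat_or_neg
  · exact (eq_nat ha hb hE.ge h0 h1 n).1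
  -- Negative indices are reached by running backwards from the edge between 0 and 1.
  · have := (eq_nat (ha.reflect 1) (hb.reflect 1)
      (by rw [cycEdges_reflect, cycEdges_reflect, hE]) (by simpa using h1) (by simpa using h0) n).2
    simpa using this

theorem exists_start {x y : E3} (he : s(x, y) ∈ cycEdges w) :
    ∃ k, (w k = x ∧ w (k + 1) = y) ∨ (w k = x ∧ w (k - 1) = y) := by
  obtain ⟨k, hk⟩ := he
  rcases Sym2.eq_iff.1 hk with ⟨h1, h2⟩ | ⟨h1, h2⟩
  · exact ⟨k, Or.inl ⟨h1, h2⟩⟩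
  · exact ⟨k + 1, Or.inr ⟨h2, by simpa using h1⟩⟩

/-- Every tracing of a closed polygon arises from a given one by a shift or a reflection. -/
theorem eq_shift_or_reflect (ha : IsCyc p a) (hb : IsCyc q b) (hE : cycEdges a = cycEdges b) :
    ∃ k, (b = fun j => a (k + j)) ∨ (b = fun j => a (k - j)) := by
  have : s(b 0, b 1) ∈ cycEdges a := by rw [hE]; exact mem_cycEdges' rfl
  obtain ⟨k, ⟨h0, h1⟩ | ⟨h0, h1⟩⟩ := exists_start this
  · exact ⟨k, Or.inl (eq_of_cycEdges hb (ha.shift k) (by rw [cycEdges_shift, hE])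
      (by simp [h0]) (by simp [h1]))⟩
  · exact ⟨k, Or.inr (eq_of_cycEdges hb (ha.reflect k) (by rw [cycEdges_reflect, hE])
      (by simp [h0]) (by simp [h1]))⟩

theorem mem_cycEdges_zero (h : IsCyc p w) {y : E3} (hy : s(w 0, y) ∈ cycEdges w) :
    y = w 1 ∨ y = w (-1) := by
  obtain ⟨k, ⟨h0, h1⟩ | ⟨h0, h1⟩⟩ := exists_start hy
  · left
    rw [← h1, h.2]
    rw [h.2] at h0
    convert h0 using 1
    ring
  · right
    rw [← h1, h.2]
    rw [h.2] at h0
    convert h0 using 1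
    ring

end IsCyc

theorem polygon_eq_cycEdges {p : ℕ} (v : ZMod p → E3) :
    polygon v = cycEdges fun j => v (j : ZMod p) := by
  ext e
  constructor
  · rintro ⟨i, rfl⟩
    obtain ⟨k, rfl⟩ := ZMod.intCast_surjective i
    exact ⟨k, by push_cast; rfl⟩
  · rintro ⟨k, rfl⟩
    exact ⟨(k : ZMod p), by push_cast; rfl⟩

theorem isCyc_intCast {p : ℕ} (hp : 3 ≤ p) {v : ZMod p → E3} (hv : Function.Injective v) :
    IsCyc p fun j => v (j : ZMod p) := by
  refine ⟨hp, fun i j => ?_⟩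
  rw [hv.eq_iff, ZMod.intCast_eq_intCast_iff_dvd_sub, ← Int.dvd_neg]
  ring_nf

theorem IsCyc.exists_zmod {p : ℕ} {w : ℤ → E3} (h : IsCyc p w) :
    ∃ v : ZMod p → E3, Function.Injective v ∧ w = fun j : ℤ => v (j : ZMod p) := by
  have : NeZero p := ⟨by have := h.1; omega⟩
  have key : ∀ j : ℤ, w (((j : ZMod p).val : ℕ) : ℤ) = w j := by
    intro j
    rw [h.2, ← Int.dvd_neg, neg_sub, ← ZMod.intCast_eq_intCast_iff_dvd_sub]
    simp
  refine ⟨fun i => w (i.val : ℤ), fun i j hij => ?_, funext fun j => (key j).symm⟩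
  obtain ⟨i, rfl⟩ := ZMod.intCast_surjective i
  obtain ⟨j, rfl⟩ := ZMod.intCast_surjective j
  simp only [key] at hij
  rw [h.2, ← Int.dvd_neg, neg_sub] at hij
  exact (ZMod.intCast_eq_intCast_iff_dvd_sub _ _ _).2 hij

theorem isPolygon_iff {p : ℕ} {F : Set (Sym2 E3)} :
    IsPolygon p F ↔ ∃ w, IsCyc p w ∧ F = cycEdges w := by
  constructor
  · rintro ⟨hp, v, hv, rfl⟩
    exact ⟨_, isCyc_intCast hp hv, polygon_eq_cycEdges v⟩
  · rintro ⟨w, hw, rfl⟩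
    obtain ⟨v, hv, rfl⟩ := hw.exists_zmod
    exact ⟨hw.1, v, hv, (polygon_eq_cycEdges v).symm⟩

namespace Skeletal

/-- The sequence `w` runs round a face of `P`. -/
def Tracks (P : Skeletal) (w : ℤ → E3) : Prop :=
  (∃ p, IsCyc p w) ∧ cycEdges w ∈ P.faces

variable {P : Skeletal} {w a b : ℤ → E3}

theorem Tracks.shift (h : P.Tracks w) (k : ℤ) : P.Tracks fun j => w (k + j) :=
  ⟨h.1.imp fun _ hp => hp.shift k, by rw [cycEdges_shift]; exact h.2⟩

theorem Tracks.reflect (h : P.Tracks w) (k : ℤ) : P.Tracks fun j => w (k - j) :=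
  ⟨h.1.imp fun _ hp => hp.reflect k, by rw [cycEdges_reflect]; exact h.2⟩

theorem Tracks.ext (ha : P.Tracks a) (hb : P.Tracks b) (hE : cycEdges a = cycEdges b)
    (h0 : a 0 = b 0) (h1 : a 1 = b 1) : a = b := by
  obtain ⟨p, hp⟩ := ha.1
  obtain ⟨q, hq⟩ := hb.1
  exact hp.eq_of_cycEdges hq hE h0 h1

theorem Tracks.eq_shift_or_reflect (ha : P.Tracks a) (hb : P.Tracks b)
    (hE : cycEdges a = cycEdges b) :
    ∃ k, (b = fun j => a (k + j)) ∨ (b = fun j => a (k - j)) := by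
  obtain ⟨p, hp⟩ := ha.1
  obtain ⟨q, hq⟩ := hb.1
  exact hp.eq_shift_or_reflect hq hE

theorem Tracks.exists_start (h : P.Tracks w) {x y : E3} (he : s(x, y) ∈ cycEdges w) :
    ∃ a, P.Tracks a ∧ cycEdges a = cycEdges w ∧ a 0 = x ∧ a 1 = y := by
  obtain ⟨k, ⟨h0, h1⟩ | ⟨h0, h1⟩⟩ := IsCyc.exists_start he
  · exact ⟨_, h.shift k, cycEdges_shift w k, by simpa using h0, by simpa using h1⟩
  · exact ⟨_, h.reflect k, cycEdges_reflect w k, by simpa using h0, by simpa using h1⟩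

theorem Tracks.ne_succ (h : P.Tracks w) (i : ℤ) : w i ≠ w (i + 1) :=
  h.1.elim fun _ hp => hp.ne_succ i

theorem Tracks.ne_succ_succ (h : P.Tracks w) (i : ℤ) : w i ≠ w (i + 2) :=
  h.1.elim fun _ hp => hp.ne_succ_succ i

theorem Tracks.ne_neg_one (h : P.Tracks w) : w 1 ≠ w (-1) := by
  have := h.ne_succ_succ (-1)
  norm_num at this
  exact fun e => this e.symm

theorem Tracks.mem_cycEdges_zero (h : P.Tracks w) {y : E3} (hy : s(w 0, y) ∈ cycEdges w) :
    y = w 1 ∨ y = w (-1) :=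
  h.1.elim fun _ hp => hp.mem_cycEdges_zero hy

namespace IsPolyhedron

variable (hP : P.IsPolyhedron)
include hP

theorem exists_tracks {F : Set (Sym2 E3)} (hF : F ∈ P.faces) :
    ∃ w, P.Tracks w ∧ cycEdges w = F := by
  obtain ⟨p, hp⟩ := (hP.face_spec F hF).1
  obtain ⟨w, hw, rfl⟩ := isPolygon_iff.1 hp
  exact ⟨w, ⟨⟨p, hw⟩, hF⟩, rfl⟩

theorem exists_tracks_start {F : Set (Sym2 E3)} (hF : F ∈ P.faces) {x y : E3} (he : s(x, y) ∈ F) :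
    ∃ w, P.Tracks w ∧ cycEdges w = F ∧ w 0 = x ∧ w 1 = y := by
  obtain ⟨a, ha, rfl⟩ := hP.exists_tracks hF
  exact ha.exists_start he

theorem edge_mem (h : P.Tracks w) (i : ℤ) : s(w i, w (i + 1)) ∈ P.edges :=
  (hP.face_spec _ h.2).2 (mem_cycEdges w i)

theorem vert_mem (h : P.Tracks w) (i : ℤ) : w i ∈ P.verts :=
  (hP.edge_spec _ (hP.edge_mem h i)).2 _ (Sym2.mem_mk_left _ _)

theorem edge_ne {x y : E3} (h : s(x, y) ∈ P.edges) : x ≠ y :=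
  (hP.edge_spec _ h).1

theorem edge_left {x y : E3} (h : s(x, y) ∈ P.edges) : x ∈ P.verts :=
  (hP.edge_spec _ h).2 _ (Sym2.mem_mk_left _ _)

theorem edge_right {x y : E3} (h : s(x, y) ∈ P.edges) : y ∈ P.verts :=
  (hP.edge_spec _ h).2 _ (Sym2.mem_mk_right _ _)

theorem exists_face {e : Sym2 E3} (he : e ∈ P.edges) : ∃ F ∈ P.faces, e ∈ F := by
  obtain ⟨F, G, -, h⟩ := Set.ncard_eq_two.1 (hP.two_faces e he)
  have : F ∈ {F | F ∈ P.faces ∧ e ∈ F} := by rw [h]; simp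
  exact ⟨F, this⟩

theorem exists_other {e : Sym2 E3} (he : e ∈ P.edges) {F : Set (Sym2 E3)} (hF : F ∈ P.faces)
    (heF : e ∈ F) : ∃ G ∈ P.faces, e ∈ G ∧ G ≠ F ∧ ∀ H ∈ P.faces, e ∈ H → H = F ∨ H = G := by
  obtain ⟨A, B, hAB, h⟩ := Set.ncard_eq_two.1 (hP.two_faces e he)
  replace h : ∀ H, H ∈ P.faces ∧ e ∈ H ↔ H = A ∨ H = B := fun H => Set.ext_iff.1 h H
  have hA := (h A).2 (Or.inl rfl)
  have hB := (h B).2 (Or.inr rfl)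
  rcases (h F).1 ⟨hF, heF⟩ with rfl | rfl
  · exact ⟨B, hB.1, hB.2, hAB.symm, fun H h1 h2 => (h H).1 ⟨h1, h2⟩⟩
  · exact ⟨A, hA.1, hA.2, hAB, fun H h1 h2 => ((h H).1 ⟨h1, h2⟩).symm⟩

theorem exists_edge {x : E3} (hx : x ∈ P.verts) : ∃ y, s(x, y) ∈ P.edges := by
  obtain ⟨⟨u, hu⟩⟩ := (hP.vertexFigure_connected ⟨x, hx⟩).nonempty
  exact ⟨u, hu.2⟩

theorem exists_tracks_edge {x y : E3} (he : s(x, y) ∈ P.edges) :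
    ∃ w, P.Tracks w ∧ w 0 = x ∧ w 1 = y := by
  obtain ⟨F, hF, heF⟩ := hP.exists_face he
  obtain ⟨w, hw, -, h0, h1⟩ := hP.exists_tracks_start hF heF
  exact ⟨w, hw, h0, h1⟩

/-- Induction along edges. -/
theorem edge_induction {p : E3 → Prop} {x₀ : E3} (hx₀ : x₀ ∈ P.verts) (h0 : p x₀)
    (hs : ∀ x y, s(x, y) ∈ P.edges → p x → p y) : ∀ x ∈ P.verts, p x := by
  intro x hx
  obtain ⟨W⟩ := hP.connected.preconnected ⟨x₀, hx₀⟩ ⟨x, hx⟩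
  have : ∀ (u v : P.verts) (W : P.edgeGraph.Walk u v), p u → p v := by
    intro u v W
    induction W with
    | nil => exact id
    | cons h _ ih => exact fun hu => ih (hs _ _ h.2 hu)
  exact this _ _ W h0

/-- Induction round a vertex-figure. -/
theorem vertexFigure_induction {x : E3} {p : E3 → Prop} {y₀ : E3} (hy₀ : s(x, y₀) ∈ P.edges)
    (h0 : p y₀) (hs : ∀ w, P.Tracks w → w 0 = x → p (w (-1)) → p (w 1)) :
    ∀ y, s(x, y) ∈ P.edges → p y := by
  intro y hy
  let v : P.verts := ⟨x, hP.edge_left hy⟩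
  let m : ∀ z, s(x, z) ∈ P.edges → {u : P.verts // P.edgeGraph.Adj v u} := fun z hz =>
    ⟨⟨z, hP.edge_right hz⟩, fun e => hP.edge_ne hz (congrArg Subtype.val e), hz⟩
  obtain ⟨W⟩ := (hP.vertexFigure_connected v).preconnected (m y₀ hy₀) (m y hy)
  have : ∀ (u u' : {u : P.verts // P.edgeGraph.Adj v u}) (W : (P.vertexFigure v).Walk u u'),
      p u.1 → p u'.1 := by
    intro u u' W
    induction W with
    | nil => exact id
    | @cons u w _ h _ ih =>
      refine fun hu => ih ?_
      obtain ⟨hne, F, hF, h1, h2⟩ := h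
      -- Run round the common face from `x` towards `w`; the other neighbour `u` of `x` on that face
      -- is then the point with index -1.
      obtain ⟨a, ha, rfl, a0, a1⟩ := hP.exists_tracks_start hF h2
      have ha0 : a 0 = x := a0
      have h3 : (u.1 : E3) = a (-1) := by
        rw [Sym2.eq_swap, ← a0] at h1
        refine (ha.mem_cycEdges_zero h1).resolve_left fun e => hne ?_
        exact Subtype.ext (Subtype.ext (e.trans a1))
      rw [h3] at hu
      have := hs a ha a0 hu
      rwa [a1] at this
  exact this _ _ W h0

end IsPolyhedron

end Skeletal

namespace Skeletal

variable {P : Skeletal} {w a b : ℤ → E3}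

/-! ### Automorphisms induced by permutations of space -/

theorem map_symm_eq {f : Equiv.Perm E3} (h : P.map f = P) : P.map f.symm = P := by
  conv_lhs => rw [← h]
  rw [map_map]
  convert P.map_id using 2
  funext x
  exact f.symm_apply_apply x

theorem Tracks.map (h : P.Tracks w) {f : E3 → E3} (hf : Function.Injective f) :
    (P.map f).Tracks fun i => f (w i) :=
  ⟨h.1.imp fun _ hp => hp.comp hf.injOn, _, h.2, image_cycEdges f w⟩

theorem Tracks.of_map_eq (h : P.Tracks w) {f : E3 → E3} (hf : Function.Injective f)
    (hP : P.map f = P) : P.Tracks fun i => f (w i) := by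
  have := h.map hf
  rwa [hP] at this

/-- The action of a permutation of space preserving `P` on the cells of `P`. -/
noncomputable def permAct (f : Equiv.Perm E3) (h : P.map f = P) : Cell P → Cell P
  | .vertex v => .vertex ⟨f v, (mem_of_map_eq h).1 _ v.2⟩
  | .edge e => .edge ⟨Sym2.map f e, (mem_of_map_eq h).2.1 _ e.2⟩
  | .face F => .face ⟨Sym2.map f '' F, (mem_of_map_eq h).2.2 _ F.2⟩

theorem permAct_mono (f : Equiv.Perm E3) (h : P.map f = P) {x y : Cell P} (hxy : x ≤ y) :
    permAct f h x ≤ permAct f h y := by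
  change Cell.Incident _ _
  replace hxy : Cell.Incident x y := hxy
  cases x <;> cases y <;> simp only [Cell.Incident, permAct, polygonVertices] at hxy ⊢
  · rw [hxy]
  · exact Sym2.mem_map.2 ⟨_, hxy, rfl⟩
  · obtain ⟨e, he, hv⟩ := hxy
    exact ⟨_, ⟨e, he, rfl⟩, Sym2.mem_map.2 ⟨_, hv, rfl⟩⟩
  · rw [hxy]
  · exact ⟨_, hxy, rfl⟩
  · rw [hxy]

theorem permAct_cancel (f f' : Equiv.Perm E3) (h : P.map f = P) (h' : P.map f' = P)
    (hff' : ∀ x, f (f' x) = x) (x : Cell P) : permAct f h (permAct f' h' x) = x := by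
  have key : ∀ e : Sym2 E3, Sym2.map f (Sym2.map f' e) = e := by
    intro e
    rw [Sym2.map_map, show f ∘ f' = id from funext hff', Sym2.map_id]
    rfl
  cases x with
  | vertex v => exact congrArg Cell.vertex (Subtype.ext (hff' v))
  | edge e => exact congrArg Cell.edge (Subtype.ext (key e))
  | face F =>
    refine congrArg Cell.face (Subtype.ext ?_)
    show Sym2.map f '' (Sym2.map f' '' F) = F
    simp [Set.image_image, key]

/-- The automorphism induced by a permutation of space preserving `P`. -/
noncomputable def permAut (f : Equiv.Perm E3) (h : P.map f = P) : P.Aut where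
  toFun := permAct f h
  invFun := permAct f.symm (map_symm_eq h)
  left_inv := permAct_cancel _ _ _ _ fun x => f.symm_apply_apply x
  right_inv := permAct_cancel _ _ _ _ fun x => f.apply_symm_apply x
  map_rel_iff' := by
    intro x y
    refine ⟨fun h' => ?_, fun h' => permAct_mono f h h'⟩
    have := permAct_mono f.symm (map_symm_eq h) h'
    simp only [Equiv.coe_fn_mk] at this
    rwa [permAct_cancel _ _ _ _ fun x => f.symm_apply_apply x,
      permAct_cancel _ _ _ _ fun x => f.symm_apply_apply x] at this

theorem symmetryToAut_eq_permAut (g : P.symmetryGroup)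
    {f : Equiv.Perm E3} (hf : P.map f = P) (hgf : ∀ x, (g : E3 ≃ᵢ E3) x = f x) :
    P.symmetryToAut g = permAut f hf := by
  have h : ((g : E3 ≃ᵢ E3) : E3 → E3) = f := funext hgf
  ext c
  show P.symmetryAct g c = permAct f hf c
  rcases c with v | e | F
  · exact congrArg Cell.vertex (Subtype.ext (hgf v))
  · refine congrArg Cell.edge (Subtype.ext ?_)
    show Sym2.map (g : E3 ≃ᵢ E3) e = Sym2.map f e
    rw [h]
  · refine congrArg Cell.face (Subtype.ext ?_)
    show Sym2.map (g : E3 ≃ᵢ E3) '' F = Sym2.map f '' F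
    rw [h]

theorem vertex_isMin (v : P.verts) : IsMin (Cell.vertex v) := by
  rintro (x | x | x) hx
  · exact le_of_eq (congrArg Cell.vertex (Eq.symm hx))
  · exact hx.elim
  · exact hx.elim

theorem face_isMax (F : P.faces) : IsMax (Cell.face F) := by
  rintro (x | x | x) hx
  · exact hx.elim
  · exact hx.elim
  · exact le_of_eq (congrArg Cell.face (Eq.symm hx))

/-! ### Flags -/

namespace IsPolyhedron

variable (hP : P.IsPolyhedron)

/-- The vertex of the flag given by a tracing of a face. -/
def vert (h : P.Tracks w) : Cell P := .vertex ⟨w 0, hP.vert_mem h 0⟩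

/-- The edge of the flag given by a tracing of a face. -/
def edge (h : P.Tracks w) : Cell P := .edge ⟨s(w 0, w 1), hP.edge_mem h 0⟩

/-- The face of the flag given by a tracing of a face. -/
def face (_hP : P.IsPolyhedron) (h : P.Tracks w) : Cell P := .face ⟨cycEdges w, h.2⟩

include hP

theorem exists_mem_face {F : Set (Sym2 E3)} (hF : F ∈ P.faces) : ∃ e, e ∈ F ∧ e ∈ P.edges := by
  obtain ⟨w, hw, rfl⟩ := hP.exists_tracks hF
  exact ⟨_, mem_cycEdges w 0, hP.edge_mem hw 0⟩

theorem exists_tracks_cells {v : E3} {e : Sym2 E3} {F : Set (Sym2 E3)} (hve : v ∈ e)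
    (heF : e ∈ F) (hF : F ∈ P.faces) :
    ∃ w, P.Tracks w ∧ w 0 = v ∧ s(w 0, w 1) = e ∧ cycEdges w = F := by
  obtain ⟨u, rfl⟩ := Sym2.mem_iff_exists.1 hve
  obtain ⟨w, hw, h, h0, h1⟩ := hP.exists_tracks_start hF heF
  exact ⟨w, hw, h0, by rw [h0, h1], h⟩

theorem isChain_cells (h : P.Tracks w) :
    IsChain (· ≤ ·) ({hP.vert h, hP.edge h, hP.face h} : Set (Cell P)) := by
  have h1 : hP.vert h ≤ hP.edge h := Sym2.mem_mk_left (w 0) (w 1)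
  have h2 : hP.edge h ≤ hP.face h := mem_cycEdges w 0
  rintro x (rfl | rfl | rfl) y (rfl | rfl | rfl) hxy
  exacts [(hxy rfl).elim, .inl h1, .inl (h1.trans h2), .inr h1, (hxy rfl).elim, .inl h2,
    .inr (h1.trans h2), .inr h2, (hxy rfl).elim]

/-- A chain has at most one cell of each kind. Missing cells can be filled in: every edge has ends
and lies in a face, every vertex lies on an edge, every face contains an edge, and a vertex of a
face lies on an edge of that face. -/
theorem exists_superset_of_isChain {C : Set (Cell P)} (hC : IsChain (· ≤ ·) C) :
    ∃ w, ∃ h : P.Tracks w, C ⊆ {hP.vert h, hP.edge h, hP.face h} := by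
  have hcomp : ∀ x ∈ C, ∀ y ∈ C, Cell.Incident x y ∨ Cell.Incident y x := fun x hx y hy =>
    hC.total hx hy
  have hv : ∃ v : E3, ∃ e : Sym2 E3, ∃ F : Set (Sym2 E3), v ∈ e ∧ e ∈ F ∧ F ∈ P.faces ∧
      (∀ x, Cell.vertex x ∈ C → (x : E3) = v) ∧ (∀ x, Cell.edge x ∈ C → (x : Sym2 E3) = e) ∧
      (∀ x, Cell.face x ∈ C → (x : Set (Sym2 E3)) = F) := by
    have uV : ∀ x y, Cell.vertex x ∈ C → Cell.vertex y ∈ C → (x : E3) = y := fun x y hx hy =>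
      (hcomp _ hx _ hy).elim (congrArg _) fun h => congrArg _ (Eq.symm h)
    have uE : ∀ x y, Cell.edge x ∈ C → Cell.edge y ∈ C → (x : Sym2 E3) = y := fun x y hx hy =>
      (hcomp _ hx _ hy).elim (congrArg _) fun h => congrArg _ (Eq.symm h)
    have uF : ∀ x y, Cell.face x ∈ C → Cell.face y ∈ C → (x : Set (Sym2 E3)) = y :=
      fun x y hx hy =>
        (hcomp _ hx _ hy).elim (congrArg _) fun h => congrArg _ (Eq.symm h)
    have iVE : ∀ x y, Cell.vertex x ∈ C → Cell.edge y ∈ C → (x : E3) ∈ (y : Sym2 E3) :=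
      fun x y hx hy => (hcomp _ hx _ hy).elim id False.elim
    have iEF : ∀ x y, Cell.edge x ∈ C → Cell.face y ∈ C →
        (x : Sym2 E3) ∈ (y : Set (Sym2 E3)) :=
      fun x y hx hy => (hcomp _ hx _ hy).elim id False.elim
    have iVF : ∀ x y, Cell.vertex x ∈ C → Cell.face y ∈ C →
        (x : E3) ∈ polygonVertices (y : Set (Sym2 E3)) :=
      fun x y hx hy => (hcomp _ hx _ hy).elim id False.elim
    by_cases hE : ∃ e, Cell.edge e ∈ C
    · obtain ⟨e, he⟩ := hE
      obtain ⟨v, hve, hv⟩ : ∃ v : E3, v ∈ (e : Sym2 E3) ∧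
          ∀ x, Cell.vertex x ∈ C → (x : E3) = v := by
        by_cases hV : ∃ v, Cell.vertex v ∈ C
        · obtain ⟨v, hv⟩ := hV
          exact ⟨v, iVE v e hv he, fun x hx => uV x v hx hv⟩
        · push Not at hV
          exact ⟨_, Sym2.out_fst_mem _, fun x hx => (hV x hx).elim⟩
      obtain ⟨F, hF, heF, hFu⟩ : ∃ F ∈ P.faces, (e : Sym2 E3) ∈ F ∧
          ∀ x, Cell.face x ∈ C → (x : Set (Sym2 E3)) = F := by
        by_cases hV : ∃ F, Cell.face F ∈ C
        · obtain ⟨F, hF⟩ := hV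
          exact ⟨F, F.2, iEF e F he hF, fun x hx => uF x F hx hF⟩
        · push Not at hV
          obtain ⟨F, hF, heF⟩ := hP.exists_face e.2
          exact ⟨F, hF, heF, fun x hx => (hV x hx).elim⟩
      exact ⟨v, e, F, hve, heF, hF, hv, fun x hx => uE x e hx he, hFu⟩
    · push Not at hE
      by_cases hV : ∃ v, Cell.vertex v ∈ C
      · obtain ⟨v, hv⟩ := hV
        by_cases hF : ∃ F, Cell.face F ∈ C
        · obtain ⟨F, hF⟩ := hF
          -- Here the edge must be compatible with both the vertex and the face of the chain.
          obtain ⟨e, heF, hve⟩ := iVF v F hv hF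
          exact ⟨v, e, F, hve, heF, F.2, fun x hx => uV x v hx hv, fun x hx => (hE x hx).elim,
            fun x hx => uF x F hx hF⟩
        · push Not at hF
          obtain ⟨y, hy⟩ := hP.exists_edge v.2
          obtain ⟨F, hFF, heF⟩ := hP.exists_face hy
          exact ⟨v, _, F, Sym2.mem_mk_left _ _, heF, hFF, fun x hx => uV x v hx hv,
            fun x hx => (hE x hx).elim, fun x hx => (hF x hx).elim⟩
      · push Not at hV
        obtain ⟨F, hF, hFu⟩ : ∃ F ∈ P.faces, ∀ x, Cell.face x ∈ C → (x : Set (Sym2 E3)) = F := by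
          by_cases hF : ∃ F, Cell.face F ∈ C
          · obtain ⟨F, hF⟩ := hF
            exact ⟨F, F.2, fun x hx => uF x F hx hF⟩
          · push Not at hF
            obtain ⟨v⟩ := hP.connected.nonempty
            obtain ⟨y, hy⟩ := hP.exists_edge v.2
            obtain ⟨F, hFF, -⟩ := hP.exists_face hy
            exact ⟨F, hFF, fun x hx => (hF x hx).elim⟩
        obtain ⟨e, heF, he⟩ := hP.exists_mem_face hF
        exact ⟨_, e, F, Sym2.out_fst_mem _, heF, hF, fun x hx => (hV x hx).elim,
          fun x hx => (hE x hx).elim, hFu⟩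
  obtain ⟨v, e, F, hve, heF, hF, h1, h2, h3⟩ := hv
  obtain ⟨w, hw, rfl, rfl, rfl⟩ := hP.exists_tracks_cells hve heF hF
  refine ⟨w, hw, ?_⟩
  rintro (x | x | x) hx
  · exact Or.inl (congrArg Cell.vertex (Subtype.ext (h1 x hx)))
  · exact Or.inr (Or.inl (congrArg Cell.edge (Subtype.ext (h2 x hx))))
  · exact Or.inr (Or.inr (congrArg Cell.face (Subtype.ext (h3 x hx))))

/-- Flags are given by tracings of faces. -/
theorem exists_tracks_flag (Φ : Flag (Cell P)) :
    ∃ w, ∃ h : P.Tracks w, (Φ : Set (Cell P)) = {hP.vert h, hP.edge h, hP.face h} := by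
  obtain ⟨w, h, hs⟩ := hP.exists_superset_of_isChain Φ.chain_le
  exact ⟨w, h, Φ.maxChain.2 (hP.isChain_cells h) hs⟩

theorem smul_flag_eq {Φ Ψ : Flag (Cell P)} {ha : P.Tracks a} {hb : P.Tracks b}
    (hΦ : (Φ : Set (Cell P)) = {hP.vert ha, hP.edge ha, hP.face ha})
    (hΨ : (Ψ : Set (Cell P)) = {hP.vert hb, hP.edge hb, hP.face hb}) {γ : P.Aut}
    (h1 : γ (hP.vert ha) = hP.vert hb) (h2 : γ (hP.edge ha) = hP.edge hb)
    (h3 : γ (hP.face ha) = hP.face hb) : γ • Φ = Ψ := by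
  apply SetLike.coe_injective
  rw [Flag.coe_smul, hΦ, hΨ, ← h1, ← h2, ← h3]
  ext x
  simp [Set.mem_smul_set, eq_comm]

/-- `γ` maps the flag of the tracing `a` to that of `b`. -/
def Carries (γ : P.Aut) (ha : P.Tracks a) (hb : P.Tracks b) : Prop :=
  γ (hP.vert ha) = hP.vert hb ∧ γ (hP.edge ha) = hP.edge hb ∧ γ (hP.face ha) = hP.face hb

theorem permAut_carries {f : Equiv.Perm E3} (h : P.map f = P) (ha : P.Tracks a) (hb : P.Tracks b)
    (hab : ∀ i, f (a i) = b i) : hP.Carries (permAut f h) ha hb := by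
  refine ⟨congrArg Cell.vertex (Subtype.ext (hab 0)), congrArg Cell.edge (Subtype.ext ?_),
    congrArg Cell.face (Subtype.ext ?_)⟩
  · show s(f (a 0), f (a 1)) = s(b 0, b 1)
    rw [hab, hab]
  · show Sym2.map f '' cycEdges a = _
    rw [image_cycEdges]
    simp only [hab]

/-! ### Automorphisms are determined by their effect on a flag -/

theorem edge_not_isMin (e : P.edges) : ¬ IsMin (Cell.edge e) := fun h =>
  h (b := Cell.vertex ⟨_, (hP.edge_spec _ e.2).2 _ (Sym2.out_fst_mem _)⟩) (Sym2.out_fst_mem _)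

theorem edge_not_isMax (e : P.edges) : ¬ IsMax (Cell.edge e) := fun h => by
  obtain ⟨F, hF, he⟩ := hP.exists_face e.2
  exact h (b := Cell.face ⟨F, hF⟩) he

theorem face_not_isMin (F : P.faces) : ¬ IsMin (Cell.face F) := fun h => by
  obtain ⟨e, heF, he⟩ := hP.exists_mem_face F.2
  exact h (b := Cell.edge ⟨e, he⟩) heF

theorem vertex_not_isMax (v : P.verts) : ¬ IsMax (Cell.vertex v) := fun h => by
  obtain ⟨y, hy⟩ := hP.exists_edge v.2
  exact h (b := Cell.edge ⟨_, hy⟩) (Sym2.mem_mk_left _ _)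

/-- Order automorphisms respect the kind of a cell: vertices are the minimal elements, faces the
maximal ones, and edges are neither. -/
theorem exists_apply_vertex (γ : P.Aut) (v : P.verts) : ∃ x, γ (.vertex v) = .vertex x := by
  have h := (γ.isMin_apply).2 (vertex_isMin v)
  rcases hx : γ (.vertex v) with x | x | x
  · exact ⟨x, rfl⟩
  · exact (hP.edge_not_isMin x (hx ▸ h)).elim
  · exact (hP.face_not_isMin x (hx ▸ h)).elim

theorem exists_apply_face (γ : P.Aut) (F : P.faces) : ∃ x, γ (.face F) = .face x := by
  have h := (γ.isMax_apply).2 (face_isMax F)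
  rcases hx : γ (.face F) with x | x | x
  · exact (hP.vertex_not_isMax x (hx ▸ h)).elim
  · exact (hP.edge_not_isMax x (hx ▸ h)).elim
  · exact ⟨x, rfl⟩

theorem exists_apply_edge (γ : P.Aut) (e : P.edges) : ∃ x, γ (.edge e) = .edge x := by
  rcases hx : γ (.edge e) with x | x | x
  · refine (hP.edge_not_isMin e ((γ.isMin_apply).1 ?_)).elim
    exact hx ▸ vertex_isMin x
  · exact ⟨x, rfl⟩
  · refine (hP.edge_not_isMax e ((γ.isMax_apply).1 ?_)).elim
    exact hx ▸ face_isMax x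

theorem exists_carries (γ : P.Aut) (ha : P.Tracks a) :
    ∃ b, ∃ hb : P.Tracks b, hP.Carries γ ha hb := by
  obtain ⟨v, hv⟩ := hP.exists_apply_vertex γ ⟨a 0, hP.vert_mem ha 0⟩
  obtain ⟨e, he⟩ := hP.exists_apply_edge γ ⟨s(a 0, a 1), hP.edge_mem ha 0⟩
  obtain ⟨F, hF⟩ := hP.exists_apply_face γ ⟨cycEdges a, ha.2⟩
  have h1 : γ (hP.vert ha) ≤ γ (hP.edge ha) := γ.monotone (Sym2.mem_mk_left (a 0) (a 1))
  have h2 : γ (hP.edge ha) ≤ γ (hP.face ha) := γ.monotone (mem_cycEdges a 0)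
  rw [vert, edge, hv, he] at h1
  rw [edge, face, he, hF] at h2
  obtain ⟨b, hb, h3, h4, h5⟩ := hP.exists_tracks_cells h1 h2 F.2
  exact ⟨b, hb, hv.trans (congrArg Cell.vertex (Subtype.ext h3.symm)),
    he.trans (congrArg Cell.edge (Subtype.ext h4.symm)),
    hF.trans (congrArg Cell.face (Subtype.ext h5.symm))⟩

/-- This lemma and `fix_rotate`, `fix_across` pass from a fixed flag to those that differ in its
vertex, edge or face. Each time only two cells can fill the place; the old one is fixed, so by
injectivity the new one is fixed as well. -/
theorem fix_opposite {γ : P.Aut} (h : P.Tracks w) (hγ : hP.Carries γ h h) :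
    hP.Carries γ (h.reflect 1) (h.reflect 1) := by
  have hE : hP.edge (h.reflect 1) = hP.edge h :=
    congrArg Cell.edge (Subtype.ext (by simp [Sym2.eq_swap]))
  refine ⟨?_, by rw [hE, hγ.2.1], ?_⟩
  · obtain ⟨x, hx⟩ := hP.exists_apply_vertex γ ⟨w (1 - 0), hP.vert_mem h (1 - 0)⟩
    have h1 : γ (hP.vert (h.reflect 1)) ≤ γ (hP.edge h) :=
      γ.monotone (by
        show w (1 - 0) ∈ s(w 0, w 1)
        simp)
    rw [vert, hx, hγ.2.1] at h1
    rw [vert, hx]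
    refine congrArg Cell.vertex (Subtype.ext ?_)
    rcases Sym2.mem_iff.1 (h1 : (x : E3) ∈ s(w 0, w 1)) with h2 | h2
    · exfalso
      have h3 : Cell.vertex x = hP.vert h := congrArg Cell.vertex (Subtype.ext h2)
      have h4 := congrArg Subtype.val
        (Cell.vertex.inj (γ.injective (hx.trans (h3.trans hγ.1.symm))))
      exact h.ne_succ 0 (by simpa using h4.symm)
    · simpa using h2
  · have hF : hP.face (h.reflect 1) = hP.face h :=
      congrArg Cell.face (Subtype.ext (cycEdges_reflect w 1))
    rw [hF, hγ.2.2]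

theorem fix_rotate {γ : P.Aut} (h : P.Tracks w) (hγ : hP.Carries γ h h) :
    hP.Carries γ (h.reflect 0) (h.reflect 0) := by
  have hV : hP.vert (h.reflect 0) = hP.vert h :=
    congrArg Cell.vertex (Subtype.ext (by simp))
  have hF : hP.face (h.reflect 0) = hP.face h :=
    congrArg Cell.face (Subtype.ext (cycEdges_reflect w 0))
  refine ⟨by rw [hV, hγ.1], ?_, by rw [hF, hγ.2.2]⟩
  obtain ⟨x, hx⟩ := hP.exists_apply_edge γ ⟨s(w (0 - 0), w (0 - 1)), hP.edge_mem (h.reflect 0) 0⟩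
  have h1 : γ (hP.vert h) ≤ γ (hP.edge (h.reflect 0)) :=
    γ.monotone (by
      show w 0 ∈ s(w (0 - 0), w (0 - 1))
      simp)
  have h2 : γ (hP.edge (h.reflect 0)) ≤ γ (hP.face h) := γ.monotone (by
    show s(w (0 - 0), w (0 - 1)) ∈ cycEdges w
    exact mem_cycEdges_symm (by ring))
  rw [hγ.1, edge, hx] at h1
  rw [hγ.2.2, edge, hx] at h2
  replace h1 : w 0 ∈ (x : Sym2 E3) := h1
  replace h2 : (x : Sym2 E3) ∈ cycEdges w := h2
  rw [edge, hx]
  refine congrArg Cell.edge (Subtype.ext ?_)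
  obtain ⟨y, hy⟩ := Sym2.mem_iff_exists.1 h1
  rw [hy] at h2
  rw [hy]
  rcases h.mem_cycEdges_zero h2 with rfl | rfl
  · exfalso
    have h3 : Cell.edge x = hP.edge h := congrArg Cell.edge (Subtype.ext hy)
    have h4 := congrArg Subtype.val (Cell.edge.inj (γ.injective (hx.trans (h3.trans hγ.2.1.symm))))
    rcases Sym2.eq_iff.1 h4 with ⟨-, h5⟩ | ⟨h5, -⟩
    · exact h.ne_neg_one (by simpa using h5.symm)
    · exact h.ne_succ 0 (by simpa using h5)
  · simp

theorem fix_across {γ : P.Aut} (ha : P.Tracks a) (hb : P.Tracks b) (h0 : a 0 = b 0)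
    (h1 : a 1 = b 1) (hγ : hP.Carries γ ha ha) : hP.Carries γ hb hb := by
  have hV : hP.vert hb = hP.vert ha := congrArg Cell.vertex (Subtype.ext h0.symm)
  have hE : hP.edge hb = hP.edge ha := congrArg Cell.edge (Subtype.ext (by
    simp [h0, h1]))
  refine ⟨by rw [hV, hγ.1], by rw [hE, hγ.2.1], ?_⟩
  obtain ⟨F, hF⟩ := hP.exists_apply_face γ ⟨cycEdges b, hb.2⟩
  have h2 : γ (hP.edge hb) ≤ γ (hP.face hb) := γ.monotone (mem_cycEdges b 0)
  rw [hE, hγ.2.1, face, hF] at h2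
  replace h2 : s(a 0, a 1) ∈ (F : Set (Sym2 E3)) := h2
  rw [face, hF]
  refine congrArg Cell.face (Subtype.ext ?_)
  show (F : Set (Sym2 E3)) = cycEdges b
  obtain ⟨G, hG, heG, hne, hu⟩ := hP.exists_other (hP.edge_mem ha 0) ha.2 (mem_cycEdges a 0)
  have hb' := hu _ hb.2 (by
    show s(a 0, a 1) ∈ _
    rw [h0, h1]
    exact mem_cycEdges b 0)
  -- If the image is the fixed face of `a`, injectivity identifies the faces of `a` and `b`.
  -- Otherwise it is the other face `G` on the edge, and `b` runs round `a`'s face, which is fixed,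
  -- or round `G` itself.
  rcases hu _ F.2 h2 with h3 | h3
  · have h4 : Cell.face F = hP.face ha := congrArg Cell.face (Subtype.ext h3)
    have h5 := congrArg Subtype.val (Cell.face.inj (γ.injective (hF.trans (h4.trans hγ.2.2.symm))))
    rw [h3]
    exact h5.symm
  · rcases hb' with h4 | h4
    · have h5 : hP.face hb = hP.face ha := congrArg Cell.face (Subtype.ext h4)
      have h6 := hγ.2.2
      rw [← h5, face, hF] at h6
      exact congrArg Subtype.val (Cell.face.inj h6)
    · rw [h3, h4]

/-- An automorphism fixing a flag is trivial. -/
theorem eq_one_of_carries {γ : P.Aut} (h : P.Tracks w) (hγ : hP.Carries γ h h) : γ = 1 := by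
  -- One fixed flag at `x` makes all flags at `x` fixed: rotate in a face, cross the new edge, and
  -- repeat round the connected vertex-figure.
  have hvert : ∀ x, (∃ a, ∃ ha : P.Tracks a, a 0 = x ∧ hP.Carries γ ha ha) →
      ∀ b, ∀ hb : P.Tracks b, b 0 = x → hP.Carries γ hb hb := by
    rintro x ⟨a, ha, rfl, hga⟩
    have := hP.vertexFigure_induction (x := a 0) (y₀ := a 1)
      (p := fun y => ∀ b, ∀ hb : P.Tracks b, b 0 = a 0 → b 1 = y → hP.Carries γ hb hb)
      (hP.edge_mem ha 0) (fun b hb h0 h1 => hP.fix_across ha hb h0.symm h1.symm hga) ?_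
    · exact fun b hb h0 => this (b 1) (h0 ▸ hP.edge_mem hb 0) b hb h0 rfl
    · intro c hc hc0 hp b hb h0 h1
      have h2 := hP.fix_rotate _ (hp _ (hc.reflect 0) (by simpa using hc0) (by simp))
      exact hP.fix_across _ hb (by simpa [hc0] using h0.symm) (by simpa using h1.symm) h2
  -- The property of a vertex spreads along edges, since a fixed flag can be turned over to the
  -- other end of its edge.
  have hall : ∀ a, ∀ ha : P.Tracks a, hP.Carries γ ha ha := by
    have := hP.edge_induction (p := fun x => ∀ b, ∀ hb : P.Tracks b, b 0 = x →
      hP.Carries γ hb hb) (hP.vert_mem h 0) (hvert _ ⟨w, h, rfl, hγ⟩) ?_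
    · exact fun a ha => this _ (hP.vert_mem ha 0) a ha rfl
    · intro x y hxy hx
      obtain ⟨a, ha, h0, h1⟩ := hP.exists_tracks_edge hxy
      exact hvert y ⟨_, ha.reflect 1, by simpa using h1, hP.fix_opposite ha (hx a ha h0)⟩
  ext c
  show γ c = c
  rcases c with v | e | F
  · obtain ⟨y, hy⟩ := hP.exists_edge v.2
    obtain ⟨a, ha, h0, -⟩ := hP.exists_tracks_edge hy
    have hv : hP.vert ha = .vertex v := congrArg Cell.vertex (Subtype.ext h0)
    rw [← hv, (hall a ha).1]
  · obtain ⟨e, he⟩ := e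
    induction e with
    | _ x y =>
      obtain ⟨a, ha, h0, h1⟩ := hP.exists_tracks_edge he
      have hv : hP.edge ha = .edge ⟨s(x, y), he⟩ :=
        congrArg Cell.edge (Subtype.ext (by
    simp [h0, h1]))
      rw [← hv, (hall a ha).2.1]
  · obtain ⟨a, ha, h0⟩ := hP.exists_tracks F.2
    have hv : hP.face ha = .face F := congrArg Cell.face (Subtype.ext h0)
    rw [← hv, (hall a ha).2.2]

theorem eq_of_carries {γ δ : P.Aut} (ha : P.Tracks a) (hb : P.Tracks b) (hγ : hP.Carries γ ha hb)
    (hδ : hP.Carries δ ha hb) : γ = δ := by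
  have : δ⁻¹ * γ = 1 := by
    refine hP.eq_one_of_carries ha ⟨?_, ?_, ?_⟩
    · rw [RelIso.mul_apply, hγ.1, ← hδ.1, RelIso.inv_apply_self]
    · rw [RelIso.mul_apply, hγ.2.1, ← hδ.2.1, RelIso.inv_apply_self]
    · rw [RelIso.mul_apply, hγ.2.2, ← hδ.2.2, RelIso.inv_apply_self]
  exact (inv_mul_eq_one.1 this).symm

/-- It suffices to reach every flag from one base flag: any two flags are then related through it.
-/
theorem isRegular_of_forall_tracks (h : P.Tracks w)
    (htrans : ∀ a, P.Tracks a → ∃ L : E3 ≃ₗᵢ[ℝ] E3, P.map L = P ∧ ∀ i, L (w i) = a i) :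
    P.IsRegular := by
  have key : ∀ a, ∀ ha : P.Tracks a, ∃ g : P.symmetryGroup,
      hP.Carries (P.symmetryToAut g) h ha := by
    intro a ha
    obtain ⟨L, hL, hLa⟩ := htrans a ha
    refine ⟨⟨L.toIsometryEquiv, hL⟩, ?_⟩
    rw [symmetryToAut_eq_permAut ⟨L.toIsometryEquiv, hL⟩ (f := L.toEquiv) hL fun _ => rfl]
    exact hP.permAut_carries _ h ha hLa
  refine ⟨hP, fun Φ Ψ => ?_⟩
  obtain ⟨a, ha, hΦ⟩ := hP.exists_tracks_flag Φ
  obtain ⟨b, hb, hΨ⟩ := hP.exists_tracks_flag Ψ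
  obtain ⟨g, hg⟩ := key a ha
  obtain ⟨g', hg'⟩ := key b hb
  refine ⟨g' * g⁻¹, ?_⟩
  rw [map_mul, map_inv]
  refine hP.smul_flag_eq hΦ hΨ ?_ ?_ ?_
  · rw [RelIso.mul_apply, ← hg.1, RelIso.inv_apply_self, hg'.1]
  · rw [RelIso.mul_apply, ← hg.2.1, RelIso.inv_apply_self, hg'.2.1]
  · rw [RelIso.mul_apply, ← hg.2.2, RelIso.inv_apply_self, hg'.2.2]

theorem isCombinatoriallyRegular_of_forall_tracks (h : P.Tracks w)
    (htrans : ∀ a, P.Tracks a → ∃ f : Equiv.Perm E3, P.map f = P ∧ ∀ i, f (w i) = a i) :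
    P.IsCombinatoriallyRegular := by
  refine ⟨hP, fun Φ Ψ => ?_⟩
  obtain ⟨a, ha, hΦ⟩ := hP.exists_tracks_flag Φ
  obtain ⟨b, hb, hΨ⟩ := hP.exists_tracks_flag Ψ
  obtain ⟨f, hf, hfa⟩ := htrans a ha
  obtain ⟨f', hf', hfb⟩ := htrans b hb
  have hg := hP.permAut_carries hf h ha hfa
  have hg' := hP.permAut_carries hf' h hb hfb
  refine ⟨permAut f' hf' * (permAut f hf)⁻¹, hP.smul_flag_eq hΦ hΨ ?_ ?_ ?_⟩
  · rw [RelIso.mul_apply, ← hg.1, RelIso.inv_apply_self, hg'.1]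
  · rw [RelIso.mul_apply, ← hg.2.1, RelIso.inv_apply_self, hg'.2.1]
  · rw [RelIso.mul_apply, ← hg.2.2, RelIso.inv_apply_self, hg'.2.2]

end IsPolyhedron

end Skeletal

/-! ### Isometries mapping one centred finite set to another -/

/-- An isometry is a linear isometry followed by the translation by `g 0`, so the image of a set
with sum `0` has sum `card • r • g 0`. -/
theorem apply_zero_of_centred {V V' : Set E3} (hfin : V.Finite) (hne : V.Nonempty)
    (hV : ∑ᶠ x ∈ V, x = 0) (hV' : ∑ᶠ x ∈ V', x = 0) {r : ℝ} (hr : r ≠ 0) (g : E3 ≃ᵢ E3)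
    (hg : (fun x => r • g x) '' V = V') : g 0 = 0 := by
  have hinj : Function.Injective fun x => r • g x := fun x y h =>
    g.injective (smul_right_injective E3 hr h)
  rw [← hg, finsum_mem_image hinj.injOn, finsum_mem_eq_finite_toFinset_sum _ hfin] at hV'
  rw [finsum_mem_eq_finite_toFinset_sum _ hfin] at hV
  have hlin : ∀ x, g x = g.toRealLinearIsometryEquiv x + g 0 := fun x => by simp
  have h1 : ∑ x ∈ hfin.toFinset, r • g x = r • (hfin.toFinset.card • g 0) := by
    rw [← Finset.smul_sum]
    congr 1
    rw [Finset.sum_congr rfl fun x _ => hlin x, Finset.sum_add_distrib, ← map_sum, hV, map_zero,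
      zero_add, Finset.sum_const]
  rw [h1, smul_eq_zero_iff_right hr] at hV'
  have hc : hfin.toFinset.card ≠ 0 := by
    simpa [Finset.card_eq_zero] using hne.ne_empty
  rw [← Nat.cast_smul_eq_nsmul ℝ] at hV'
  exact (smul_eq_zero_iff_right (Nat.cast_ne_zero.2 hc)).1 hV'

theorem norm_apply_of_centred {V V' : Set E3} (hfin : V.Finite) (hne : V.Nonempty)
    (hV : ∑ᶠ x ∈ V, x = 0) (hV' : ∑ᶠ x ∈ V', x = 0) {r : ℝ} (hr : r ≠ 0) (g : E3 ≃ᵢ E3)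
    (hg : (fun x => r • g x) '' V = V') (x : E3) : ‖g x‖ = ‖x‖ := by
  have h0 := apply_zero_of_centred hfin hne hV hV' hr g hg
  have := g.isometry.dist_eq x 0
  rwa [h0, dist_zero_right, dist_zero_right] at this

/-! ### Polyhedra on two concentric spheres: index, vertex orbits, similarity -/

namespace Skeletal

variable {P : Skeletal} {w a b : ℤ → E3}

theorem norm_apply_of_mem_symmetryGroup (hP : P.IsPolyhedron) (hsum : ∑ᶠ x ∈ P.verts, x = 0)
    {g : E3 ≃ᵢ E3} (hg : g ∈ P.symmetryGroup) (x : E3) : ‖g x‖ = ‖x‖ := by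
  obtain ⟨v⟩ := hP.connected.nonempty
  refine norm_apply_of_centred hP.finite_verts ⟨v, v.2⟩ hsum hsum one_ne_zero g ?_ x
  simp only [one_smul]
  exact congrArg Skeletal.verts (show P.map g = P from hg)

/-- A polyhedron with vertices on two concentric spheres, whose edges join the two spheres. -/
structure TwoLayered (P : Skeletal) (A B : Set E3) (r s : ℝ) : Prop where
  poly : P.IsPolyhedron
  verts_eq : P.verts = A ∪ B
  norm_left : ∀ x ∈ A, ‖x‖ = r
  norm_right : ∀ x ∈ B, ‖x‖ = s
  radii_ne : r ≠ s
  sum_eq : ∑ᶠ x ∈ P.verts, x = 0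
  edge_left : ∀ x y, s(x, y) ∈ P.edges → x ∈ A → y ∈ B
  edge_right : ∀ x y, s(x, y) ∈ P.edges → x ∈ B → y ∈ A

namespace TwoLayered

variable {A B : Set E3} {r s : ℝ} (hP : P.TwoLayered A B r s) (hw : P.Tracks w) (hwA : w 0 ∈ A)
  (hA : ∀ a, P.Tracks a → a 0 ∈ A → ∃ L : E3 ≃ₗᵢ[ℝ] E3, P.map L = P ∧ ∀ i, L (w i) = a i)
  (hB : ∀ a, P.Tracks a → a 0 ∈ B → ∃ f : Equiv.Perm E3, P.map f = P ∧ ∀ i, f (w i) = a i)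

include hP in
theorem norm_mem {x : E3} (hx : x ∈ P.verts) : (x ∈ A ∧ ‖x‖ = r) ∨ (x ∈ B ∧ ‖x‖ = s) := by
  rw [hP.verts_eq] at hx
  exact hx.imp (fun h => ⟨h, hP.norm_left _ h⟩) fun h => ⟨h, hP.norm_right _ h⟩

include hP in
theorem mem_left {x : E3} (hx : x ∈ P.verts) (h : ‖x‖ = r) : x ∈ A :=
  (hP.norm_mem hx).elim And.left fun h' => (hP.radii_ne (h.symm.trans h'.2)).elim

include hP in
theorem mem_right {x : E3} (hx : x ∈ P.verts) (h : ‖x‖ = s) : x ∈ B :=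
  (hP.norm_mem hx).elim (fun h' => (hP.radii_ne (h'.2.symm.trans h)).elim) And.left

include hP hw hwA hA hB in
-- An automorphism that keeps `w 0` in `A` is induced by an isometry, as one with the same effect on
-- the base flag exists; one induced by an isometry preserves norms and cannot move `w 0` to `B`.
theorem isRegularOfIndexTwo : P.IsRegularOfIndexTwo := by
  refine ⟨hP.poly.isCombinatoriallyRegular_of_forall_tracks hw fun a ha => ?_, ?_⟩
  · rcases hP.norm_mem (hP.poly.vert_mem ha 0) with h | h
    · obtain ⟨L, hL, hLa⟩ := hA a ha h.1
      exact ⟨L.toEquiv, hL, hLa⟩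
    · exact hB a ha h.1
  · have hgeom : ∀ γ : P.Aut, ∀ x : P.verts, γ (hP.poly.vert hw) = .vertex x → (x : E3) ∈ A →
        γ ∈ P.symmetryToAut.range := by
      intro γ x hx hxA
      obtain ⟨b, hb, hγ⟩ := hP.poly.exists_carries γ hw
      have hbx : b 0 = x := congrArg Subtype.val (Cell.vertex.inj (hγ.1.symm.trans hx))
      obtain ⟨L, hL, hLa⟩ := hA b hb (hbx ▸ hxA)
      refine ⟨⟨L.toIsometryEquiv, hL⟩, ?_⟩
      rw [symmetryToAut_eq_permAut ⟨L.toIsometryEquiv, hL⟩ (f := L.toEquiv) hL fun _ => rfl]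
      exact hP.poly.eq_of_carries hw hb (hP.poly.permAut_carries (f := L.toEquiv) hL hw hb hLa) hγ
    have hw1 : w 1 ∈ B := hP.edge_left _ _ (hP.poly.edge_mem hw 0) hwA
    -- The tracing advanced by one step starts in `B`; the permutation reaching it represents the
    -- nontrivial coset.
    obtain ⟨f, hf, hfw⟩ := hB _ (hw.shift 1) (by simpa using hw1)
    have hf0 : f (w 0) = w 1 := by simpa using hfw 0
    unfold index
    rw [Subgroup.index_eq_two_iff_exists_notMem_and]
    refine ⟨permAut f hf, ?_, fun γ => ?_⟩
    · rintro ⟨g, hg⟩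
      have h1 : (g : E3 ≃ᵢ E3) (w 0) = f (w 0) :=
        congrArg Subtype.val (Cell.vertex.inj (DFunLike.congr_fun hg (hP.poly.vert hw)))
      have h2 := norm_apply_of_mem_symmetryGroup hP.poly hP.sum_eq g.2 (w 0)
      rw [h1, hf0, hP.norm_left _ hwA, hP.norm_right _ hw1] at h2
      exact hP.radii_ne h2.symm
    · obtain ⟨x, hx⟩ := hP.poly.exists_apply_vertex γ ⟨w 0, hP.poly.vert_mem hw 0⟩
      obtain ⟨y, hy⟩ := hP.poly.exists_apply_vertex γ ⟨w 1, hP.poly.vert_mem hw 1⟩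
      obtain ⟨e, he⟩ := hP.poly.exists_apply_edge γ ⟨s(w 0, w 1), hP.poly.edge_mem hw 0⟩
      have hxe : γ (.vertex ⟨w 0, hP.poly.vert_mem hw 0⟩) ≤
          γ (.edge ⟨s(w 0, w 1), hP.poly.edge_mem hw 0⟩) := γ.monotone (Sym2.mem_mk_left _ _)
      have hye : γ (.vertex ⟨w 1, hP.poly.vert_mem hw 1⟩) ≤
          γ (.edge ⟨s(w 0, w 1), hP.poly.edge_mem hw 0⟩) := γ.monotone (Sym2.mem_mk_right _ _)
      rw [hx, he] at hxe
      rw [hy, he] at hye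
      replace hxe : (x : E3) ∈ (e : Sym2 E3) := hxe
      replace hye : (y : E3) ∈ (e : Sym2 E3) := hye
      have hxy : (x : E3) ≠ y := by
        intro h
        rw [Subtype.ext h, ← hy] at hx
        exact hw.ne_succ 0 (congrArg Subtype.val (Cell.vertex.inj (γ.injective hx)))
      have hxye : s((x : E3), (y : E3)) ∈ P.edges := by
        rw [← (Sym2.mem_and_mem_iff hxy).1 ⟨hxe, hye⟩]
        exact e.2
      rcases hP.norm_mem x.2 with h | h
      · exact Or.inr (hgeom γ x hx h.1)
      -- Since `f` sends `w 0` to `w 1`, the product sends `w 0` to `y`, which is joined to `x ∈ B`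
      -- by an edge and so lies in `A`.
      · refine Or.inl (hgeom _ y ?_ (hP.edge_right _ _ hxye h.1))
        rw [RelIso.mul_apply, ← hy]
        exact congrArg γ (congrArg Cell.vertex (Subtype.ext hf0))

include hP hw hwA hA in
theorem vertexOrbits_ncard : P.vertexOrbits.ncard = 2 := by
  have hw1 : w 1 ∈ B := hP.edge_left _ _ (hP.poly.edge_mem hw 0) hwA
  have hrepA : ∀ x ∈ A, ∃ g ∈ P.symmetryGroup, g (w 0) = x := by
    intro x hx
    obtain ⟨y, hy⟩ := hP.poly.exists_edge (show x ∈ P.verts by rw [hP.verts_eq]; exact .inl hx)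
    obtain ⟨a, ha, h0, -⟩ := hP.poly.exists_tracks_edge hy
    obtain ⟨L, hL, hLa⟩ := hA a ha (h0 ▸ hx)
    exact ⟨L.toIsometryEquiv, hL, (hLa 0).trans h0⟩
  have hrepB : ∀ x ∈ B, ∃ g ∈ P.symmetryGroup, g (w 1) = x := by
    intro x hx
    obtain ⟨y, hy⟩ := hP.poly.exists_edge (show x ∈ P.verts by rw [hP.verts_eq]; exact .inr hx)
    obtain ⟨a, ha, h0, h1⟩ := hP.poly.exists_tracks_edge hy
    -- A tracing that starts in `B` starts in `A` when its first edge is reversed; then `x` is its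
    -- second point, the image of `w 1`.
    obtain ⟨L, hL, hLa⟩ := hA _ (ha.reflect 1) (by
      have := hP.edge_right _ _ hy hx
      simpa [h1] using this)
    exact ⟨L.toIsometryEquiv, hL, (hLa 1).trans (by simpa using h0)⟩
  have hmem : ∀ g ∈ P.symmetryGroup, ∀ v ∈ P.verts, g v ∈ P.verts := fun g hg v hv =>
    (mem_of_map_eq (show P.map g = P from hg)).1 v hv
  have horbA : ∀ v ∈ A, {x | ∃ g ∈ P.symmetryGroup, g v = x} = A := by
    intro v hv
    ext x
    constructor
    · rintro ⟨g, hg, rfl⟩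
      refine hP.mem_left (hmem g hg v ?_) ?_
      · rw [hP.verts_eq]; exact .inl hv
      · rw [norm_apply_of_mem_symmetryGroup hP.poly hP.sum_eq hg, hP.norm_left v hv]
    · intro hx
      obtain ⟨g, hg, rfl⟩ := hrepA v hv
      obtain ⟨g', hg', rfl⟩ := hrepA x hx
      exact ⟨g' * g⁻¹, mul_mem hg' (inv_mem hg), congrArg g' (g.symm_apply_apply _)⟩
  have horbB : ∀ v ∈ B, {x | ∃ g ∈ P.symmetryGroup, g v = x} = B := by
    intro v hv
    ext x
    constructor
    · rintro ⟨g, hg, rfl⟩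
      refine hP.mem_right (hmem g hg v ?_) ?_
      · rw [hP.verts_eq]; exact .inr hv
      · rw [norm_apply_of_mem_symmetryGroup hP.poly hP.sum_eq hg, hP.norm_right v hv]
    · intro hx
      obtain ⟨g, hg, rfl⟩ := hrepB v hv
      obtain ⟨g', hg', rfl⟩ := hrepB x hx
      exact ⟨g' * g⁻¹, mul_mem hg' (inv_mem hg), congrArg g' (g.symm_apply_apply _)⟩
  have hAB : A ≠ B := by
    intro h
    have h1 := hP.norm_left _ hwA
    rw [h] at hwA
    exact hP.radii_ne (h1.symm.trans (hP.norm_right _ hwA))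
  have : P.vertexOrbits = {A, B} := by
    ext O
    constructor
    · rintro ⟨v, hv, rfl⟩
      rw [hP.verts_eq] at hv
      exact hv.imp (horbA v) (horbB v)
    · rintro (rfl | rfl)
      · exact ⟨w 0, by rw [hP.verts_eq]; exact .inl hwA, (horbA _ hwA).symm⟩
      · exact ⟨w 1, by rw [hP.verts_eq]; exact .inr hw1, (horbB _ hw1).symm⟩
  rw [this, Set.ncard_pair hAB]

/-- Similar two-layered polyhedra have proportional radii. -/
theorem eq_or_eq_inv_of_similar {P' : Skeletal} {A B A' B' : Set E3} {R t u : ℝ} (hR : 0 < R)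
    (h : P.TwoLayered A B R (t * R)) (h' : P'.TwoLayered A' B' R (u * R))
    (hA : A.Nonempty) (hB : B.Nonempty) (hsim : P.Similar P') : u = t ∨ u = t⁻¹ := by
  obtain ⟨ρ, hρ, g, rfl⟩ := hsim
  obtain ⟨x, hx⟩ := hA
  obtain ⟨y, hy⟩ := hB
  have hxP : x ∈ P.verts := by rw [h.verts_eq]; exact .inl hx
  have hyP : y ∈ P.verts := by rw [h.verts_eq]; exact .inr hy
  have hg := norm_apply_of_centred h.poly.finite_verts ⟨x, hxP⟩ h.sum_eq h'.sum_eq hρ.ne' g rfl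
  have ht : t ≠ 1 := fun e => h.radii_ne (by rw [e, one_mul])
  have hnorm : ∀ z ∈ P.verts, ρ * ‖z‖ = R ∨ ρ * ‖z‖ = u * R := by
    intro z hz
    have := h'.norm_mem (x := ρ • g z) ⟨z, hz, rfl⟩
    rw [norm_smul, hg, Real.norm_of_nonneg hρ.le] at this
    exact this.imp And.right And.right
  have hx' := hnorm x hxP
  have hy' := hnorm y hyP
  rw [h.norm_left x hx] at hx'
  rw [h.norm_right y hy, ← mul_assoc] at hy'
  have hc : ∀ {p q : ℝ}, p * R = q * R → p = q := fun e => mul_right_cancel₀ hR.ne' e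
  -- The radii `ρR` and `ρtR` are each `R` or `uR`. They cannot coincide as `t ≠ 1`, which leaves `ρ
  -- = 1`, `u = t` or `ρ = u`, `u * t = 1`.
  rcases hx' with hx' | hx'
  · have hρ1 : ρ = 1 := hc (hx'.trans (one_mul R).symm)
    subst hρ1
    rcases hy' with hy' | hy'
    · exact (ht (hc (by linarith))).elim
    · exact Or.inl (hc (by linarith))
  · have hρu : ρ = u := hc hx'
    subst hρu
    rcases hy' with hy' | hy'
    · exact Or.inr (eq_inv_of_mul_eq_one_left (hc (hy'.trans (one_mul R).symm)))
    · have := hc hy'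
      exact (ht (mul_left_cancel₀ hρ.ne' (this.trans (mul_one ρ).symm))).elim

end TwoLayered

end Skeletal

/-! ### Coplanarity -/

/-- The direction space of `S` has dimension at most 2 exactly when its orthogonal complement
contains a nonzero normal. -/
theorem coplanar_iff_exists_inner {S : Set E3} :
    Coplanar ℝ S ↔ ∃ n : E3, n ≠ 0 ∧ ∃ k : ℝ, ∀ x ∈ S, inner ℝ n x = k := by
  constructor
  · intro h
    rcases S.eq_empty_or_nonempty with rfl | ⟨x₀, hx₀⟩
    · exact ⟨EuclideanSpace.single 0 1, by simp, 0, by simp⟩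
    have hfin : Module.finrank ℝ (vectorSpan ℝ S) ≤ 2 := by
      have h2 := h.finrank_le_two
      exact h2
    have hne : (vectorSpan ℝ S)ᗮ ≠ ⊥ := by
      intro hb
      have h1 := (vectorSpan ℝ S).finrank_add_finrank_orthogonal
      rw [hb, finrank_bot, finrank_euclideanSpace_fin] at h1
      omega
    obtain ⟨n, hn, hn0⟩ := Submodule.exists_mem_ne_zero_of_ne_bot hne
    refine ⟨n, hn0, inner ℝ n x₀, fun x hx => ?_⟩
    have := (Submodule.mem_orthogonal' _ _).1 hn _ (vsub_mem_vectorSpan ℝ hx hx₀)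
    rw [vsub_eq_sub, inner_sub_right] at this
    linarith
  · rintro ⟨n, hn0, k, hk⟩
    have hle : vectorSpan ℝ S ≤ (Submodule.span ℝ {n})ᗮ := by
      rw [vectorSpan, Submodule.span_le]
      rintro _ ⟨x, hx, y, hy, rfl⟩
      rw [SetLike.mem_coe, Submodule.mem_orthogonal_singleton_iff_inner_right]
      show inner ℝ n (x - y) = 0
      rw [inner_sub_right, hk x hx, hk y hy, sub_self]
    have h1 := Submodule.finrank_mono hle
    have h2 := (Submodule.span ℝ {n}).finrank_add_finrank_orthogonal
    rw [finrank_span_singleton hn0, finrank_euclideanSpace_fin] at h2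
    rw [coplanar_iff_finrank_le_two]
    omega

namespace Skeletal

variable {P Q : Skeletal} {w a b : ℤ → E3} {R t : ℝ}

/-! ### Criteria for connectedness and invariance -/

/-- Converse of `IsPolyhedron.edge_induction`: take for `S` the set of points reachable from `x₀`.
In this form connectedness is easily carried from one figure to another. -/
theorem edgeGraph_connected_of (hedge : ∀ e ∈ P.edges, ¬ e.IsDiag ∧ ∀ x ∈ e, x ∈ P.verts)
    {x₀ : E3} (hx₀ : x₀ ∈ P.verts)
    (h : ∀ S : Set E3, x₀ ∈ S → (∀ x y, s(x, y) ∈ P.edges → x ∈ S → y ∈ S) → P.verts ⊆ S) :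
    P.edgeGraph.Connected := by
  rw [SimpleGraph.connected_iff_exists_forall_reachable]
  refine ⟨⟨x₀, hx₀⟩, fun v => ?_⟩
  have h1 := h {x | ∃ hx : x ∈ P.verts, P.edgeGraph.Reachable ⟨x₀, hx₀⟩ ⟨x, hx⟩}
    ⟨hx₀, SimpleGraph.Reachable.refl _⟩ ?_ v.2
  · exact h1.2
  · rintro x y hxy ⟨hx, hr⟩
    refine ⟨(hedge _ hxy).2 _ (Sym2.mem_mk_right _ _), hr.trans (SimpleGraph.Adj.reachable ?_)⟩
    exact ⟨fun e => (hedge _ hxy).1 (congrArg Subtype.val e), hxy⟩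

/-- The analogue for vertex-figures. The condition `F ⊆ P.edges` guarantees that the new point `z`
is again a neighbour of `x`. -/
theorem vertexFigure_connected_of (hedge : ∀ e ∈ P.edges, ¬ e.IsDiag ∧ ∀ x ∈ e, x ∈ P.verts)
    {x y₀ : E3} (hx : x ∈ P.verts) (hy₀ : s(x, y₀) ∈ P.edges)
    (h : ∀ S : Set E3, y₀ ∈ S →
      (∀ y z, y ≠ z → (∃ F ∈ P.faces, F ⊆ P.edges ∧ s(y, x) ∈ F ∧ s(x, z) ∈ F) → y ∈ S → z ∈ S) →
      ∀ y, s(x, y) ∈ P.edges → y ∈ S) :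
    (P.vertexFigure ⟨x, hx⟩).Connected := by
  rw [SimpleGraph.connected_iff_exists_forall_reachable]
  let m : ∀ z, s(x, z) ∈ P.edges → {u : P.verts // P.edgeGraph.Adj ⟨x, hx⟩ u} := fun z hz =>
    ⟨⟨z, (hedge _ hz).2 _ (Sym2.mem_mk_right _ _)⟩,
      fun e => (hedge _ hz).1 (congrArg Subtype.val e), hz⟩
  refine ⟨m y₀ hy₀, fun v => ?_⟩
  have h1 := h {z | ∃ hz : s(x, z) ∈ P.edges,
    (P.vertexFigure ⟨x, hx⟩).Reachable (m y₀ hy₀) (m z hz)} ⟨hy₀, SimpleGraph.Reachable.refl _⟩ ?_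
    v.1 v.2.2
  · exact h1.2
  · rintro y z hne ⟨F, hF, hFE, h1, h2⟩ ⟨hy, hr⟩
    refine ⟨hFE h2, hr.trans (SimpleGraph.Adj.reachable ?_)⟩
    exact ⟨fun e => hne (congrArg (fun u => (u.1 : E3)) e), F, hF, h1, h2⟩

/-- `f` maps vertices, edges and faces of `P` to such. -/
def Stable (P : Skeletal) (f : E3 → E3) : Prop :=
  (∀ v ∈ P.verts, f v ∈ P.verts) ∧ (∀ e ∈ P.edges, Sym2.map f e ∈ P.edges) ∧
    ∀ F ∈ P.faces, Sym2.map f '' F ∈ P.faces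

theorem map_eq_of_stable {f : Equiv.Perm E3} (h : P.Stable f) (h' : P.Stable f.symm) :
    P.map f = P := by
  have key : ∀ e : Sym2 E3, Sym2.map f (Sym2.map f.symm e) = e := by
    intro e
    rw [Sym2.map_map, show f ∘ f.symm = id from funext f.apply_symm_apply, Sym2.map_id]
    rfl
  refine Skeletal.ext ?_ ?_ ?_
  · refine Set.Subset.antisymm (Set.image_subset_iff.2 h.1) fun v hv => ?_
    exact ⟨_, h'.1 v hv, f.apply_symm_apply v⟩
  · refine Set.Subset.antisymm (Set.image_subset_iff.2 h.2.1) fun e he => ?_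
    exact ⟨_, h'.2.1 e he, key e⟩
  · refine Set.Subset.antisymm (Set.image_subset_iff.2 h.2.2) fun F hF => ?_
    refine ⟨_, h'.2.2 F hF, ?_⟩
    show Sym2.map f '' (Sym2.map f.symm '' F) = F
    simp [Set.image_image, key]

/-! ### Centred regular polyhedra -/

/-- A polyhedron with vertices on a sphere about their centroid `0` and with a tracing `w` of a face
which is mapped to all others by linear isometries preserving the polyhedron; the last condition
says that the vertices of the traced face with even and odd index have centroids that agree up to
sign. -/
structure CentredRegular (Q : Skeletal) (w : ℤ → E3) (R : ℝ) : Prop where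
  poly : Q.IsPolyhedron
  tracks : Q.Tracks w
  trans : ∀ a, Q.Tracks a → ∃ L : E3 ≃ₗᵢ[ℝ] E3, Q.map L = Q ∧ ∀ i, L (w i) = a i
  pos : 0 < R
  norm_eq : ∀ x ∈ Q.verts, ‖x‖ = R
  sum_eq : ∑ᶠ x ∈ Q.verts, x = 0
  span : ∀ n : E3, inner ℝ n (w 0) = 0 → inner ℝ n (w 1) = 0 → inner ℝ n (w 2) = 0 → n = 0
  balanced : ∃ N : ℕ, 0 < N ∧ ∃ ε : ℝ, (ε = 1 ∨ ε = -1) ∧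
    ∑ j ∈ Finset.range N, w (2 * j) = ε • ∑ j ∈ Finset.range N, w (2 * j + 1)

theorem CentredRegular.isRegular (h : Q.CentredRegular w R) : Q.IsRegular :=
  h.poly.isRegular_of_forall_tracks h.tracks h.trans

/-- The sequence `w 0, t w 1, w 2, t w 3, …`. -/
def alt (w : ℤ → E3) (t : ℝ) (j : ℤ) : E3 :=
  if Even j then w j else t • w j

theorem alt_even {j : ℤ} (h : Even j) : alt w t j = w j := if_pos h

theorem alt_odd {j : ℤ} (h : ¬ Even j) : alt w t j = t • w j := if_neg h

theorem alt_shift {k : ℤ} (hk : Even k) (j : ℤ) :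
    alt w t (k + j) = alt (fun i => w (k + i)) t j := by
  simp only [alt, Int.even_add, hk, true_iff]

theorem alt_reflect {k : ℤ} (hk : Even k) (j : ℤ) :
    alt w t (k - j) = alt (fun i => w (k - i)) t j := by
  simp only [alt, Int.even_sub, hk, true_iff]

theorem map_alt (L : E3 ≃ₗᵢ[ℝ] E3) (h : ∀ i, L (w i) = a i) (j : ℤ) :
    L (alt w t j) = alt a t j := by
  unfold alt
  split_ifs
  · exact h j
  · rw [map_smul, h]

/-- The normal is pulled back by `L` to the base face, where `balanced` and `span` are available.
Balance shows that the plane passes through the origin, and `span` then kills the normal. -/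
theorem CentredRegular.alt_not_coplanar (h : Q.CentredRegular w R) (ht : 0 < t) (ht1 : t ≠ 1)
    (ha : Q.Tracks a) : ¬ Coplanar ℝ (Set.range (alt a t)) := by
  rw [coplanar_iff_exists_inner]
  rintro ⟨n, hn, k, hk⟩
  obtain ⟨L, -, hL⟩ := h.trans a ha
  have hev : ∀ j : ℤ, inner ℝ (L.symm n) (w (2 * j)) = k := by
    intro j
    rw [← hk _ ⟨2 * j, rfl⟩, alt_even (even_two_mul j), ← hL, LinearIsometryEquiv.inner_map_eq_flip,
      LinearIsometryEquiv.symm_symm]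
  have hod : ∀ j : ℤ, t * inner ℝ (L.symm n) (w (2 * j + 1)) = k := by
    intro j
    rw [← hk _ ⟨2 * j + 1, rfl⟩, alt_odd (Int.not_even_two_mul_add_one j), ← hL, inner_smul_right,
      LinearIsometryEquiv.inner_map_eq_flip, LinearIsometryEquiv.symm_symm]
  have hk0 : k = 0 := by
    obtain ⟨N, hN, ε, hε, hsum⟩ := h.balanced
    have h1 := congrArg (fun x => t * inner ℝ (L.symm n) x) hsum
    simp only [inner_smul_right, inner_sum, hev] at h1
    have h0 : t * ∑ j ∈ Finset.range N, inner ℝ (L.symm n) (w (2 * j + 1)) = N * k := by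
      rw [Finset.mul_sum]
      simp [hod]
    rw [mul_left_comm t ε, h0] at h1
    simp only [Finset.sum_const, Finset.card_range, nsmul_eq_mul] at h1
    have hN' : (N : ℝ) ≠ 0 := by exact_mod_cast hN.ne'
    -- The even vertices contribute `N * k` and the odd ones `N * k / t`, equal up to the sign `ε`.
    -- Here `t ≠ 1` excludes `t = ε` for `ε = 1`, and `t > 0` excludes it for `ε = -1`.
    have h2 : (t - ε) * k = 0 := by
      have : (N : ℝ) * ((t - ε) * k) = 0 := by linarith
      exact (mul_eq_zero.1 this).resolve_left hN'
    refine (mul_eq_zero.1 h2).resolve_left fun h3 => ?_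
    rcases hε with rfl | rfl
    · exact ht1 (by linarith)
    · linarith
  subst hk0
  apply hn
  have := h.span (L.symm n) (by simpa using hev 0)
    (by simpa [ht.ne'] using hod 0) (by simpa using hev 1)
  simpa using this

end Skeletal

/-- Norms separate even from odd indices, so a point recurs exactly when both the parity and the
point of `w` recur. This gives period `2p` for odd `p` and `p` for even `p`. -/
theorem IsCyc.alt {p : ℕ} {w : ℤ → E3} {R t : ℝ} (h : IsCyc p w) (hw : ∀ i, ‖w i‖ = R) (hR : 0 < R)
    (ht : 0 < t) (ht1 : t ≠ 1) : IsCyc (Nat.lcm 2 p) (Skeletal.alt w t) := by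
  have hp := h.1
  refine ⟨?_, fun i j => ?_⟩
  · have := Nat.le_of_dvd (Nat.lcm_pos (by norm_num) (by omega)) (Nat.dvd_lcm_right 2 p)
    omega
  · have hne : ∀ x y : E3, ‖x‖ = R → ‖y‖ = R → x ≠ t • y := by
      intro x y hx hy e
      rw [e, norm_smul, hy, Real.norm_of_nonneg ht.le] at hx
      exact ht1 (mul_right_cancel₀ hR.ne' (hx.trans (one_mul R).symm))
    have hd : ((Nat.lcm 2 p : ℕ) : ℤ) ∣ i - j ↔ (Even i ↔ Even j) ∧ (p : ℤ) ∣ i - j := by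
      rw [← Int.even_sub, even_iff_two_dvd, ← Int.natAbs_dvd_natAbs, Int.natAbs_natCast,
        Nat.lcm_dvd_iff, ← Int.natAbs_dvd_natAbs (a := 2), ← Int.natAbs_dvd_natAbs (a := (p : ℤ))]
      rfl
    rw [hd, ← h.2]
    unfold Skeletal.alt
    split_ifs with h1 h2 h2
    · simp [h1, h2]
    · simp [h1, h2, hne _ _ (hw i) (hw j)]
    · simp [h1, h2, (hne _ _ (hw j) (hw i)).symm]
    · simp [h1, h2, (smul_right_injective E3 ht.ne').eq_iff]

/-- The permutation of space interchanging the spheres of radii `R` and `t * R` about the origin. -/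
noncomputable def sphereSwap {R t : ℝ} (hR : 0 < R) (ht : 0 < t) (ht1 : t ≠ 1) :
    Equiv.Perm E3 :=
  have hne : t * R ≠ R := fun e => ht1 (mul_right_cancel₀ hR.ne' (e.trans (one_mul R).symm))
  Function.Involutive.toPerm
    (fun x => if ‖x‖ = R then t • x else if ‖x‖ = t * R then t⁻¹ • x else x) <| by
    intro x
    by_cases h1 : ‖x‖ = R
    · simp [h1, norm_smul, abs_of_pos ht, hne, ht.ne', smul_smul]
    · by_cases h2 : ‖x‖ = t * R
      · simp [h2, hne, norm_smul, abs_of_pos ht, ht.ne', smul_smul]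
      · simp [h1, h2]

/-! ### The crossing of a regular polyhedron with a homothetic copy -/

namespace Skeletal

variable {P Q : Skeletal} {w a b : ℤ → E3} {R t : ℝ}

theorem mem_cross_faces {F : Set (Sym2 E3)} :
    F ∈ (Q.cross t).faces ↔ ∃ w, Q.Tracks w ∧ F = cycEdges (alt w t) := by
  constructor
  · rintro ⟨p, hp, v, hv, hF, rfl⟩
    refine ⟨fun j => v (j : ZMod p), ⟨⟨p, isCyc_intCast hp hv⟩, ?_⟩, rfl⟩
    rwa [← polygon_eq_cycEdges]
  · rintro ⟨w, ⟨⟨p, hp⟩, hF⟩, rfl⟩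
    obtain ⟨v, hv, rfl⟩ := hp.exists_zmod
    exact ⟨p, hp.1, v, hv, by rwa [polygon_eq_cycEdges], rfl⟩

theorem cycEdges_alt_subset (hQ : Q.IsPolyhedron) (hw : Q.Tracks w) :
    cycEdges (alt w t) ⊆ (Q.cross t).edges := by
  rintro _ ⟨i, rfl⟩
  by_cases hi : Even i
  · exact ⟨w i, w (i + 1), hQ.edge_mem hw i, by
      show s(alt w t i, alt w t (i + 1)) = _
      rw [alt_even hi, alt_odd (by rw [Int.even_add_one]; exact not_not.2 hi)]⟩
  · refine ⟨w (i + 1), w i, by rw [Sym2.eq_swap]; exact hQ.edge_mem hw i, ?_⟩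
    show s(alt w t i, alt w t (i + 1)) = _
    rw [alt_odd hi, alt_even (by rw [Int.even_add_one]; exact hi), Sym2.eq_swap]

theorem cross_edge_swap {x y : E3} (hxy : s(x, y) ∈ Q.edges) : s(t • x, y) ∈ (Q.cross t).edges :=
  ⟨y, x, by rwa [Sym2.eq_swap], Sym2.eq_swap⟩

theorem cross_stable (L : E3 ≃ₗᵢ[ℝ] E3) (hL : Q.map L = Q) : (Q.cross t).Stable L := by
  have hm := mem_of_map_eq hL
  refine ⟨?_, ?_, ?_⟩
  · rintro v (hv | ⟨y, hy, rfl⟩)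
    · exact Or.inl (hm.1 v hv)
    · exact Or.inr ⟨_, hm.1 y hy, map_smul L t y⟩
  · rintro _ ⟨x, y, hxy, rfl⟩
    refine ⟨L x, L y, hm.2.1 _ hxy, ?_⟩
    rw [Sym2.map_mk, map_smul]
  · intro F hF
    obtain ⟨w, hw, rfl⟩ := mem_cross_faces.1 hF
    rw [image_cycEdges, mem_cross_faces]
    refine ⟨_, hw.of_map_eq L.injective hL, ?_⟩
    simp only [map_alt L fun _ => rfl]

theorem cross_map_eq (L : E3 ≃ₗᵢ[ℝ] E3) (hL : Q.map L = Q) : (Q.cross t).map L = Q.cross t :=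
  map_eq_of_stable (f := L.toEquiv) (cross_stable L hL)
    (cross_stable L.symm (map_symm_eq (f := L.toEquiv) hL))

namespace CentredRegular

variable (h : Q.CentredRegular w R) (ht : 0 < t) (ht1 : t ≠ 1)
include h ht ht1

theorem ne_smul {x y : E3} (hx : x ∈ Q.verts) (hy : y ∈ Q.verts) : x ≠ t • y := by
  intro e
  have h1 := h.norm_eq x hx
  rw [e, norm_smul, h.norm_eq y hy, Real.norm_of_nonneg ht.le] at h1
  exact ht1 (mul_right_cancel₀ h.pos.ne' (h1.trans (one_mul R).symm))

theorem tracks_alt (ha : Q.Tracks a) : (Q.cross t).Tracks (alt a t) := by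
  obtain ⟨p, hp⟩ := ha.1
  exact ⟨⟨_, hp.alt (fun i => h.norm_eq _ (h.poly.vert_mem ha i)) h.pos ht ht1⟩,
    mem_cross_faces.2 ⟨a, ha, rfl⟩⟩

/-- A tracing of a face differs from an alternating one by a shift or reflection; an odd offset
would start it on the copy `t Q`. -/
theorem exists_eq_alt {u : ℤ → E3} (hu : (Q.cross t).Tracks u) (hu0 : u 0 ∈ Q.verts) :
    ∃ a, Q.Tracks a ∧ u = alt a t := by
  obtain ⟨a, ha, hua⟩ := mem_cross_faces.1 hu.2
  obtain ⟨k, hk | hk⟩ := (h.tracks_alt ht ht1 ha).eq_shift_or_reflect hu hua.symm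
  · have hev : Even k := by
      by_contra hk'
      have : u 0 = t • a k := by rw [hk]; simp [alt_odd hk']
      exact h.ne_smul ht ht1 hu0 (h.poly.vert_mem ha k) this
    exact ⟨_, ha.shift k, hk.trans (funext fun j => alt_shift hev j)⟩
  · have hev : Even k := by
      by_contra hk'
      have : u 0 = t • a k := by rw [hk]; simp [alt_odd hk']
      exact h.ne_smul ht ht1 hu0 (h.poly.vert_mem ha k) this
    exact ⟨_, ha.reflect k, hk.trans (funext fun j => alt_reflect hev j)⟩

theorem edge_of_cross_edge {x y : E3} (he : s(x, y) ∈ (Q.cross t).edges) (hx : x ∈ Q.verts) :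
    ∃ z, s(x, z) ∈ Q.edges ∧ y = t • z := by
  obtain ⟨x', y', hxy, he⟩ := he
  rcases Sym2.eq_iff.1 he with ⟨rfl, rfl⟩ | ⟨rfl, rfl⟩
  · exact ⟨y', hxy, rfl⟩
  · exact (h.ne_smul ht ht1 hx (h.poly.edge_right hxy) rfl).elim

theorem edge_of_cross_edge' {x y : E3} (he : s(t • x, y) ∈ (Q.cross t).edges)
    (hx : x ∈ Q.verts) : s(x, y) ∈ Q.edges := by
  obtain ⟨x', y', hxy, he⟩ := he
  rcases Sym2.eq_iff.1 he with ⟨rfl, rfl⟩ | ⟨h1, rfl⟩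
  · exact (h.ne_smul ht ht1 (h.poly.edge_left hxy) hx rfl).elim
  · rw [smul_right_injective E3 ht.ne' h1, Sym2.eq_swap]
    exact hxy

theorem sphereSwap_apply {x : E3} (hx : x ∈ Q.verts) : sphereSwap h.pos ht ht1 x = t • x :=
  if_pos (h.norm_eq x hx)

theorem sphereSwap_apply_smul {x : E3} (hx : x ∈ Q.verts) :
    sphereSwap h.pos ht ht1 (t • x) = x := by
  rw [← h.sphereSwap_apply ht ht1 hx]
  exact Equiv.symm_apply_apply (sphereSwap h.pos ht ht1) x

/-- Interchanging the layers amounts to beginning the alternation at the next vertex, so it maps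
faces of the crossing to faces. -/
theorem sphereSwap_alt (ha : Q.Tracks a) (j : ℤ) :
    sphereSwap h.pos ht ht1 (alt a t j) = alt (fun i => a (1 + i)) t (-1 + j) := by
  have hodd : Even (-1 + j) ↔ ¬ Even j := by
    rw [neg_add_eq_sub, Int.even_sub_one]
  by_cases hj : Even j
  · rw [alt_even hj, alt_odd (by rw [hodd]; exact not_not.2 hj),
      h.sphereSwap_apply ht ht1 (h.poly.vert_mem ha j)]
    simp
  · rw [alt_odd hj, alt_even (hodd.2 hj), h.sphereSwap_apply_smul ht ht1 (h.poly.vert_mem ha j)]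
    simp

theorem cross_map_sphereSwap : (Q.cross t).map (sphereSwap h.pos ht ht1) = Q.cross t := by
  have hst : (Q.cross t).Stable (sphereSwap h.pos ht ht1) := by
    refine ⟨?_, ?_, ?_⟩
    · rintro v (hv | ⟨y, hy, rfl⟩)
      · rw [h.sphereSwap_apply ht ht1 hv]
        exact Or.inr ⟨v, hv, rfl⟩
      · rw [h.sphereSwap_apply_smul ht ht1 hy]
        exact Or.inl hy
    · rintro _ ⟨x, y, hxy, rfl⟩
      rw [Sym2.map_mk, h.sphereSwap_apply ht ht1 (h.poly.edge_left hxy),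
        h.sphereSwap_apply_smul ht ht1 (h.poly.edge_right hxy)]
      exact cross_edge_swap hxy
    · intro F hF
      obtain ⟨a, ha, rfl⟩ := mem_cross_faces.1 hF
      rw [image_cycEdges]
      simp only [h.sphereSwap_alt ht ht1 ha]
      rw [cycEdges_shift]
      exact mem_cross_faces.2 ⟨_, ha.shift 1, rfl⟩
  exact map_eq_of_stable hst hst

/-- Run from `x` to `t • y`, a face of the crossing alternates a face of `Q` run from `x` to `y`; so
the faces at the two edges correspond. -/
theorem cross_two_faces {x y : E3} (hxy : s(x, y) ∈ Q.edges) :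
    {F | F ∈ (Q.cross t).faces ∧ s(x, t • y) ∈ F}.ncard = 2 := by
  obtain ⟨F, hF, heF⟩ := h.poly.exists_face hxy
  obtain ⟨G, hG, heG, hne, hu⟩ := h.poly.exists_other hxy hF heF
  obtain ⟨a, ha, rfl, rfl, rfl⟩ := h.poly.exists_tracks_start hF heF
  obtain ⟨b, hb, rfl, h0, h1⟩ := h.poly.exists_tracks_start hG heG
  have hodd : ¬ Even (1 : ℤ) := by decide
  have inj : ∀ c d : ℤ → E3, alt c t = alt d t → c = d := by
    intro c d e
    funext j
    have := congrFun e j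
    unfold alt at this
    split_ifs at this
    · exact this
    · exact smul_right_injective E3 ht.ne' this
  refine Set.ncard_eq_two.2 ⟨cycEdges (alt a t), cycEdges (alt b t), fun e => hne ?_, ?_⟩
  · have : alt a t = alt b t := by
      refine (h.tracks_alt ht ht1 ha).ext (h.tracks_alt ht ht1 hb) e ?_ ?_
      · simp [alt, h0]
      · simp [alt, h1]
    rw [inj _ _ this]
  · ext H
    constructor
    · rintro ⟨hH, heH⟩
      obtain ⟨c, hc, rfl⟩ := mem_cross_faces.1 hH
      obtain ⟨u, hu', hu0, hu1⟩ := (h.tracks_alt ht ht1 hc).exists_start heH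
      obtain ⟨d, hd, rfl⟩ := h.exists_eq_alt ht ht1 hu' (by rw [hu1.1]; exact h.poly.vert_mem ha 0)
      have hd0 : d 0 = a 0 := by simpa [alt] using hu1.1
      have hd1 : d 1 = a 1 := by
        have := hu1.2
        rw [alt_odd hodd] at this
        exact smul_right_injective E3 ht.ne' this
      rw [← hu0]
      rcases hu _ hd.2 (by rw [← hd0, ← hd1]; exact mem_cycEdges d 0) with e | e
      · exact Or.inl (by rw [hd.ext ha e hd0 hd1])
      · exact Or.inr (by rw [hd.ext hb e (hd0.trans h0.symm) (hd1.trans h1.symm)]; rfl)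
    · rintro (rfl | rfl)
      · refine ⟨mem_cross_faces.2 ⟨a, ha, rfl⟩, 0, ?_⟩
        simp [alt]
      · refine ⟨mem_cross_faces.2 ⟨b, hb, rfl⟩, 0, ?_⟩
        simp [alt, h0, h1]

theorem cross_isPolyhedron
    (hodd : ¬ ∃ c : E3 → Prop, ∀ x y, s(x, y) ∈ Q.edges → (c x ↔ ¬ c y)) :
    (Q.cross t).IsPolyhedron := by
  have hQ := h.poly
  have hspec : ∀ e ∈ (Q.cross t).edges, ¬ e.IsDiag ∧ ∀ x ∈ e, x ∈ (Q.cross t).verts := by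
    rintro _ ⟨x, y, hxy, rfl⟩
    refine ⟨h.ne_smul ht ht1 (hQ.edge_left hxy) (hQ.edge_right hxy), fun z hz => ?_⟩
    rcases Sym2.mem_iff.1 hz with rfl | rfl
    · exact Or.inl (hQ.edge_left hxy)
    · exact Or.inr ⟨y, hQ.edge_right hxy, rfl⟩
  refine ⟨?_, hspec, ?_, ?_, ?_, ?_⟩
  · refine hQ.finite_verts.union ((hQ.finite_verts.image (t • ·)).subset ?_)
    rintro _ ⟨y, hy, rfl⟩
    exact ⟨y, hy, rfl⟩
  · intro F hF
    obtain ⟨a, ha, rfl⟩ := mem_cross_faces.1 hF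
    obtain ⟨p, hp⟩ := (h.tracks_alt ht ht1 ha).1
    exact ⟨⟨p, isPolygon_iff.2 ⟨_, hp, rfl⟩⟩, cycEdges_alt_subset hQ ha⟩
  · refine edgeGraph_connected_of hspec (x₀ := w 0) (Or.inl (hQ.vert_mem h.tracks 0)) ?_
    intro S h0 hS
    have e1 : ∀ x y, s(x, y) ∈ Q.edges → x ∈ S → t • y ∈ S := fun x y hxy =>
      hS _ _ ⟨x, y, hxy, rfl⟩
    have e2 : ∀ x y, s(x, y) ∈ Q.edges → t • x ∈ S → y ∈ S := fun x y hxy =>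
      hS _ _ (cross_edge_swap hxy)
    have hsw : ∀ x y, s(x, y) ∈ Q.edges → s(y, x) ∈ Q.edges := fun x y hxy => by
      rwa [Sym2.eq_swap]
    -- If `S` contains both points over `w 0`, it contains both points over every vertex. If not, it
    -- contains exactly one over each, and membership in `S` is a proper 2-colouring of `Q`, against
    -- `hodd`.
    by_cases h1 : t • w 0 ∈ S
    · have := hQ.edge_induction (p := fun x => x ∈ S ∧ t • x ∈ S) (hQ.vert_mem h.tracks 0)
        ⟨h0, h1⟩ fun x y hxy hx => ⟨e2 x y hxy hx.2, e1 x y hxy hx.1⟩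
      rintro v (hv | ⟨y, hy, rfl⟩)
      exacts [(this v hv).1, (this y hy).2]
    · have := hQ.edge_induction (p := fun x => x ∈ S ↔ ¬ t • x ∈ S) (hQ.vert_mem h.tracks 0)
        (by simp [h0, h1]) fun x y hxy hx => by
          have i1 := e1 x y hxy
          have i2 := e2 x y hxy
          have i3 := e1 y x (hsw _ _ hxy)
          have i4 := e2 y x (hsw _ _ hxy)
          tauto
      refine (hodd ⟨fun x => x ∈ S, fun x y hxy => ?_⟩).elim
      have i1 := e1 x y hxy
      have i2 := e2 x y hxy
      have i3 := e1 y x (hsw _ _ hxy)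
      have i4 := e2 y x (hsw _ _ hxy)
      have i5 := this x (hQ.edge_left hxy)
      have i6 := this y (hQ.edge_right hxy)
      tauto
  -- The vertex-figure at a vertex of `Q` is that of `Q` scaled by `t`; at a vertex `t • x` of the
  -- copy it is that of `Q` at `x`.
  · rintro ⟨v, hv | ⟨x, hx, rfl⟩⟩
    · obtain ⟨y₀, hy₀⟩ := hQ.exists_edge hv
      refine vertexFigure_connected_of hspec (y₀ := t • y₀) (Or.inl hv) ⟨v, y₀, hy₀, rfl⟩ ?_
      intro S h0 hS y hy
      obtain ⟨z, hz, rfl⟩ := h.edge_of_cross_edge ht ht1 hy hv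
      refine hQ.vertexFigure_induction (p := fun y => t • y ∈ S) hy₀ h0 ?_ z hz
      intro a ha ha0 hp
      have ha' := h.tracks_alt ht ht1 ha
      refine hS _ _ (fun e => ha.ne_neg_one (smul_right_injective E3 ht.ne' e).symm)
        ⟨_, ha'.2, cycEdges_alt_subset hQ ha, ?_, ?_⟩ hp
      · refine ⟨-1, ?_⟩
        simp [alt, ha0]
      · refine ⟨0, ?_⟩
        simp [alt, ha0]
    · obtain ⟨y₀, hy₀⟩ := hQ.exists_edge hx
      refine vertexFigure_connected_of hspec (y₀ := y₀) (Or.inr ⟨x, hx, rfl⟩)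
        (cross_edge_swap hy₀) ?_
      intro S h0 hS y hy
      refine hQ.vertexFigure_induction (p := fun y => y ∈ S) hy₀ h0 ?_ y
        (h.edge_of_cross_edge' ht ht1 hy hx)
      intro a ha ha0 hp
      -- After the shift `a 0` has the odd index -1 and is scaled, while `a (-1)` and `a 1` have the
      -- even indices -2 and 0.
      have ha' := h.tracks_alt ht ht1 (ha.shift 1)
      refine hS _ _ (fun e => ha.ne_neg_one e.symm)
        ⟨_, ha'.2, cycEdges_alt_subset hQ (ha.shift 1), ?_, ?_⟩ hp
      · refine ⟨-2, ?_⟩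
        simp [alt, ha0]
      · refine ⟨-1, ?_⟩
        simp [alt, ha0]
  · rintro _ ⟨x, y, hxy, rfl⟩
    exact h.cross_two_faces ht ht1 hxy

theorem cross_twoLayered
    (hodd : ¬ ∃ c : E3 → Prop, ∀ x y, s(x, y) ∈ Q.edges → (c x ↔ ¬ c y)) :
    (Q.cross t).TwoLayered Q.verts {x | ∃ y ∈ Q.verts, x = t • y} R (t * R) where
  poly := h.cross_isPolyhedron ht ht1 hodd
  verts_eq := rfl
  norm_left := h.norm_eq
  norm_right := by
    rintro _ ⟨y, hy, rfl⟩
    rw [norm_smul, h.norm_eq y hy, Real.norm_of_nonneg ht.le]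
  radii_ne := fun e => ht1 (mul_right_cancel₀ h.pos.ne' (e.symm.trans (one_mul R).symm))
  sum_eq := by
    have himg : {x | ∃ y ∈ Q.verts, x = t • y} = (fun y => t • y) '' Q.verts := by
      ext x
      simp [eq_comm]
    have hfin := h.poly.finite_verts
    show ∑ᶠ x ∈ Q.verts ∪ {x | ∃ y ∈ Q.verts, x = t • y}, x = 0
    have hdisj : Disjoint Q.verts ((fun y => t • y) '' Q.verts) := by
      rw [Set.disjoint_left]
      rintro _ hx ⟨y, hy, rfl⟩
      exact h.ne_smul ht ht1 hx hy rfl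
    rw [himg, finsum_mem_union hdisj hfin (hfin.image _), h.sum_eq, zero_add,
      finsum_mem_image (smul_right_injective E3 ht.ne').injOn, ← smul_finsum_mem hfin, h.sum_eq,
      smul_zero]
  edge_left := fun x y hxy hx => by
    obtain ⟨z, hz, rfl⟩ := h.edge_of_cross_edge ht ht1 hxy hx
    exact ⟨z, h.poly.edge_right hz, rfl⟩
  edge_right := by
    rintro _ y hxy ⟨x, hx, rfl⟩
    exact h.poly.edge_right (h.edge_of_cross_edge' ht ht1 hxy hx)

theorem cross_spec
    (hodd : ¬ ∃ c : E3 → Prop, ∀ x y, s(x, y) ∈ Q.edges → (c x ↔ ¬ c y)) :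
    (Q.cross t).IsRegularOfIndexTwo ∧ (Q.cross t).vertexOrbits.ncard = 2 ∧
      ∀ F ∈ (Q.cross t).faces, ¬ Coplanar ℝ (polygonVertices F) := by
  have h2 := h.cross_twoLayered ht ht1 hodd
  have hw := h.tracks_alt ht ht1 h.tracks
  have hw0 : alt w t 0 ∈ Q.verts := by simpa [alt] using h.poly.vert_mem h.tracks 0
  have hA : ∀ a, (Q.cross t).Tracks a → a 0 ∈ Q.verts →
      ∃ L : E3 ≃ₗᵢ[ℝ] E3, (Q.cross t).map L = Q.cross t ∧ ∀ i, L (alt w t i) = a i := by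
    intro a ha ha0
    obtain ⟨b, hb, rfl⟩ := h.exists_eq_alt ht ht1 ha ha0
    obtain ⟨L, hL, hLb⟩ := h.trans b hb
    exact ⟨L, cross_map_eq L hL, map_alt L hLb⟩
  refine ⟨h2.isRegularOfIndexTwo hw hw0 hA ?_, h2.vertexOrbits_ncard hw hw0 hA, ?_⟩
  · rintro a ha ⟨x, hx, hax⟩
    -- A tracing starting on the copy is moved to `Q` by the swap, reached there by an isometry, and
    -- moved back.
    have hσ := h.cross_map_sphereSwap ht ht1
    have hσa := ha.of_map_eq (sphereSwap h.pos ht ht1).injective hσ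
    obtain ⟨L, hL, hLa⟩ := hA _ hσa (by rw [hax, h.sphereSwap_apply_smul ht ht1 hx]; exact hx)
    refine ⟨(sphereSwap h.pos ht ht1).symm * L.toEquiv, ?_, fun i => ?_⟩
    · have := map_symm_eq hσ
      rw [Equiv.Perm.coe_mul, ← map_map]
      show ((Q.cross t).map L).map _ = _
      rw [hL, this]
    · show (sphereSwap h.pos ht ht1).symm (L (alt w t i)) = a i
      rw [hLa, Equiv.symm_apply_apply]
  · intro F hF
    obtain ⟨a, ha, rfl⟩ := mem_cross_faces.1 hF
    rw [polygonVertices_cycEdges]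
    exact h.alt_not_coplanar ht ht1 ha

end CentredRegular

/-- Polyhedra obtained by the crossing construction are similar only for equal or inverse
parameters. -/
theorem CentredRegular.cross_similar {u : ℝ} (h : Q.CentredRegular w R)
    (hodd : ¬ ∃ c : E3 → Prop, ∀ x y, s(x, y) ∈ Q.edges → (c x ↔ ¬ c y)) (ht : 0 < t)
    (ht1 : t ≠ 1) (hu : 0 < u) (hu1 : u ≠ 1) (hsim : (Q.cross t).Similar (Q.cross u)) :
    u = t ∨ u = t⁻¹ :=
  TwoLayered.eq_or_eq_inv_of_similar h.pos (h.cross_twoLayered ht ht1 hodd)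
    (h.cross_twoLayered hu hu1 hodd) ⟨_, h.poly.vert_mem h.tracks 0⟩
    ⟨_, _, h.poly.vert_mem h.tracks 0, rfl⟩ hsim

end Skeletal

namespace Skeletal

variable {P Q : Skeletal} {w a b : ℤ → E3} {R t : ℝ}

/-! ### Images of polyhedra under permutations of space -/

theorem IsPolyhedron.map_congr (hQ : Q.IsPolyhedron) {f g : E3 → E3}
    (h : ∀ x ∈ Q.verts, f x = g x) : Q.map f = Q.map g := by
  have hE : ∀ e ∈ Q.edges, Sym2.map f e = Sym2.map g e := fun e he =>
    Sym2.map_congr fun x hx => h x ((hQ.edge_spec e he).2 x hx)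
  refine Skeletal.ext (Set.image_congr h) (Set.image_congr hE) (Set.image_congr fun F hF => ?_)
  exact Set.image_congr fun e he => hE e ((hQ.face_spec F hF).2 he)

theorem map_map_symm (f : Equiv.Perm E3) : (Q.map f).map f.symm = Q := by
  rw [map_map]
  convert Q.map_id using 2
  funext x
  exact f.symm_apply_apply x

theorem Tracks.of_map {f : Equiv.Perm E3} (h : (Q.map f).Tracks w) :
    Q.Tracks fun i => f.symm (w i) := by
  have := h.map f.symm.injective
  rwa [map_map_symm] at this

theorem mem_map_edges {f : Equiv.Perm E3} {x y : E3} :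
    s(f x, f y) ∈ (Q.map f).edges ↔ s(x, y) ∈ Q.edges :=
  (Sym2.map.injective f.injective).mem_set_image (s := Q.edges) (a := s(x, y))

theorem IsPolyhedron.map (hQ : Q.IsPolyhedron) (f : Equiv.Perm E3) : (Q.map f).IsPolyhedron := by
  have hfE : Function.Injective (Sym2.map f) := Sym2.map.injective f.injective
  have hspec : ∀ e ∈ (Q.map f).edges, ¬ e.IsDiag ∧ ∀ x ∈ e, x ∈ (Q.map f).verts := by
    rintro _ ⟨e, he, rfl⟩
    induction e with
    | _ x y =>
      refine ⟨fun h => hQ.edge_ne he (f.injective h), fun z hz => ?_⟩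
      rcases Sym2.mem_iff.1 hz with rfl | rfl
      · exact ⟨x, hQ.edge_left he, rfl⟩
      · exact ⟨y, hQ.edge_right he, rfl⟩
  have hface : ∀ F ∈ Q.faces, Sym2.map f '' F ⊆ (Q.map f).edges := fun F hF =>
    Set.image_mono (hQ.face_spec F hF).2
  refine ⟨hQ.finite_verts.image f, hspec, ?_, ?_, ?_, ?_⟩
  · rintro _ ⟨F, hF, rfl⟩
    refine ⟨?_, hface F hF⟩
    obtain ⟨a, ha, rfl⟩ := hQ.exists_tracks hF
    obtain ⟨p, hp⟩ := (ha.map f.injective).1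
    exact ⟨p, isPolygon_iff.2 ⟨_, hp, image_cycEdges f a⟩⟩
  · obtain ⟨⟨v, hv⟩⟩ := hQ.connected.nonempty
    refine edgeGraph_connected_of hspec (x₀ := f v) ⟨v, hv, rfl⟩ fun S h0 hS => ?_
    rintro _ ⟨x, hx, rfl⟩
    exact hQ.edge_induction (p := fun x => f x ∈ S) hv h0
      (fun x y hxy => hS _ _ (mem_map_edges.2 hxy)) x hx
  · rintro ⟨_, x, hx, rfl⟩
    obtain ⟨y₀, hy₀⟩ := hQ.exists_edge hx
    refine vertexFigure_connected_of hspec (y₀ := f y₀) ⟨x, hx, rfl⟩ (mem_map_edges.2 hy₀) ?_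
    intro S h0 hS y hy
    obtain ⟨y, rfl⟩ := f.surjective y
    refine hQ.vertexFigure_induction (p := fun y => f y ∈ S) hy₀ h0 ?_ y (mem_map_edges.1 hy)
    intro a ha ha0 hp
    refine hS _ _ (fun e => ha.ne_neg_one (f.injective e).symm)
      ⟨Sym2.map f '' cycEdges a, ⟨_, ha.2, rfl⟩, hface _ ha.2, ?_, ?_⟩ hp
    · exact ⟨s(a (-1), a 0), ⟨-1, by simp⟩, by rw [ha0]; rfl⟩
    · exact ⟨s(a 0, a 1), ⟨0, by simp⟩, by rw [ha0]; rfl⟩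
  · rintro _ ⟨e, he, rfl⟩
    have : {F | F ∈ (Q.map f).faces ∧ Sym2.map f e ∈ F} =
        (fun F => Sym2.map f '' F) '' {F | F ∈ Q.faces ∧ e ∈ F} := by
      ext F
      constructor
      · rintro ⟨⟨F, hF, rfl⟩, heF⟩
        exact ⟨F, ⟨hF, (hfE.mem_set_image).1 heF⟩, rfl⟩
      · rintro ⟨F, ⟨hF, heF⟩, rfl⟩
        exact ⟨⟨F, hF, rfl⟩, e, heF, rfl⟩
    rw [this, Set.ncard_image_of_injective _ hfE.image_injective, hQ.two_faces e he]

/-! ### Rescaling every other vertex of the cube -/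

/-- The product of the coordinates. -/
def coordProd (x : E3) : ℝ := x 0 * x 1 * x 2

theorem coordProd_smul (r : ℝ) (x : E3) : coordProd (r • x) = r ^ 3 * coordProd x := by
  simp only [coordProd, PiLp.smul_apply, smul_eq_mul]
  ring

theorem coordProd_eq_of_mem_cubeVerts {x : E3} (hx : x ∈ cubeVerts) :
    coordProd x = 1 ∨ coordProd x = -1 := by
  unfold coordProd
  rcases hx 0 with h0 | h0 <;> rcases hx 1 with h1 | h1 <;> rcases hx 2 with h2 | h2 <;>
    norm_num [h0, h1, h2]

open Classical in
/-- Scaling the points with non-positive product of coordinates by `t`. -/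
noncomputable def signScale (ht : 0 < t) : Equiv.Perm E3 where
  toFun x := if 0 < coordProd x then x else t • x
  invFun x := if 0 < coordProd x then x else t⁻¹ • x
  left_inv x := by
    by_cases h : 0 < coordProd x
    · simp [h]
    · have : ¬ 0 < coordProd (t • x) := by
        rw [coordProd_smul, mul_pos_iff_of_pos_left (by positivity)]
        exact h
      simp [h, this, smul_smul, ht.ne']
  right_inv x := by
    by_cases h : 0 < coordProd x
    · simp [h]
    · have : ¬ 0 < coordProd (t⁻¹ • x) := by
        rw [coordProd_smul, mul_pos_iff_of_pos_left (by positivity)]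
        exact h
      simp [h, this, smul_smul, ht.ne']

theorem signScale_of_eq_one (ht : 0 < t) {x : E3} (h : coordProd x = 1) :
    signScale ht x = x :=
  if_pos (by rw [h]; norm_num)

theorem signScale_of_eq_neg_one (ht : 0 < t) {x : E3} (h : coordProd x = -1) :
    signScale ht x = t • x :=
  if_neg (by rw [h]; norm_num)

namespace CentredRegular

variable (h : Q.CentredRegular w R) (hV : Q.verts = cubeVerts)
  (hE : ∀ x y, s(x, y) ∈ Q.edges → coordProd x = - coordProd y)
  (hw : coordProd (w 0) = 1) (hS : ∑ᶠ x ∈ tetrahedronVerts, x = 0)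
  (ht : 0 < t) (ht1 : t ≠ 1)

include h ht

include hE

/-- The sign of the coordinate product is a 2-colouring and so alternates along a face. Rescaled
faces are thus alternating sequences, and `alt_not_coplanar` applies to them too. -/
theorem signScale_apply_tracks (ha : Q.Tracks a) (ha0 : coordProd (a 0) = 1) (j : ℤ) :
    signScale ht (a j) = alt a t j := by
  have hstep : ∀ i : ℤ, coordProd (a i) = - coordProd (a (i + 1)) := fun i =>
    hE _ _ (h.poly.edge_mem ha i)
  have hev : ∀ i : ℤ, coordProd (a (2 * i)) = 1 := by
    intro i
    induction i using Int.induction_on with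
    | zero => simpa using ha0
    | succ i ih =>
      have h1 := hstep (2 * i)
      have h2 := hstep (2 * i + 1)
      rw [show (2 * ((i : ℤ) + 1)) = 2 * i + 1 + 1 by ring]
      linarith
    | pred i ih =>
      have h1 := hstep (2 * (-i - 1))
      have h2 := hstep (2 * (-i - 1) + 1)
      rw [show 2 * (-(i : ℤ) - 1) + 1 + 1 = 2 * -i by ring] at h2
      linarith
  rcases Int.even_or_odd' j with ⟨i, rfl | rfl⟩
  · rw [alt_even (even_two_mul i), signScale_of_eq_one ht (hev i)]
  · rw [alt_odd (Int.not_even_two_mul_add_one i), signScale_of_eq_neg_one ht]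
    have := hstep (2 * i)
    rw [hev] at this
    linarith

omit hE
include hV

/-- On the cube the sign of the coordinate product decides which tetrahedron a vertex belongs to.
Unlike the map defining `rescaleHalf`, `signScale` is a bijection of the whole space, since positive
factors preserve that sign. -/
theorem rescaleHalf_eq_map : Q.rescaleHalf t = Q.map (signScale ht) := by
  refine h.poly.map_congr fun x hx => ?_
  rw [hV] at hx
  rcases coordProd_eq_of_mem_cubeVerts hx with h1 | h1
  · rw [signScale_of_eq_one ht h1, if_pos ⟨hx, h1⟩]
  · rw [signScale_of_eq_neg_one ht h1, if_neg]
    rintro ⟨-, h2⟩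
    have h3 : coordProd x = 1 := h2
    linarith

include hE

include hS ht1

/-- The cube vertices with product -1 are the negatives of those with product 1, so the second layer
is `-t` times the first; both have sum `0`. -/
theorem rescaleHalf_twoLayered : (Q.rescaleHalf t).TwoLayered tetrahedronVerts
    ((fun x => -t • x) '' tetrahedronVerts) R (t * R) := by
  have hRt : R ≠ t * R := fun e => ht1 (mul_right_cancel₀ h.pos.ne' (e.symm.trans (one_mul R).symm))
  have hneg : ∀ x : E3, x ∈ cubeVerts → coordProd x = -1 →
      t • x ∈ (fun x => -t • x) '' tetrahedronVerts := by
    intro x hx h1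
    refine ⟨-x, ⟨fun i => ?_, ?_⟩, by simp⟩
    · rcases hx i with h2 | h2 <;> simp [h2]
    · have : (-x) 0 * (-x) 1 * (-x) 2 = - coordProd x := by
        simp only [coordProd, PiLp.neg_apply]
        ring
      rw [this, h1, neg_neg]
  have hnorm : ∀ x ∈ tetrahedronVerts, ‖x‖ = R := fun x hx => h.norm_eq x (by rw [hV]; exact hx.1)
  have hnorm' : ∀ x ∈ (fun x => -t • x) '' tetrahedronVerts, ‖x‖ = t * R := by
    rintro _ ⟨x, hx, rfl⟩
    show ‖-t • x‖ = _
    rw [neg_smul, norm_neg, norm_smul, hnorm x hx, Real.norm_of_nonneg ht.le]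
  have hcase : ∀ x ∈ Q.verts, (signScale ht x ∈ tetrahedronVerts ∧ coordProd x = 1) ∨
      (signScale ht x ∈ (fun x => -t • x) '' tetrahedronVerts ∧ coordProd x = -1) := by
    intro x hx
    rw [hV] at hx
    rcases coordProd_eq_of_mem_cubeVerts hx with h1 | h1
    · exact Or.inl ⟨by rw [signScale_of_eq_one ht h1]; exact ⟨hx, h1⟩, h1⟩
    · exact Or.inr ⟨by rw [signScale_of_eq_neg_one ht h1]; exact hneg x hx h1, h1⟩
  have hverts : (Q.rescaleHalf t).verts =
      tetrahedronVerts ∪ (fun x => -t • x) '' tetrahedronVerts := by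
    rw [h.rescaleHalf_eq_map hV ht]
    refine Set.Subset.antisymm ?_ ?_
    · rintro _ ⟨x, hx, rfl⟩
      exact (hcase x hx).imp And.left And.left
    · rintro x (hx | ⟨y, hy, rfl⟩)
      · exact ⟨x, by rw [hV]; exact hx.1, signScale_of_eq_one ht hx.2⟩
      · refine ⟨-y, ?_, ?_⟩
        · rw [hV]
          intro i
          rcases hy.1 i with h2 | h2 <;> simp [h2]
        · rw [signScale_of_eq_neg_one ht]
          · simp
          · have : coordProd y = 1 := hy.2
            rw [← this, ← neg_one_smul ℝ y, coordProd_smul]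
            norm_num
  have hedge : ∀ x y, s(x, y) ∈ (Q.rescaleHalf t).edges → ∃ x' y', s(x', y') ∈ Q.edges ∧
      signScale ht x' = x ∧ signScale ht y' = y := by
    intro x y hxy
    rw [h.rescaleHalf_eq_map hV ht] at hxy
    obtain ⟨x, rfl⟩ := (signScale ht).surjective x
    obtain ⟨y, rfl⟩ := (signScale ht).surjective y
    exact ⟨x, y, mem_map_edges.1 hxy, rfl, rfl⟩
  refine ⟨?_, hverts, hnorm, hnorm', hRt, ?_, ?_, ?_⟩
  · rw [h.rescaleHalf_eq_map hV ht]
    exact h.poly.map _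
  · have hfin : (tetrahedronVerts).Finite := h.poly.finite_verts.subset fun x hx => by
      rw [hV]; exact hx.1
    have hdisj : Disjoint tetrahedronVerts ((fun x => -t • x) '' tetrahedronVerts) := by
      rw [Set.disjoint_left]
      intro x hx hx'
      exact hRt ((hnorm x hx).symm.trans (hnorm' x hx'))
    rw [hverts, finsum_mem_union hdisj hfin (hfin.image _), hS, zero_add,
      finsum_mem_image (smul_right_injective E3 (neg_ne_zero.2 ht.ne')).injOn,
      ← smul_finsum_mem hfin, hS, smul_zero]
  · intro x y hxy hx
    obtain ⟨x, y, hxy', rfl, rfl⟩ := hedge x y hxy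
    have h1 := hE x y hxy'
    rcases hcase y (h.poly.edge_right hxy') with ⟨-, h2⟩ | ⟨h2, -⟩
    · rcases hcase x (h.poly.edge_left hxy') with ⟨-, h3⟩ | ⟨h3, -⟩
      · linarith
      · exact (hRt ((hnorm _ hx).symm.trans (hnorm' _ h3))).elim
    · exact h2
  · intro x y hxy hx
    obtain ⟨x, y, hxy', rfl, rfl⟩ := hedge x y hxy
    have h1 := hE x y hxy'
    rcases hcase y (h.poly.edge_right hxy') with ⟨h2, -⟩ | ⟨-, h2⟩
    · exact h2
    · rcases hcase x (h.poly.edge_left hxy') with ⟨h3, -⟩ | ⟨-, h3⟩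
      · exact (hRt ((hnorm _ h3).symm.trans (hnorm' _ hx))).elim
      · linarith

include hw

theorem rescaleHalf_spec :
    (Q.rescaleHalf t).IsRegularOfIndexTwo ∧ (Q.rescaleHalf t).vertexOrbits.ncard = 2 ∧
      ∀ F ∈ (Q.rescaleHalf t).faces, ¬ Coplanar ℝ (polygonVertices F) := by
  have h2 := h.rescaleHalf_twoLayered hV hE hS ht ht1
  have heq := h.rescaleHalf_eq_map hV ht
  have hcube : ∀ x ∈ Q.verts, coordProd x = 1 ∨ coordProd x = -1 := fun x hx =>
    coordProd_eq_of_mem_cubeVerts (by rwa [hV] at hx)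
  have hw' : (Q.rescaleHalf t).Tracks fun i => signScale ht (w i) := by
    rw [heq]
    exact h.tracks.map (signScale ht).injective
  have hw0 : signScale ht (w 0) ∈ tetrahedronVerts := by
    rw [signScale_of_eq_one ht hw]
    exact ⟨by rw [← hV]; exact h.poly.vert_mem h.tracks 0, hw⟩
  have hA : ∀ a, (Q.rescaleHalf t).Tracks a → a 0 ∈ tetrahedronVerts →
      ∃ L : E3 ≃ₗᵢ[ℝ] E3, (Q.rescaleHalf t).map L = Q.rescaleHalf t ∧
        ∀ i, L (signScale ht (w i)) = a i := by
    intro a ha ha0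
    rw [heq] at ha
    have hb := ha.of_map
    have hb0 : (signScale ht).symm (a 0) = a 0 := by
      rw [Equiv.symm_apply_eq, signScale_of_eq_one ht ha0.2]
    obtain ⟨L, hL, hLa⟩ := h.trans _ hb
    -- As the colour changes sign along every edge and the edge graph is connected, an isometry that
    -- keeps the colour of `w 0` keeps all colours, and therefore commutes with the rescaling.
    have hpres : ∀ x ∈ Q.verts, coordProd (L x) = coordProd x := by
      refine h.poly.edge_induction (h.poly.vert_mem h.tracks 0) ?_ fun x y hxy hx => ?_
      · rw [hLa, hb0, hw]
        exact ha0.2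
      · have h3 := hE x y hxy
        have h4 := hE (L x) (L y) ((mem_of_map_eq hL).2.1 _ hxy)
        linarith
    have hcomm : ∀ x ∈ Q.verts, signScale ht (L x) = L (signScale ht x) := by
      intro x hx
      rcases hcube x hx with h3 | h3
      · rw [signScale_of_eq_one ht h3, signScale_of_eq_one ht ((hpres x hx).trans h3)]
      · rw [signScale_of_eq_neg_one ht h3, signScale_of_eq_neg_one ht ((hpres x hx).trans h3),
          map_smul]
    refine ⟨L, ?_, fun i => ?_⟩
    · rw [heq, map_map, ← h.poly.map_congr (f := signScale ht ∘ L) (g := L ∘ signScale ht) hcomm,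
        ← map_map, hL]
    · rw [← hcomm _ (h.poly.vert_mem h.tracks i), hLa, Equiv.apply_symm_apply]
  refine ⟨h2.isRegularOfIndexTwo hw' hw0 hA ?_, h2.vertexOrbits_ncard hw' hw0 hA, ?_⟩
  · intro a ha _
    rw [heq] at ha
    obtain ⟨L, hL, hLa⟩ := h.trans _ ha.of_map
    -- Only a combinatorial automorphism is needed here, so any symmetry of `Q` may be conjugated by
    -- the rescaling, even if it exchanges the colours.
    refine ⟨signScale ht * L.toEquiv * (signScale ht)⁻¹, ?_, fun i => ?_⟩
    · rw [heq, map_map]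
      have : ((signScale ht * L.toEquiv * (signScale ht)⁻¹ : Equiv.Perm E3) : E3 → E3) ∘
          signScale ht = signScale ht ∘ L := by
        funext x
        simp
      rw [this, ← map_map, hL]
    · show signScale ht (L ((signScale ht).symm (signScale ht (w i)))) = a i
      rw [Equiv.symm_apply_apply, hLa, Equiv.apply_symm_apply]
  · intro F hF
    rw [heq] at hF
    obtain ⟨F, hF, rfl⟩ := hF
    obtain ⟨a, ha, rfl⟩ := h.poly.exists_tracks hF
    -- Start the face at a vertex of the fixed tetrahedron, moving on one step if necessary.
    obtain ⟨b, hb, hab, hb0⟩ : ∃ b, Q.Tracks b ∧ cycEdges b = cycEdges a ∧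
        coordProd (b 0) = 1 := by
      rcases hcube _ (h.poly.vert_mem ha 0) with h3 | h3
      · exact ⟨a, ha, rfl, h3⟩
      · refine ⟨_, ha.shift 1, cycEdges_shift a 1, ?_⟩
        have := hE _ _ (h.poly.edge_mem ha 0)
        simp only [zero_add] at this
        simp only [add_zero]
        linarith
    show ¬ Coplanar ℝ (polygonVertices (Sym2.map (signScale ht) '' cycEdges a))
    rw [← hab, image_cycEdges, polygonVertices_cycEdges]
    simp only [h.signScale_apply_tracks hE ht hb hb0]
    exact h.alt_not_coplanar ht ht1 hb

end CentredRegular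

/-- Polyhedra obtained by rescaling the cube are similar only for equal or inverse parameters. -/
theorem CentredRegular.rescaleHalf_similar {u : ℝ} (h : Q.CentredRegular w R)
    (hV : Q.verts = cubeVerts) (hE : ∀ x y, s(x, y) ∈ Q.edges → coordProd x = - coordProd y)
    (hw : coordProd (w 0) = 1) (hS : ∑ᶠ x ∈ tetrahedronVerts, x = 0) (ht : 0 < t)
    (ht1 : t ≠ 1) (hu : 0 < u) (hu1 : u ≠ 1)
    (hsim : (Q.rescaleHalf t).Similar (Q.rescaleHalf u)) : u = t ∨ u = t⁻¹ := by
  have hw0 : w 0 ∈ tetrahedronVerts := ⟨by rw [← hV]; exact h.poly.vert_mem h.tracks 0, hw⟩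
  exact TwoLayered.eq_or_eq_inv_of_similar h.pos (h.rescaleHalf_twoLayered hV hE hS ht ht1)
    (h.rescaleHalf_twoLayered hV hE hS hu hu1) ⟨_, hw0⟩ ⟨_, _, hw0, rfl⟩ hsim

end Skeletal

namespace Skeletal

variable {P Q : Skeletal} {w a b z z' : ℤ → E3} {R t : ℝ}

/-! ### Petrie duals -/

/-- Any two, but no three, consecutive edges of the path `z` belong to a common face. -/
def PetriePath (Q : Skeletal) (z : ℤ → E3) : Prop :=
  ∀ i : ℤ, (∃ G ∈ Q.faces, s(z i, z (i + 1)) ∈ G ∧ s(z (i + 1), z (i + 2)) ∈ G) ∧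
    ¬ ∃ G ∈ Q.faces, s(z i, z (i + 1)) ∈ G ∧ s(z (i + 1), z (i + 2)) ∈ G ∧
      s(z (i + 2), z (i + 3)) ∈ G

theorem PetriePath.shift (h : Q.PetriePath z) (k : ℤ) : Q.PetriePath fun j => z (k + j) := by
  intro i
  simpa only [add_assoc] using h (k + i)

theorem PetriePath.reflect (h : Q.PetriePath z) (k : ℤ) : Q.PetriePath fun j => z (k - j) := by
  intro i
  -- Three consecutive edges read backwards begin at index `k - i - 3` of the original path.
  have e : ∀ m : ℤ, k - (i + m) = (k - i - 3) + (3 - m) := fun m => by ring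
  have e0 : k - i = (k - i - 3) + 3 := by ring
  have h1 := (h (k - i - 3 + 1)).1
  have h2 := (h (k - i - 3)).2
  simp only [e, add_assoc] at h1 ⊢
  rw [e0]
  norm_num at h1 h2 ⊢
  constructor
  · obtain ⟨G, hG, h3, h4⟩ := h1
    exact ⟨G, hG, by rwa [Sym2.eq_swap], by rwa [Sym2.eq_swap]⟩
  · intro G hG h3 h4 h5
    exact h2 G hG (by rwa [Sym2.eq_swap]) (by rwa [Sym2.eq_swap]) (by rwa [Sym2.eq_swap])

theorem mem_petrieDual_faces {F : Set (Sym2 E3)} : F ∈ Q.petrieDual.faces ↔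
    ∃ z, (∃ p, IsCyc p z) ∧ Q.PetriePath z ∧ cycEdges z ⊆ Q.edges ∧ F = cycEdges z := by
  constructor
  · rintro ⟨p, hp, v, hv, rfl, hF, h⟩
    refine ⟨fun j => v (j : ZMod p), ⟨p, isCyc_intCast hp hv⟩, fun i => ?_, ?_,
      polygon_eq_cycEdges v⟩
    · have := h i
      push_cast
      exact this
    · rwa [← polygon_eq_cycEdges]
  · rintro ⟨z, ⟨p, hp⟩, hz, hF, rfl⟩
    obtain ⟨v, hv, rfl⟩ := hp.exists_zmod
    refine ⟨p, hp.1, v, hv, (polygon_eq_cycEdges v).symm, hF, fun i => ?_⟩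
    obtain ⟨i, rfl⟩ := ZMod.intCast_surjective i
    have := hz i
    push_cast at this
    exact this

/-- The definition supplies one Petrie tracing of the polygon; every other one is a shift or
reflection of it. -/
theorem Tracks.petriePath (h : Q.petrieDual.Tracks z) : Q.PetriePath z := by
  obtain ⟨a, ⟨p, hp⟩, ha, -, he⟩ := mem_petrieDual_faces.1 h.2
  obtain ⟨q, hq⟩ := h.1
  obtain ⟨k, rfl | rfl⟩ := hp.eq_shift_or_reflect hq he.symm
  · exact ha.shift k
  · exact ha.reflect k

theorem PetriePath.of_map_eq {f : Equiv.Perm E3} (hf : Q.map f = Q) (h : Q.PetriePath z) :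
    Q.PetriePath fun i => f (z i) := by
  intro i
  refine ⟨?_, ?_⟩
  · obtain ⟨G, hG, h1, h2⟩ := (h i).1
    exact ⟨_, (mem_of_map_eq hf).2.2 G hG, ⟨_, h1, rfl⟩, ⟨_, h2, rfl⟩⟩
  · rintro ⟨G, hG, h1, h2, h3⟩
    have hf' := map_symm_eq hf
    refine (h i).2 ⟨_, (mem_of_map_eq hf').2.2 G hG, ⟨_, h1, ?_⟩, ⟨_, h2, ?_⟩, ⟨_, h3, ?_⟩⟩ <;>
    simp

theorem petrieDual_stable {f : Equiv.Perm E3} (hf : Q.map f = Q) : Q.petrieDual.Stable f := by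
  refine ⟨(mem_of_map_eq hf).1, (mem_of_map_eq hf).2.1, fun F hF => ?_⟩
  obtain ⟨z, ⟨p, hp⟩, hz, hE, rfl⟩ := mem_petrieDual_faces.1 hF
  rw [image_cycEdges]
  refine mem_petrieDual_faces.2 ⟨_, ⟨p, hp.comp f.injective.injOn⟩, hz.of_map_eq hf, ?_, rfl⟩
  rw [← image_cycEdges]
  rintro _ ⟨e, he, rfl⟩
  exact (mem_of_map_eq hf).2.1 e (hE he)

theorem petrieDual_map_eq {f : Equiv.Perm E3} (hf : Q.map f = Q) :
    Q.petrieDual.map f = Q.petrieDual :=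
  map_eq_of_stable (petrieDual_stable hf) (petrieDual_stable (map_symm_eq hf))

namespace CentredRegular

variable (h : Q.CentredRegular w R)
  (hU : ∀ a b, Q.Tracks a → Q.Tracks b → a 0 = b 0 → a 1 = b 1 → a 2 = b 2 → a = b)
include h

theorem exists_tracks_corner {x y u : E3} {G : Set (Sym2 E3)} (hG : G ∈ Q.faces)
    (h1 : s(x, y) ∈ G) (h2 : s(y, u) ∈ G) (hxu : x ≠ u) :
    ∃ a, Q.Tracks a ∧ cycEdges a = G ∧ a 0 = x ∧ a 1 = y ∧ a 2 = u := by
  obtain ⟨a, ha, rfl, h0, h1⟩ := h.poly.exists_tracks_start hG h1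
  refine ⟨a, ha, rfl, h0, h1, ?_⟩
  have h3 := (ha.shift 1).mem_cycEdges_zero (y := u) (by
    rw [cycEdges_shift]
    simpa [h1] using h2)
  rcases h3 with h3 | h3
  · exact h3.symm
  · exact (hxu (by rw [h3, ← h0]; rfl)).elim

/-- A Petrie path must leave the face containing its last two edges, so it continues in the other
face on `{y, u}`; there the vertex following `y, u` is determined. -/
theorem petrie_step {x y u v v' : E3} (hyv : y ≠ v) (hyv' : y ≠ v')
    (h1 : ∃ G ∈ Q.faces, s(x, y) ∈ G ∧ s(y, u) ∈ G)
    (h2 : ∃ G ∈ Q.faces, s(y, u) ∈ G ∧ s(u, v) ∈ G)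
    (h2' : ∃ G ∈ Q.faces, s(y, u) ∈ G ∧ s(u, v') ∈ G)
    (h3 : ¬ ∃ G ∈ Q.faces, s(x, y) ∈ G ∧ s(y, u) ∈ G ∧ s(u, v) ∈ G)
    (h3' : ¬ ∃ G ∈ Q.faces, s(x, y) ∈ G ∧ s(y, u) ∈ G ∧ s(u, v') ∈ G) : v = v' := by
  obtain ⟨G, hG, e1, e2⟩ := h1
  obtain ⟨H, hH, e3, e4⟩ := h2
  obtain ⟨K, hK, e5, e6⟩ := h2'
  obtain ⟨O, -, -, -, hO⟩ := h.poly.exists_other ((h.poly.face_spec G hG).2 e2) hG e2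
  have hHO : H = O := (hO H hH e3).resolve_left fun e => h3 ⟨G, hG, e1, e2, e ▸ e4⟩
  have hKO : K = O := (hO K hK e5).resolve_left fun e => h3' ⟨G, hG, e1, e2, e ▸ e6⟩
  obtain ⟨a, ha, hae, a0, a1, a2⟩ := h.exists_tracks_corner hH e3 e4 hyv
  obtain ⟨b, hb, hbe, b0, b1, b2⟩ := h.exists_tracks_corner hK e5 e6 hyv'
  have := ha.ext hb (by rw [hae, hbe, hHO, hKO]) (a0.trans b0.symm) (a1.trans b1.symm)
  rw [← a2, ← b2, this]

theorem petriePath_ext_nat {p q : ℕ} (hz : Q.PetriePath z) (hz' : Q.PetriePath z')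
    (hp : IsCyc p z) (hq : IsCyc q z') (h0 : z 0 = z' 0) (h1 : z 1 = z' 1) (h2 : z 2 = z' 2)
    (n : ℕ) : z n = z' n ∧ z (n + 1) = z' (n + 1) ∧ z (n + 2) = z' (n + 2) := by
  induction n with
  | zero => simpa using ⟨h0, h1, h2⟩
  | succ n ih =>
    obtain ⟨e0, e1, e2⟩ := ih
    have i1 := hz (n : ℤ)
    have i2 := hz (n + 1 : ℤ)
    have j1 := hz' (n : ℤ)
    have j2 := hz' (n + 1 : ℤ)
    have k2 := hp.ne_succ_succ (n + 1 : ℤ)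
    have k3 := hq.ne_succ_succ (n + 1 : ℤ)
    push_cast
    simp only [add_assoc] at *
    norm_num at *
    refine ⟨e1, e2, ?_⟩
    rw [← e0, ← e1, ← e2] at j1
    rw [← e1, ← e2] at j2
    rw [← e1] at k3
    exact h.petrie_step k2 k3 i1.1 i2.1 j2.1 (by simpa using i1.2) (by simpa using j1.2)

theorem petriePath_ext (hz : Q.petrieDual.Tracks z) (hz' : Q.petrieDual.Tracks z')
    (h0 : z 0 = z' 0) (h1 : z 1 = z' 1) (h2 : z 2 = z' 2) : z = z' := by
  obtain ⟨p, hp⟩ := hz.1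
  obtain ⟨q, hq⟩ := hz'.1
  funext i
  obtain ⟨n, rfl | rfl⟩ := i.eq_nat_or_neg
  · exact (h.petriePath_ext_nat hz.petriePath hz'.petriePath hp hq h0 h1 h2 n).1
  -- Reflection about 2 keeps the three known vertices in front and turns index `-n` into `n + 2`.
  · have := (h.petriePath_ext_nat (hz.petriePath.reflect 2) (hz'.petriePath.reflect 2)
      (hp.reflect 2) (hq.reflect 2) (by simpa using h2) (by simpa using h1) (by simpa using h0) n).2.2
    simpa using this

include hU

/-- The Petrie dual of a centred regular polyhedron is centred regular as soon as one path of Petrie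
type closes up without repetition and is not degenerate. -/
theorem petrieDual {p : ℕ} (hp : IsCyc p z) (hz : Q.PetriePath z)
    (hspan : ∀ n : E3, inner ℝ n (z 0) = 0 → inner ℝ n (z 1) = 0 → inner ℝ n (z 2) = 0 → n = 0)
    (hbal : ∃ N : ℕ, 0 < N ∧ ∃ ε : ℝ, (ε = 1 ∨ ε = -1) ∧
      ∑ j ∈ Finset.range N, z (2 * j) = ε • ∑ j ∈ Finset.range N, z (2 * j + 1)) :
    Q.petrieDual.CentredRegular z R := by
  have hzE : cycEdges z ⊆ Q.edges := by
    rintro _ ⟨i, rfl⟩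
    obtain ⟨G, hG, h1, -⟩ := (hz i).1
    exact (h.poly.face_spec G hG).2 h1
  have hzt : Q.petrieDual.Tracks z :=
    ⟨⟨p, hp⟩, mem_petrieDual_faces.2 ⟨z, ⟨p, hp⟩, hz, hzE, rfl⟩⟩
  -- Corners of Petrie polygons are corners of faces; `hface` below is the converse, obtained by
  -- moving `z` with symmetries of `Q`.
  have hcorner : ∀ y, Q.petrieDual.Tracks y →
      ∃ a, Q.Tracks a ∧ a 0 = y 0 ∧ a 1 = y 1 ∧ a 2 = y 2 := by
    intro y hy
    obtain ⟨G, hG, h1, h2⟩ := (hy.petriePath 0).1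
    obtain ⟨a, ha, -, h⟩ := h.exists_tracks_corner hG h1 h2 (hy.ne_succ_succ 0)
    exact ⟨a, ha, h⟩
  obtain ⟨c, hc, c0, c1, c2⟩ := hcorner z hzt
  obtain ⟨Lc, hLc, hLcw⟩ := h.trans c hc
  have hreach : ∀ a, Q.Tracks a → ∃ L : E3 ≃ₗᵢ[ℝ] E3, Q.map L = Q ∧
      L (z 0) = a 0 ∧ L (z 1) = a 1 ∧ L (z 2) = a 2 := by
    intro a ha
    obtain ⟨L, hL, hLw⟩ := h.trans a ha
    refine ⟨Lc.symm.trans L, ?_, ?_⟩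
    · rw [LinearIsometryEquiv.coe_trans, ← map_map,
        show Q.map Lc.symm = Q from map_symm_eq (f := Lc.toEquiv) hLc, hL]
    · simp [← c0, ← c1, ← c2, ← hLcw, ← hLw]
  have htr : ∀ L : E3 ≃ₗᵢ[ℝ] E3, Q.map L = Q → Q.petrieDual.Tracks fun i => L (z i) := fun L hL =>
    hzt.of_map_eq L.injective (petrieDual_map_eq (f := L.toEquiv) hL)
  have hface : ∀ a, Q.Tracks a → ∃ y, Q.petrieDual.Tracks y ∧ y 0 = a 0 ∧ y 1 = a 1 ∧
      y 2 = a 2 := by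
    intro a ha
    obtain ⟨L, hL, h0, h1, h2⟩ := hreach a ha
    exact ⟨_, htr L hL, h0, h1, h2⟩
  have hFE : ∀ F ∈ Q.petrieDual.faces, F ⊆ Q.edges := by
    intro F hF
    obtain ⟨y, -, -, hE, rfl⟩ := mem_petrieDual_faces.1 hF
    exact hE
  have hpoly : Q.petrieDual.IsPolyhedron := by
    refine ⟨h.poly.finite_verts, h.poly.edge_spec, fun F hF => ⟨?_, hFE F hF⟩, h.poly.connected,
      ?_, ?_⟩
    · obtain ⟨y, ⟨q, hq⟩, -, -, rfl⟩ := mem_petrieDual_faces.1 hF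
      exact ⟨q, isPolygon_iff.2 ⟨y, hq, rfl⟩⟩
    · rintro ⟨x, hx⟩
      obtain ⟨y₀, hy₀⟩ := h.poly.exists_edge hx
      refine vertexFigure_connected_of (P := Q.petrieDual) h.poly.edge_spec hx hy₀ ?_
      intro S h0 hS
      refine h.poly.vertexFigure_induction (p := fun y => y ∈ S) hy₀ h0 ?_
      intro a ha ha0 hm
      -- The corner `a (-1)`, `a 0`, `a 1` of a face is also one of a Petrie polygon, so the
      -- vertex-figures have the same links.
      obtain ⟨y, hy, y0, y1, y2⟩ := hface _ (ha.shift (-1))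
      replace y1 : y 1 = x := y1.trans (by simpa using ha0)
      replace y2 : y 2 = a 1 := y2
      replace y0 : y 0 = a (-1) := y0
      refine hS _ _ (fun e => ha.ne_neg_one e.symm) ⟨_, hy.2, hFE _ hy.2, ?_, ?_⟩ hm
      · rw [← y0, ← y1]
        exact mem_cycEdges y 0
      · rw [← y1, ← y2]
        exact mem_cycEdges y 1
    · intro e he
      induction e with
      | _ x y =>
        replace he : s(x, y) ∈ Q.edges := he
        obtain ⟨F, hF, heF⟩ := h.poly.exists_face he
        obtain ⟨G, hG, heG, hne, hu⟩ := h.poly.exists_other he hF heF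
        obtain ⟨a, ha, rfl, rfl, rfl⟩ := h.poly.exists_tracks_start hF heF
        obtain ⟨b, hb, rfl, b0, b1⟩ := h.poly.exists_tracks_start hG heG
        -- The two faces on the edge give two ways to continue it by a corner, hence two Petrie
        -- polygons. They differ because by `hU` a corner determines its face.
        obtain ⟨u, hu', u0, u1, u2⟩ := hface a ha
        obtain ⟨v, hv', v0, v1, v2⟩ := hface b hb
        refine Set.ncard_eq_two.2 ⟨cycEdges u, cycEdges v, fun e => hne ?_, ?_⟩
        · have := hu'.ext hv' e (by rw [u0, v0, b0]) (by rw [u1, v1, b1])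
          rw [hU b a hb ha b0 b1 (by rw [← v2, ← u2, this])]
        · ext H
          constructor
          · rintro ⟨hH, heH⟩
            obtain ⟨y, ⟨q, hq⟩, hy, hE, rfl⟩ := mem_petrieDual_faces.1 hH
            obtain ⟨y', hy', hyy', y0, y1⟩ :=
              Tracks.exists_start (P := Q.petrieDual) (w := y) ⟨⟨q, hq⟩, hH⟩ heH
            obtain ⟨d, hd, d0, d1, d2⟩ := hcorner y' hy'
            rw [← hyy']
            rcases hu _ hd.2 (by rw [← y0, ← y1, ← d0, ← d1]; exact mem_cycEdges d 0) with e | e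
            · have hda := hd.ext ha e (d0.trans y0) (d1.trans y1)
              rw [h.petriePath_ext hy' hu' (by rw [y0, u0]) (by rw [y1, u1])
                (by rw [← d2, u2, hda])]
              exact Or.inl rfl
            · have hdb := hd.ext hb e ((d0.trans y0).trans b0.symm) ((d1.trans y1).trans b1.symm)
              rw [h.petriePath_ext hy' hv' (by rw [y0, v0, b0]) (by rw [y1, v1, b1])
                (by rw [← d2, v2, hdb])]
              exact Or.inr rfl
          · rintro (rfl | rfl)
            · exact ⟨hu'.2, by rw [← u0, ← u1]; exact mem_cycEdges u 0⟩
            · exact ⟨hv'.2, by rw [← b0, ← b1, ← v0, ← v1]; exact mem_cycEdges v 0⟩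
  refine ⟨hpoly, hzt, fun y hy => ?_, h.pos, h.norm_eq, h.sum_eq, hspan, hbal⟩
  obtain ⟨a, ha, a0, a1, a2⟩ := hcorner y hy
  obtain ⟨L, hL, e0, e1, e2⟩ := hreach a ha
  refine ⟨L, petrieDual_map_eq (f := L.toEquiv) hL, fun i => ?_⟩
  exact congrFun (h.petriePath_ext (htr L hL) hy (e0.trans a0) (e1.trans a1) (e2.trans a2)) i

end CentredRegular

end Skeletal

/-! ### Linear isometries from Gram matrices -/

theorem linearIndependent_of_forall_inner {v : Fin 3 → E3}
    (h : ∀ n : E3, (∀ i, inner ℝ n (v i) = 0) → n = 0) : LinearIndependent ℝ v := by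
  have hs : ⊤ ≤ Submodule.span ℝ (Set.range v) := by
    rw [top_le_iff, ← Submodule.orthogonal_eq_bot_iff, Submodule.eq_bot_iff]
    intro n hn
    refine h n fun i => ?_
    rw [real_inner_comm]
    exact hn _ (Submodule.subset_span ⟨i, rfl⟩)
  exact linearIndependent_of_top_le_span_of_card_eq_finrank hs (by simp)

/-- The `v i` form a basis, so they can be sent to the `u i`; equality of the Gram matrices extends
bilinearly to preservation of all inner products. -/
theorem exists_linearIsometryEquiv {v u : Fin 3 → E3}
    (h : ∀ n : E3, (∀ i, inner ℝ n (v i) = 0) → n = 0)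
    (hvu : ∀ i j, inner ℝ (u i) (u j) = (inner ℝ (v i) (v j) : ℝ)) :
    ∃ L : E3 ≃ₗᵢ[ℝ] E3, ∀ i, L (v i) = u i := by
  let b := basisOfLinearIndependentOfCardEqFinrank (linearIndependent_of_forall_inner h)
    (by simp)
  have hb : ∀ i, b i = v i := fun i => by simp [b]
  let L : E3 →ₗ[ℝ] E3 := b.constr ℝ u
  have hL : ∀ i, L (v i) = u i := fun i => by rw [← hb, Module.Basis.constr_basis]
  have h1 : ∀ i y, inner ℝ (L (v i)) (L y) = (inner ℝ (v i) y : ℝ) := by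
    intro i y
    have : (innerₗ E3 (L (v i))) ∘ₗ L = innerₗ E3 (v i) := b.ext fun j => by
      simp [hb, hL, hvu]
    exact LinearMap.congr_fun this y
  have h2 : ∀ x y, inner ℝ (L x) (L y) = (inner ℝ x y : ℝ) := by
    intro x y
    have : (innerₗ E3 (L y)) ∘ₗ L = innerₗ E3 y := b.ext fun j => by
      simp only [LinearMap.comp_apply, innerₗ_apply_apply, hb]
      rw [real_inner_comm, h1, real_inner_comm]
    rw [real_inner_comm, real_inner_comm y x]
    exact LinearMap.congr_fun this x
  exact ⟨(L.isometryOfInner h2).toLinearIsometryEquiv rfl, hL⟩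

namespace Skeletal

variable {V : Set E3} {c d R : ℝ} {p q : ℕ} {w a b z : ℤ → E3}

/-! ### Figures given by vertices and inner products -/

/-- The points `x` and `y` of `V` have inner product `c`. -/
def Adj (V : Set E3) (c : ℝ) (x y : E3) : Prop :=
  x ∈ V ∧ y ∈ V ∧ x ≠ y ∧ inner ℝ x y = c

/-- Two adjacent edges whose free ends have inner product `d`. -/
def Corner (V : Set E3) (c d : ℝ) (x y z : E3) : Prop :=
  Adj V c x y ∧ Adj V c y z ∧ x ≠ z ∧ inner ℝ x z = d

theorem Adj.symm {x y : E3} (h : Adj V c x y) : Adj V c y x :=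
  ⟨h.2.1, h.1, h.2.2.1.symm, by rw [real_inner_comm]; exact h.2.2.2⟩

theorem mem_ofVertices_edges {x y : E3} : s(x, y) ∈ (ofVertices V c p).edges ↔ Adj V c x y := by
  constructor
  · rintro ⟨x', y', z', h1, h2, h3, h4⟩
    rcases Sym2.eq_iff.1 h4 with ⟨rfl, rfl⟩ | ⟨rfl, rfl⟩
    · exact ⟨y', h1, h2, h3⟩
    · exact Adj.symm ⟨y', h1, h2, h3⟩
  · rintro ⟨h1, h2, h3, h4⟩
    exact ⟨x, h1, y, h2, h3, h4, rfl⟩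

/-- A closed planar polygon with `p` vertices in `V` and edges of the prescribed kind. -/
structure FaceCycle (V : Set E3) (c : ℝ) (p : ℕ) (a : ℤ → E3) : Prop where
  cyc : IsCyc p a
  adj : ∀ i, Adj V c (a i) (a (i + 1))
  planar : Coplanar ℝ (Set.range a)

theorem FaceCycle.tracks (h : FaceCycle V c p a) : (ofVertices V c p).Tracks a := by
  refine ⟨⟨p, h.cyc⟩, isPolygon_iff.2 ⟨a, h.cyc, rfl⟩, ?_, ?_⟩
  · rintro _ ⟨i, rfl⟩
    exact mem_ofVertices_edges (p := p).2 (h.adj i)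
  · rw [polygonVertices_cycEdges]
    exact h.planar

theorem Tracks.faceCycle (h : (ofVertices V c p).Tracks a) : FaceCycle V c p a := by
  obtain ⟨⟨q, hq⟩, h1, h2, h3⟩ := h
  obtain ⟨b, hb, he⟩ := isPolygon_iff.1 h1
  refine ⟨?_, fun i => ?_, by rwa [polygonVertices_cycEdges] at h3⟩
  · obtain ⟨k, rfl | rfl⟩ := hb.eq_shift_or_reflect hq he.symm
    exacts [hb.shift k, hb.reflect k]
  · exact mem_ofVertices_edges (p := p).1 (h2 _ (mem_cycEdges a i))

theorem coplanar_image (L : E3 ≃ₗᵢ[ℝ] E3) (h : Coplanar ℝ (Set.range a)) :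
    Coplanar ℝ (Set.range fun i => L (a i)) := by
  rw [coplanar_iff_exists_inner] at h ⊢
  obtain ⟨n, hn, k, hk⟩ := h
  refine ⟨L n, by simpa using hn, k, ?_⟩
  rintro _ ⟨i, rfl⟩
  rw [L.inner_map_map]
  exact hk _ ⟨i, rfl⟩

theorem FaceCycle.map (h : FaceCycle V c p a) (L : E3 ≃ₗᵢ[ℝ] E3) (hL : ∀ x ∈ V, L x ∈ V) :
    FaceCycle V c p fun i => L (a i) where
  cyc := h.cyc.comp L.injective.injOn
  adj i := by
    obtain ⟨h1, h2, h3, h4⟩ := h.adj i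
    exact ⟨hL _ h1, hL _ h2, fun e => h3 (L.injective e), by rw [L.inner_map_map]; exact h4⟩
  planar := coplanar_image L h.planar

theorem ofVertices_stable (L : E3 ≃ₗᵢ[ℝ] E3) (hL : ∀ x ∈ V, L x ∈ V) :
    (ofVertices V c p).Stable L := by
  refine ⟨hL, ?_, ?_⟩
  · rintro _ ⟨x, hx, y, hy, hne, hc, rfl⟩
    exact ⟨L x, hL x hx, L y, hL y hy, fun e => hne (L.injective e),
      by rw [L.inner_map_map]; exact hc, rfl⟩
  · intro F hF
    obtain ⟨b, hb, rfl⟩ := isPolygon_iff.1 hF.1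
    rw [image_cycEdges]
    exact ((Tracks.faceCycle (p := p) ⟨⟨p, hb⟩, hF⟩).map L hL).tracks.2

/-- The data from which `ofVertices V c p` is recognised as a regular polyhedron. -/
structure CornerSystem (V : Set E3) (c d : ℝ) (p : ℕ) (w : ℤ → E3) (R : ℝ) : Prop where
  finite : V.Finite
  pos : 0 < R
  norm_eq : ∀ x ∈ V, ‖x‖ = R
  sum_eq : ∑ᶠ x ∈ V, x = 0
  base : FaceCycle V c p w
  span : ∀ n : E3, inner ℝ n (w 0) = 0 → inner ℝ n (w 1) = 0 → inner ℝ n (w 2) = 0 → n = 0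
  corner : ∀ a, FaceCycle V c p a → inner ℝ (a 0) (a 2) = d
  unique : ∀ a, FaceCycle V c p a → a 0 = w 0 → a 1 = w 1 → a 2 = w 2 → a = w
  gram : ∀ x y z, Corner V c d x y z → ∀ v ∈ V, ∃ v' ∈ V, inner ℝ v' x = (inner ℝ v (w 0) : ℝ) ∧
    inner ℝ v' y = (inner ℝ v (w 1) : ℝ) ∧ inner ℝ v' z = (inner ℝ v (w 2) : ℝ)
  two : ∀ x y, Adj V c x y → ∃ z z', z ≠ z' ∧ ∀ u, Corner V c d x y u ↔ u = z ∨ u = z'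
  link : ∀ x y u, Adj V c x y → Adj V c x u → y = u ∨ Corner V c d y x u ∨
    ∃ v, Corner V c d y x v ∧ Corner V c d v x u
  connected : ∃ x₀ ∈ V, ∀ S : Set E3, x₀ ∈ S → (∀ x y, Adj V c x y → x ∈ S → y ∈ S) → V ⊆ S

/-! ### Regular polyhedra from corner systems -/

namespace CornerSystem

variable (h : CornerSystem V c d p w R)
include h

theorem corner_of_faceCycle (ha : FaceCycle V c p a) : Corner V c d (a 0) (a 1) (a 2) :=
  ⟨ha.adj 0, ha.adj 1, ha.cyc.ne_succ_succ 0, h.corner a ha⟩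

/-- Vertices have norm `R`, edges have inner product `c` and corners `d`, so all corners share one
Gram matrix. -/
theorem exists_isometry {x y u : E3} (hc : Corner V c d x y u) :
    ∃ L : E3 ≃ₗᵢ[ℝ] E3, (∀ v ∈ V, L v ∈ V) ∧ (∀ v ∈ V, L.symm v ∈ V) ∧
      L (w 0) = x ∧ L (w 1) = y ∧ L (w 2) = u := by
  have hb := h.corner_of_faceCycle h.base
  have hself : ∀ x ∈ V, inner ℝ x x = R ^ 2 := fun x hx => by
    rw [real_inner_self_eq_norm_sq, h.norm_eq x hx]
  obtain ⟨L, hL⟩ := exists_linearIsometryEquiv (v := ![w 0, w 1, w 2]) (u := ![x, y, u])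
    (fun n hn => h.span n (hn 0) (hn 1) (hn 2)) (by
      have e1 := hc.1.2.2.2
      have e2 := hc.2.1.2.2.2
      have e3 := hc.2.2.2
      have f1 := hb.1.2.2.2
      have f2 := hb.2.1.2.2.2
      have f3 := hb.2.2.2
      have g1 := hself _ hc.1.1
      have g2 := hself _ hc.1.2.1
      have g3 := hself _ hc.2.1.2.1
      have k1 := hself _ hb.1.1
      have k2 := hself _ hb.1.2.1
      have k3 := hself _ hb.2.1.2.1
      have e1' := (real_inner_comm x y).trans e1
      have e2' := (real_inner_comm y u).trans e2
      have e3' := (real_inner_comm x u).trans e3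
      have f1' := (real_inner_comm (w 0) (w 1)).trans f1
      have f2' := (real_inner_comm (w 1) (w 2)).trans f2
      have f3' := (real_inner_comm (w 0) (w 2)).trans f3
      simp only [Fin.forall_fin_succ]
      simp only [Matrix.cons_val_zero, Matrix.cons_val_succ, Matrix.cons_val_fin_one]
      simp only [e1, e2, e3, f1, f2, f3, g1, g2, g3, k1, k2, k3, e1', e2', e3', f1', f2', f3',
        implies_true, and_true])
  have h0 : L (w 0) = x := hL 0
  have h1 : L (w 1) = y := hL 1
  have h2 : L (w 2) = u := hL 2
  have hmem : ∀ v ∈ V, L v ∈ V := by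
    intro v hv
    -- The vertex `v'` lies to the corner `x, y, u` as `v` does to the base corner. A point is
    -- determined by its inner products with three independent vectors, so `L v = v'`.
    obtain ⟨v', hv', e0, e1, e2⟩ := h.gram x y u hc v hv
    have : L.symm v' - v = 0 := by
      have key : ∀ m, inner ℝ v' (L m) = (inner ℝ v m : ℝ) →
          inner ℝ (L.symm v' - v) m = (0 : ℝ) := by
        intro m hm
        rw [inner_sub_left, ← hm, LinearIsometryEquiv.inner_map_eq_flip, L.symm_symm, sub_self]
      exact h.span _ (key _ (by rw [h0, e0])) (key _ (by rw [h1, e1])) (key _ (by rw [h2, e2]))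
    rw [← sub_eq_zero.1 this, L.apply_symm_apply]
    exact hv'
  refine ⟨L, hmem, fun v hv => ?_, h0, h1, h2⟩
  have himg : L '' V = V := by
    refine Set.eq_of_subset_of_ncard_le (Set.image_subset_iff.2 hmem) ?_ h.finite
    rw [Set.ncard_image_of_injective _ L.injective]
  rw [← himg] at hv
  obtain ⟨v, hv, rfl⟩ := hv
  rwa [L.symm_apply_apply]

theorem exists_faceCycle {x y u : E3} (hc : Corner V c d x y u) :
    ∃ a, FaceCycle V c p a ∧ a 0 = x ∧ a 1 = y ∧ a 2 = u := by
  obtain ⟨L, hL, -, h0, h1, h2⟩ := h.exists_isometry hc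
  exact ⟨_, h.base.map L hL, h0, h1, h2⟩

theorem exists_isometry_faceCycle (ha : FaceCycle V c p a) :
    ∃ L : E3 ≃ₗᵢ[ℝ] E3, (ofVertices V c p).map L = ofVertices V c p ∧ (∀ i, L (w i) = a i) := by
  obtain ⟨L, hL, hL', h0, h1, h2⟩ := h.exists_isometry (h.corner_of_faceCycle ha)
  refine ⟨L, map_eq_of_stable (f := L.toEquiv) (ofVertices_stable L hL)
    (ofVertices_stable L.symm hL'), fun i => ?_⟩
  -- The isometry is known only on a corner; pulled back, the face starts with the base corner and
  -- is therefore the base face.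
  have := h.unique _ (ha.map L.symm hL') (by rw [← h0, L.symm_apply_apply])
    (by rw [← h1, L.symm_apply_apply]) (by rw [← h2, L.symm_apply_apply])
  rw [← congrFun this i, L.apply_symm_apply]

theorem faceCycle_ext (ha : FaceCycle V c p a) (hb : FaceCycle V c p b) (h0 : a 0 = b 0)
    (h1 : a 1 = b 1) (h2 : a 2 = b 2) : a = b := by
  obtain ⟨L, hL, hL', e0, e1, e2⟩ := h.exists_isometry (h.corner_of_faceCycle ha)
  have i1 := h.unique _ (ha.map L.symm hL') (by rw [← e0, L.symm_apply_apply])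
    (by rw [← e1, L.symm_apply_apply]) (by rw [← e2, L.symm_apply_apply])
  have i2 := h.unique _ (hb.map L.symm hL') (by rw [← h0, ← e0, L.symm_apply_apply])
    (by rw [← h1, ← e1, L.symm_apply_apply]) (by rw [← h2, ← e2, L.symm_apply_apply])
  funext i
  exact L.symm.injective (congrFun (i1.trans i2.symm) i)

theorem isPolyhedron : (ofVertices V c p).IsPolyhedron := by
  have hspec : ∀ e ∈ (ofVertices V c p).edges,
      ¬ e.IsDiag ∧ ∀ x ∈ e, x ∈ (ofVertices V c p).verts := by
    rintro _ ⟨x, hx, y, hy, hne, -, rfl⟩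
    refine ⟨hne, fun z hz => ?_⟩
    rcases Sym2.mem_iff.1 hz with rfl | rfl
    exacts [hx, hy]
  have hFE : ∀ F ∈ (ofVertices V c p).faces, F ⊆ (ofVertices V c p).edges := fun F hF => hF.2.1
  refine ⟨h.finite, hspec, fun F hF => ⟨⟨p, hF.1⟩, hFE F hF⟩, ?_, ?_, ?_⟩
  · obtain ⟨x₀, hx₀, hconn⟩ := h.connected
    exact edgeGraph_connected_of hspec hx₀ fun S h0 hS =>
      hconn S h0 fun x y hxy => hS x y (mem_ofVertices_edges.2 hxy)
  · rintro ⟨x, hx⟩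
    -- An isolated `x` would contradict connectedness: `{x}` (if `x = x₀`) or its complement would
    -- be closed under adjacency.
    obtain ⟨y₀, hy₀⟩ : ∃ y, Adj V c x y := by
      by_contra hne
      obtain ⟨x₀, hx₀, hconn⟩ := h.connected
      by_cases hxx : x = x₀
      · subst hxx
        have := hconn {x} rfl fun u v huv hu => (hne ⟨v, hu ▸ huv⟩).elim
        exact (h.base.adj 0).2.2.1 ((this (h.base.adj 0).1).trans (this (h.base.adj 0).2.1).symm)
      · exact hconn {x}ᶜ (fun e => hxx (Eq.symm e))
          (fun u v huv _ hv => hne ⟨u, by rw [← (hv : v = x)]; exact huv.symm⟩) hx rfl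
    refine vertexFigure_connected_of hspec hx (mem_ofVertices_edges.2 hy₀) fun S h0 hS y hy => ?_
    rw [mem_ofVertices_edges] at hy
    have hstep : ∀ y z, Corner V c d y x z → y ∈ S → z ∈ S := by
      intro y z hc
      obtain ⟨a, ha, rfl, rfl, rfl⟩ := h.exists_faceCycle hc
      exact hS _ _ hc.2.2.1 ⟨_, ha.tracks.2, hFE _ ha.tracks.2, mem_cycEdges a 0, mem_cycEdges a 1⟩
    rcases h.link x y₀ y hy₀ hy with rfl | h1 | ⟨v, h1, h2⟩
    · exact h0
    · exact hstep _ _ h1 h0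
    · exact hstep _ _ h2 (hstep _ _ h1 h0)
  · intro e he
    induction e with
    | _ x y =>
      rw [mem_ofVertices_edges] at he
      -- A face on the edge, run from `x` to `y`, is determined by its third vertex, for which there
      -- are two choices.
      obtain ⟨z, z', hne, hz⟩ := h.two x y he
      obtain ⟨a, ha, a0, a1, a2⟩ := h.exists_faceCycle ((hz z).2 (Or.inl rfl))
      obtain ⟨b, hb, b0, b1, b2⟩ := h.exists_faceCycle ((hz z').2 (Or.inr rfl))
      refine Set.ncard_eq_two.2 ⟨cycEdges a, cycEdges b, fun e => hne ?_, ?_⟩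
      · rw [← a2, ← b2, ha.tracks.ext hb.tracks e (a0.trans b0.symm) (a1.trans b1.symm)]
      · ext F
        constructor
        · rintro ⟨hF, heF⟩
          obtain ⟨f, hf, rfl⟩ := isPolygon_iff.1 hF.1
          obtain ⟨g, hg, hgf, g0, g1⟩ :=
            Tracks.exists_start (P := ofVertices V c p) (w := f) ⟨⟨p, hf⟩, hF⟩ heF
          have hgc := h.corner_of_faceCycle hg.faceCycle
          rw [g0, g1] at hgc
          rw [← hgf]
          rcases (hz _).1 hgc with e | e
          · exact Or.inl (by
              rw [h.faceCycle_ext hg.faceCycle ha (g0.trans a0.symm) (g1.trans a1.symm)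
                (e.trans a2.symm)])
          · exact Or.inr (by
              rw [h.faceCycle_ext hg.faceCycle hb (g0.trans b0.symm) (g1.trans b1.symm)
                (e.trans b2.symm)]
              rfl)
        · rintro (rfl | rfl)
          · exact ⟨ha.tracks.2, by rw [← a0, ← a1]; exact mem_cycEdges a 0⟩
          · exact ⟨hb.tracks.2, by rw [← b0, ← b1]; exact mem_cycEdges b 0⟩

theorem centredRegular (hbal : ∃ N : ℕ, 0 < N ∧ ∃ ε : ℝ, (ε = 1 ∨ ε = -1) ∧
      ∑ j ∈ Finset.range N, w (2 * j) = ε • ∑ j ∈ Finset.range N, w (2 * j + 1)) :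
    (ofVertices V c p).CentredRegular w R :=
  ⟨h.isPolyhedron, h.base.tracks, fun _ ha => h.exists_isometry_faceCycle ha.faceCycle,
    h.pos, h.norm_eq, h.sum_eq, h.span, hbal⟩

/-- A path all of whose corners are those of faces, and which leaves each face after two edges, is
a Petrie path. -/
theorem petriePath (hq : IsCyc q z) (hz : ∀ i, Corner V c d (z i) (z (i + 1)) (z (i + 2)))
    (hne : ∀ i, inner ℝ (z i) (z (i + 3)) ≠ (inner ℝ (w 0) (w 3) : ℝ)) :
    (ofVertices V c p).PetriePath z := by
  intro i
  obtain ⟨a, ha, a0, a1, a2⟩ := h.exists_faceCycle (hz i)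
  refine ⟨⟨_, ha.tracks.2, by rw [← a0, ← a1]; exact mem_cycEdges a 0,
    by rw [← a1, ← a2]; exact mem_cycEdges a 1⟩, ?_⟩
  rintro ⟨G, hG, e0, e1, e2⟩
  obtain ⟨b, hb, rfl, b0, b1⟩ := h.isPolyhedron.exists_tracks_start hG e0
  have hs : ∀ k : ℤ, ∀ y, s(b k, y) ∈ cycEdges b → y ≠ b (k - 1) → y = b (k + 1) := by
    intro k y hy hne
    refine ((hb.shift k).mem_cycEdges_zero ?_).resolve_right hne
    rw [cycEdges_shift]
    simpa using hy
  have b2 : z (i + 2) = b 2 := hs 1 _ (by rwa [b1]) (by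
    show _ ≠ b 0
    rw [b0]
    exact (hq.ne_succ_succ i).symm)
  have b3 : z (i + 3) = b 3 := hs 2 _ (by rwa [← b2]) (by
    show _ ≠ b 1
    rw [b1]
    exact (hq.ne_add (i + 1) (k := 2) (by ring) (by norm_num) (by norm_num)).symm)
  -- A face containing three consecutive edges of `z` would follow `z` for four vertices. Being
  -- congruent to the base face, it would give the inner product excluded by `hne`.
  obtain ⟨L, -, hL⟩ := h.exists_isometry_faceCycle hb.faceCycle
  apply hne i
  rw [b3, ← b0, ← hL 0, ← hL 3, L.inner_map_map]

theorem petrieDual_centredRegular (hq : IsCyc q z)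
    (hz : ∀ i, Corner V c d (z i) (z (i + 1)) (z (i + 2)))
    (hne : ∀ i, inner ℝ (z i) (z (i + 3)) ≠ (inner ℝ (w 0) (w 3) : ℝ))
    (hwbal : ∃ N : ℕ, 0 < N ∧ ∃ ε : ℝ, (ε = 1 ∨ ε = -1) ∧
      ∑ j ∈ Finset.range N, w (2 * j) = ε • ∑ j ∈ Finset.range N, w (2 * j + 1))
    (hzbal : ∃ N : ℕ, 0 < N ∧ ∃ ε : ℝ, (ε = 1 ∨ ε = -1) ∧
      ∑ j ∈ Finset.range N, z (2 * j) = ε • ∑ j ∈ Finset.range N, z (2 * j + 1)) :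
    (ofVertices V c p).petrieDual.CentredRegular z R := by
  refine (h.centredRegular hwbal).petrieDual
    (fun a b ha hb => h.faceCycle_ext ha.faceCycle hb.faceCycle) hq (h.petriePath hq hz hne)
    ?_ hzbal
  obtain ⟨L, -, -, h0, h1, h2⟩ := h.exists_isometry (hz 0)
  intro n n0 n1 n2
  have key : ∀ m, inner ℝ n (L m) = (0 : ℝ) → inner ℝ (L.symm n) m = (0 : ℝ) := fun m hm => by
    rw [← hm, LinearIsometryEquiv.inner_map_eq_flip L.symm, L.symm_symm]
  have := h.span (L.symm n) (key _ (by rw [h0]; exact n0)) (key _ (by rw [h1]; exact n1))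
    (key _ (by rw [h2]; exact n2))
  simpa using this

end CornerSystem

end Skeletal

/-! ### Exact coordinates in the ring of golden integers -/

/-- The pair `(a, b)` stands for `a + b φ`, where `φ` is the golden ratio. -/
abbrev GoldenInt : Type := ℤ × ℤ

/-- Vectors with coordinates `a + b φ`. -/
abbrev GoldenVec : Type := GoldenInt × GoldenInt × GoldenInt

namespace GoldenInt

/-- The product `(a + b φ) (c + d φ)`. -/
def times (x y : GoldenInt) : GoldenInt :=
  (x.1 * y.1 + x.2 * y.2, x.1 * y.2 + x.2 * y.1 + x.2 * y.2)

/-- The real number `a + b φ`. -/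
noncomputable def val (x : GoldenInt) : ℝ := x.1 + x.2 * Real.goldenRatio

theorem val_zero : val 0 = 0 := by simp [val]

theorem val_add (x y : GoldenInt) : val (x + y) = val x + val y := by
  simp only [val, Prod.fst_add, Prod.snd_add]
  push_cast
  ring

theorem val_sub (x y : GoldenInt) : val (x - y) = val x - val y := by
  simp only [val, Prod.fst_sub, Prod.snd_sub]
  push_cast
  ring

theorem val_times (x y : GoldenInt) : val (times x y) = val x * val y := by
  simp only [val, times]
  push_cast
  linear_combination (-(x.2 : ℝ) * y.2) * Real.goldenRatio_sq

/-- Irrationality of the golden ratio makes equality of these real numbers an equality of integer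
pairs, hence decidable. -/
theorem val_eq_zero {x : GoldenInt} (h : val x = 0) : x = 0 := by
  obtain ⟨a, b⟩ := x
  simp only [val] at h
  have hb : b = 0 := by
    by_contra hb
    have hb' : (b : ℝ) ≠ 0 := Int.cast_ne_zero.2 hb
    refine Real.goldenRatio_irrational ⟨-a / b, ?_⟩
    push_cast
    rw [div_eq_iff hb']
    linarith
  subst hb
  simpa using h

theorem val_injective : Function.Injective val := fun x y h =>
  sub_eq_zero.1 (val_eq_zero (by rw [val_sub, h, sub_self]))

end GoldenInt

open GoldenInt

namespace GoldenVec

/-- The inner product. -/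
def dot (x y : GoldenVec) : GoldenInt :=
  times x.1 y.1 + (times x.2.1 y.2.1 + times x.2.2 y.2.2)

/-- The vector product. -/
def cross (x y : GoldenVec) : GoldenVec :=
  (times x.2.1 y.2.2 - times x.2.2 y.2.1, times x.2.2 y.1 - times x.1 y.2.2,
    times x.1 y.2.1 - times x.2.1 y.1)

/-- The point of space with the given coordinates. -/
noncomputable def toE3 (x : GoldenVec) : E3 := !₂[val x.1, val x.2.1, val x.2.2]

theorem inner_toE3 (x y : GoldenVec) : inner ℝ (toE3 x) (toE3 y) = val (dot x y) := by
  simp only [toE3, dot, val_add, val_times, PiLp.inner_apply, Fin.sum_univ_three]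
  simp
  ring

theorem toE3_zero : toE3 0 = 0 := by
  ext i
  fin_cases i <;> simp [toE3, val_zero]

theorem toE3_add (x y : GoldenVec) : toE3 (x + y) = toE3 x + toE3 y := by
  ext i
  fin_cases i <;> simp [toE3, val_add]

theorem toE3_sub (x y : GoldenVec) : toE3 (x - y) = toE3 x - toE3 y := by
  ext i
  fin_cases i <;> simp [toE3, val_sub]

theorem toE3_injective : Function.Injective toE3 := by
  intro x y h
  have h0 := congrArg (fun v : E3 => v 0) h
  have h1 := congrArg (fun v : E3 => v 1) h
  have h2 := congrArg (fun v : E3 => v 2) h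
  exact Prod.ext (val_injective h0) (Prod.ext (val_injective h1) (val_injective h2))

/-- Cramer's rule: the determinant times each coordinate of `n` is a combination of the three
equations with cofactors as coefficients. -/
theorem eq_zero_of_inner {x y z : GoldenVec} (h : dot (cross x y) z ≠ 0) {n : E3}
    (hx : inner ℝ n (toE3 x) = 0) (hy : inner ℝ n (toE3 y) = 0) (hz : inner ℝ n (toE3 z) = 0) :
    n = 0 := by
  have h' : val (dot (cross x y) z) ≠ 0 := fun e => h (val_eq_zero e)
  simp only [dot, cross, val_add, val_sub, val_times] at h'
  simp only [toE3, PiLp.inner_apply, Fin.sum_univ_three] at hx hy hz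
  simp at hx hy hz
  ext i
  apply mul_left_cancel₀ h'
  fin_cases i
  · show _ * n 0 = _ * (0 : ℝ)
    linear_combination
      (val y.2.1 * val z.2.2 - val y.2.2 * val z.2.1) * hx +
      (val z.2.1 * val x.2.2 - val z.2.2 * val x.2.1) * hy +
      (val x.2.1 * val y.2.2 - val x.2.2 * val y.2.1) * hz
  · show _ * n 1 = _ * (0 : ℝ)
    linear_combination
      (val y.2.2 * val z.1 - val y.1 * val z.2.2) * hx +
      (val z.2.2 * val x.1 - val z.1 * val x.2.2) * hy +
      (val x.2.2 * val y.1 - val x.1 * val y.2.2) * hz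
  · show _ * n 2 = _ * (0 : ℝ)
    linear_combination
      (val y.1 * val z.2.1 - val y.2.1 * val z.1) * hx +
      (val z.1 * val x.2.1 - val z.2.1 * val x.1) * hy +
      (val x.1 * val y.2.1 - val x.2.1 * val y.1) * hz

/-- The points `x`, `y`, `z`, `u` lie in a plane. -/
def planar (x y z u : GoldenVec) : Bool :=
  decide (dot (cross (y - x) (z - x)) (u - x) = 0)

theorem planar_of_coplanar {S : Set E3} (hS : Coplanar ℝ S) {x y z u : GoldenVec}
    (hx : toE3 x ∈ S) (hy : toE3 y ∈ S) (hz : toE3 z ∈ S) (hu : toE3 u ∈ S) :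
    planar x y z u = true := by
  obtain ⟨n, hn, k, hk⟩ := coplanar_iff_exists_inner.1 hS
  by_contra h
  have hsub : ∀ v, toE3 v ∈ S → inner ℝ n (toE3 (v - x)) = 0 := fun v hv => by
    rw [toE3_sub, inner_sub_right, hk _ hv, hk _ hx, sub_self]
  exact hn (eq_zero_of_inner (by simpa [planar] using h) (hsub y hy) (hsub z hz) (hsub u hu))

theorem coplanar_of_planar {S : Set E3} {x y z : GoldenVec} (hne : cross (y - x) (z - x) ≠ 0)
    (h : ∀ v ∈ S, ∃ u, v = toE3 u ∧ planar x y z u = true) : Coplanar ℝ S := by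
  refine coplanar_iff_exists_inner.2 ⟨toE3 (cross (y - x) (z - x)), fun e => hne ?_,
    inner ℝ (toE3 (cross (y - x) (z - x))) (toE3 x), fun v hv => ?_⟩
  · rw [← toE3_zero] at e
    exact toE3_injective e
  · obtain ⟨u, rfl, hu⟩ := h v hv
    rw [← sub_eq_zero, ← inner_sub_right, ← toE3_sub, inner_toE3, of_decide_eq_true hu, val_zero]

end GoldenVec

/-! ### Bounded quantifiers -/

/-- `f i` holds for all `i < k`. -/
def allBelow : ℕ → (ℕ → Bool) → Bool
  | 0, _ => true
  | k + 1, f => f k && allBelow k f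

/-- `f i` holds for some `i < k`. -/
def anyBelow : ℕ → (ℕ → Bool) → Bool
  | 0, _ => false
  | k + 1, f => f k || anyBelow k f

/-- The checks below are Boolean programs meant for evaluation by the kernel; lemmas of this kind
turn their outcome into propositions. -/
theorem allBelow_eq_true {k : ℕ} {f : ℕ → Bool} :
    allBelow k f = true ↔ ∀ i < k, f i = true := by
  induction k with
  | zero => simp [allBelow]
  | succ k ih =>
    rw [allBelow, Bool.and_eq_true, ih]
    exact ⟨fun h i hi => (Nat.lt_succ_iff_lt_or_eq.1 hi).elim (h.2 i) fun e => e ▸ h.1,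
      fun h => ⟨h k k.lt_succ_self, fun i hi => h i (hi.trans k.lt_succ_self)⟩⟩

theorem anyBelow_eq_true {k : ℕ} {f : ℕ → Bool} :
    anyBelow k f = true ↔ ∃ i < k, f i = true := by
  induction k with
  | zero => simp [anyBelow]
  | succ k ih =>
    rw [anyBelow, Bool.or_eq_true, ih]
    constructor
    · rintro (h | ⟨i, hi, h⟩)
      exacts [⟨k, k.lt_succ_self, h⟩, ⟨i, hi.trans k.lt_succ_self, h⟩]
    · rintro ⟨i, hi, h⟩
      rcases Nat.lt_succ_iff_lt_or_eq.1 hi with h' | rfl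
      exacts [.inr ⟨i, h', h⟩, .inl h]

/-- The entries of the list are distinct. -/
def distinct : List ℕ → Bool
  | [] => true
  | x :: l => l.all (fun y => !Nat.beq x y) && distinct l

theorem distinct_eq_true {l : List ℕ} : distinct l = true ↔ l.Nodup := by
  induction l with
  | nil => simp [distinct]
  | cons x l ih =>
    rw [distinct, Bool.and_eq_true, ih, List.nodup_cons, List.all_eq_true]
    simp only [Bool.not_eq_true', ← Bool.not_eq_true, Nat.beq_eq]
    exact and_congr_left fun _ => ⟨fun h hx => h x hx rfl, fun h y hy e => h (e ▸ hy)⟩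

/-- The lists are equal. -/
def sameList : List ℕ → List ℕ → Bool
  | [], [] => true
  | x :: l, y :: m => Nat.beq x y && sameList l m
  | _, _ => false

theorem sameList_eq_true {l m : List ℕ} : sameList l m = true ↔ l = m := by
  induction l generalizing m with
  | nil => cases m <;> simp [sameList]
  | cons x l ih => cases m <;> simp [sameList, ih]

/-! ### Figures with tabulated inner products -/

/-- A number of points with golden integer coordinates, the list of the inner products that occur
between them, and the table of the inner products, each given by its position in that list; the
table is written as a number in base 8. -/
structure InnerTable where
  size : ℕ
  vec : List GoldenVec
  cls : List GoldenInt
  table : ℕ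

/-- The sum of `f i` for `i < k`. -/
def sumBelow : ℕ → (ℕ → GoldenVec) → GoldenVec
  | 0, _ => 0
  | k + 1, f => sumBelow k f + f k

theorem toE3_sumBelow (k : ℕ) (f : ℕ → GoldenVec) :
    GoldenVec.toE3 (sumBelow k f) = ∑ i ∈ Finset.range k, GoldenVec.toE3 (f i) := by
  induction k with
  | zero => exact GoldenVec.toE3_zero
  | succ k ih => rw [sumBelow, GoldenVec.toE3_add, ih, Finset.sum_range_succ]

theorem not_or_eq_true {a b : Bool} : (!a || b) = true ↔ (a = true → b = true) := by
  cases a <;> simp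

namespace InnerTable

open GoldenInt GoldenVec Skeletal

variable (M : InnerTable)

/-- The coordinates of the point with number `i`. -/
def coord (i : ℕ) : GoldenVec := M.vec.getD i 0

/-- The position in the list of the inner product of two points. -/
def code (i j : ℕ) : ℕ :=
  -- Each base 8 digit takes three bits, stored row by row from the lowest; 7 masks one digit.
  Nat.land (Nat.shiftRight M.table (Nat.mul 3 (Nat.add (Nat.mul M.size i) j))) 7

/-- The point with number `i`. -/
noncomputable def point (i : ℕ) : E3 := toE3 (M.coord i)

/-- The set of points. -/
def points : Set E3 := {x | ∃ i < M.size, x = M.point i}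

/-- The inner product at a given position in the list. -/
noncomputable def scalar (k : ℕ) : ℝ := val (M.cls.getD k 0)

/-- The table is correct, the points are distinct and lie on a sphere, and they have sum `0`. -/
def valid : Bool :=
  allBelow M.size (fun i => allBelow M.size fun j =>
    decide (dot (M.coord i) (M.coord j) = M.cls.getD (M.code i j) 0) &&
      -- Position 0 of the list is reserved for the common squared norm; its occurring only on the
      -- diagonal makes the points distinct.
      (Nat.blt (M.code i j) M.cls.length && (Nat.beq (M.code i j) 0 == Nat.beq i j))) &&
  (decide M.cls.Nodup && decide (sumBelow M.size M.coord = 0))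

/-- The point with number `l i` where `i` is read modulo the length of `l`. -/
def entry (l : List ℕ) (i : ℤ) : ℕ := l.getD (i % l.length).toNat 0

/-- The closed polygon whose vertices have the numbers in `l`. -/
noncomputable def polygonOf (l : List ℕ) (i : ℤ) : E3 := M.point (entry l i)

/-- The list consists of at least three distinct numbers of points. -/
def isCycle (l : List ℕ) : Bool :=
  Nat.ble 3 l.length && (distinct l && l.all fun i => Nat.blt i M.size)

/-- The vertices of the polygon with even and odd index have centroids that agree up to sign. -/
def balanced (l : List ℕ) : Bool :=
  -- Summing over a full length of indices avoids a case split: for odd length every vertex occurs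
  -- once in each sum, for even length each vertex of the relevant parity occurs twice.
  let a := sumBelow l.length fun j => M.coord (l.getD (2 * j % l.length) 0)
  let b := sumBelow l.length fun j => M.coord (l.getD ((2 * j + 1) % l.length) 0)
  decide (a = b) || decide (a + b = 0)

/-- Three points forming a corner. -/
def isCorner (c d i j k : ℕ) : Bool :=
  Nat.beq (M.code i j) c && (Nat.beq (M.code j k) c && Nat.beq (M.code i k) d)

/-- All corners have the same inner products with the set of points. -/
def gramCheck (c d i₀ j₀ k₀ : ℕ) : Bool :=
  allBelow M.size fun i => allBelow M.size fun j => !Nat.beq (M.code i j) c ||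
    allBelow M.size fun k => !M.isCorner c d i j k || allBelow M.size fun v =>
      anyBelow M.size fun v' => Nat.beq (M.code v' i) (M.code v i₀) &&
        (Nat.beq (M.code v' j) (M.code v j₀) && Nat.beq (M.code v' k) (M.code v k₀))

/-- Each edge is continued by two corners. -/
def twoCheck (c d : ℕ) : Bool :=
  allBelow M.size fun i => allBelow M.size fun j => !Nat.beq (M.code i j) c ||
    anyBelow M.size fun k => M.isCorner c d i j k && anyBelow M.size fun k' =>
      M.isCorner c d i j k' && (!Nat.beq k k' && allBelow M.size fun u =>
        !M.isCorner c d i j u || (Nat.beq u k || Nat.beq u k'))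

/-- Any two edges at a point are linked by at most two corners. -/
def linkCheck (c d : ℕ) : Bool :=
  allBelow M.size fun i => allBelow M.size fun j => !Nat.beq (M.code i j) c ||
    allBelow M.size fun u => !Nat.beq (M.code i u) c || (Nat.beq j u || (M.isCorner c d j i u ||
      anyBelow M.size fun v => M.isCorner c d j i v && M.isCorner c d v i u))

/-- Each point occurs in the list, and each point in the list but the first is adjacent to an
earlier one. -/
def connectedCheck (c : ℕ) (l : List ℕ) : Bool :=
  Nat.ble 1 l.length && (l.all (fun i => Nat.blt i M.size) &&
  (allBelow M.size (fun i => anyBelow l.length fun j => Nat.beq i (l.getD j 0)) &&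
  allBelow l.length fun j => Nat.beq j 0 ||
    anyBelow j fun i => Nat.beq (M.code (l.getD i 0) (l.getD j 0)) c))

/-- The test holds for all paths with `k` edges ending in `i`, continued by `l`. -/
def allPaths (c : ℕ) (test : List ℕ → Bool) : ℕ → ℕ → List ℕ → Bool
  | 0, i, l => test (i :: l)
  | k + 1, i, l => allBelow M.size fun j =>
      !Nat.beq (M.code j i) c || allPaths c test k j (i :: l)

/-- A path is not closed, or not simple, or not planar, or begins with a corner and agrees with
`w` if its first three vertices do. -/
def faceTest (c d : ℕ) (w l : List ℕ) : Bool :=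
  !Nat.beq (M.code (l.getD (w.length - 1) 0) (l.getD 0 0)) c || (!distinct l ||
    ((Nat.beq (M.code (l.getD 0 0) (l.getD 2 0)) d &&
      (!sameList (l.take 3) (w.take 3) || sameList l w)) ||
    !(l.drop 3).all fun u => planar (M.coord (l.getD 0 0)) (M.coord (l.getD 1 0))
      (M.coord (l.getD 2 0)) (M.coord u)))

/-- All planar closed polygons begin with a corner and are determined by it. -/
def faceCheck (c d : ℕ) (w : List ℕ) : Bool :=
  allBelow M.size fun i => M.allPaths c (M.faceTest c d w) (w.length - 1) i []

/-- The polygon is a non-degenerate planar one with edges of the given kind. -/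
def baseCheck (c : ℕ) (w : List ℕ) : Bool :=
  let x := M.coord (w.getD 0 0)
  let y := M.coord (w.getD 1 0)
  let z := M.coord (w.getD 2 0)
  M.isCycle w && (M.balanced w && (!decide (dot (cross x y) z = 0) &&
    (!decide (cross (y - x) (z - x) = 0) && ((w.all fun u => planar x y z (M.coord u)) &&
      allBelow w.length fun i => Nat.beq (M.code (w.getD i 0) (w.getD ((i + 1) % w.length) 0)) c))))

/-- The polygon is a Petrie polygon. -/
def petrieCheck (c d : ℕ) (w z : List ℕ) : Bool :=
  M.isCycle z && (M.balanced z && allBelow z.length fun i =>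
    M.isCorner c d (z.getD i 0) (z.getD ((i + 1) % z.length) 0) (z.getD ((i + 2) % z.length) 0) &&
    !Nat.beq (M.code (z.getD i 0) (z.getD ((i + 3) % z.length) 0))
      (M.code (w.getD 0 0) (w.getD (3 % w.length) 0)))

/-- The figure with edges of kind `c` and corners of kind `d` is regular with face `w`. -/
def regularCheck (c d : ℕ) (w z l : List ℕ) : Bool :=
  Nat.blt 0 c && (Nat.blt c M.cls.length && (Nat.blt 0 d && (Nat.blt d M.cls.length &&
  (M.valid && (M.baseCheck c w && (M.petrieCheck c d w z && (M.connectedCheck c l &&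
  (M.gramCheck c d (w.getD 0 0) (w.getD 1 0) (w.getD 2 0) && (M.twoCheck c d &&
  (M.linkCheck c d && M.faceCheck c d w))))))))))

end InnerTable

namespace InnerTable

open GoldenInt GoldenVec Skeletal

variable {M : InnerTable} {c d : ℕ} {l w z : List ℕ}

/-! ### Periodic polygons -/

theorem entry_lt {n : ℕ} (h : M.isCycle l = true) (i : ℤ) (hn : n = l.length) :
    (i % l.length).toNat < n := by
  simp only [isCycle, Bool.and_eq_true, Nat.ble_eq] at h
  have := Int.emod_lt_of_pos i (b := l.length) (by omega)
  omega

theorem entry_add (h : M.isCycle l = true) (i : ℤ) (k : ℕ) :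
    entry l (i + k) = l.getD (((i % l.length).toNat + k) % l.length) 0 := by
  have h0 := entry_lt h i rfl
  rw [entry]
  congr 1
  zify
  have h1 : 0 ≤ i % (l.length : ℤ) := Int.emod_nonneg _ (by omega)
  have h2 : 0 ≤ (i + k) % (l.length : ℤ) := Int.emod_nonneg _ (by omega)
  rw [Int.toNat_of_nonneg h1, Int.toNat_of_nonneg h2, Int.emod_add_emod]

theorem entry_natCast (l : List ℕ) (i : ℕ) : entry l i = l.getD (i % l.length) 0 := by
  rw [entry]
  congr 1

theorem entry_lt_size (h : M.isCycle l = true) (i : ℤ) : entry l i < M.size := by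
  have h0 := entry_lt h i rfl
  simp only [isCycle, Bool.and_eq_true, List.all_eq_true, Nat.blt_eq] at h
  rw [entry, List.getD_eq_getElem _ _ h0]
  exact h.2.2 _ (List.getElem_mem h0)

theorem entry_eq_iff (h : M.isCycle l = true) {i j : ℤ} :
    entry l i = entry l j ↔ (l.length : ℤ) ∣ i - j := by
  have hi := entry_lt h i rfl
  have hj := entry_lt h j rfl
  simp only [isCycle, Bool.and_eq_true, distinct_eq_true] at h
  rw [entry, entry, List.getD_eq_getElem _ _ hi, List.getD_eq_getElem _ _ hj, h.2.1.getElem_inj_iff]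
  have h1 : 0 ≤ i % (l.length : ℤ) := Int.emod_nonneg _ (by omega)
  have h2 : 0 ≤ j % (l.length : ℤ) := Int.emod_nonneg _ (by omega)
  rw [← Int.natCast_inj, Int.toNat_of_nonneg h1, Int.toNat_of_nonneg h2,
    Int.emod_eq_emod_iff_emod_sub_eq_zero, ← Int.dvd_iff_emod_eq_zero]

theorem exists_balance (h : M.isCycle l = true) (hb : M.balanced l = true) :
    ∃ N : ℕ, 0 < N ∧ ∃ ε : ℝ, (ε = 1 ∨ ε = -1) ∧
      ∑ j ∈ Finset.range N, M.polygonOf l (2 * j) =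
        ε • ∑ j ∈ Finset.range N, M.polygonOf l (2 * j + 1) := by
  have h0 := entry_lt h 0 rfl
  refine ⟨l.length, by omega, ?_⟩
  have h1 : ∑ j ∈ Finset.range l.length, M.polygonOf l (2 * j) =
      toE3 (sumBelow l.length fun j => M.coord (l.getD (2 * j % l.length) 0)) := by
    rw [toE3_sumBelow]
    refine Finset.sum_congr rfl fun j _ => ?_
    rw [← entry_natCast]
    push_cast
    rfl
  have h2 : ∑ j ∈ Finset.range l.length, M.polygonOf l (2 * j + 1) =
      toE3 (sumBelow l.length fun j => M.coord (l.getD ((2 * j + 1) % l.length) 0)) := by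
    rw [toE3_sumBelow]
    refine Finset.sum_congr rfl fun j _ => ?_
    rw [← entry_natCast]
    push_cast
    rfl
  simp only [balanced, Bool.or_eq_true, decide_eq_true_eq] at hb
  rw [h1, h2]
  rcases hb with hb | hb
  · exact ⟨1, .inl rfl, by rw [one_smul, hb]⟩
  · refine ⟨-1, .inr rfl, ?_⟩
    rw [neg_one_smul, eq_neg_iff_add_eq_zero, ← toE3_add, hb, toE3_zero]

/-! ### Reading off inner products -/

section valid

variable (h : M.valid = true) {i j k i' j' : ℕ}
include h

theorem inner_point (hi : i < M.size) (hj : j < M.size) :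
    inner ℝ (M.point i) (M.point j) = M.scalar (M.code i j) := by
  simp only [valid, Bool.and_eq_true, allBelow_eq_true, decide_eq_true_eq] at h
  rw [point, point, inner_toE3, (h.1 i hi j hj).1, scalar]

theorem code_lt (hi : i < M.size) (hj : j < M.size) : M.code i j < M.cls.length := by
  simp only [valid, Bool.and_eq_true, allBelow_eq_true, Nat.blt_eq] at h
  exact (h.1 i hi j hj).2.1

theorem code_eq_zero_iff (hi : i < M.size) (hj : j < M.size) : M.code i j = 0 ↔ i = j := by
  simp only [valid, Bool.and_eq_true, allBelow_eq_true, beq_iff_eq] at h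
  rw [← Nat.beq_eq, (h.1 i hi j hj).2.2, Nat.beq_eq]

/-- The list has no repetitions and `val` is injective; hence comparing real inner products becomes
comparing small natural numbers. -/
theorem scalar_inj {a b : ℕ} (ha : a < M.cls.length) (hb : b < M.cls.length) :
    M.scalar a = M.scalar b ↔ a = b := by
  simp only [valid, Bool.and_eq_true, decide_eq_true_eq] at h
  rw [scalar, scalar, val_injective.eq_iff, List.getD_eq_getElem _ _ ha,
    List.getD_eq_getElem _ _ hb, h.2.1.getElem_inj_iff]

theorem inner_eq_scalar_iff (hi : i < M.size) (hj : j < M.size) (hc : c < M.cls.length) :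
    inner ℝ (M.point i) (M.point j) = M.scalar c ↔ M.code i j = c := by
  rw [inner_point h hi hj, scalar_inj h (code_lt h hi hj) hc]

theorem inner_eq_inner_iff (hi : i < M.size) (hj : j < M.size) (hi' : i' < M.size)
    (hj' : j' < M.size) :
    inner ℝ (M.point i) (M.point j) = (inner ℝ (M.point i') (M.point j') : ℝ) ↔
      M.code i j = M.code i' j' := by
  rw [inner_point h hi' hj', inner_eq_scalar_iff h hi hj (code_lt h hi' hj')]

theorem point_inj (hi : i < M.size) (hj : j < M.size) : M.point i = M.point j ↔ i = j := by
  refine ⟨fun e => ?_, fun e => e ▸ rfl⟩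
  rw [← code_eq_zero_iff h hi hj, ← (code_eq_zero_iff h hi hi).2 rfl,
    ← inner_eq_inner_iff h hi hj hi hi, e]

theorem norm_point (hi : i < M.size) : ‖M.point i‖ = √(M.scalar 0) := by
  have := inner_point h hi hi
  rw [(code_eq_zero_iff h hi hi).2 rfl, real_inner_self_eq_norm_sq] at this
  rw [← this, Real.sqrt_sq (norm_nonneg _)]

omit h in
theorem points_eq_image : M.points = ((Finset.range M.size).image M.point : Finset E3) := by
  ext x
  simp [points, eq_comm]

theorem finsum_points : ∑ᶠ x ∈ M.points, x = 0 := by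
  rw [points_eq_image, finsum_mem_coe_finset, Finset.sum_image fun i hi j hj e =>
    (point_inj h (Finset.mem_range.1 hi) (Finset.mem_range.1 hj)).1 e]
  have h0 : sumBelow M.size M.coord = 0 := by
    simp only [valid, Bool.and_eq_true, decide_eq_true_eq] at h
    exact h.2.2
  rw [← toE3_zero, ← h0, toE3_sumBelow]
  rfl

theorem isCyc_polygonOf (hl : M.isCycle l = true) : IsCyc l.length (M.polygonOf l) := by
  refine ⟨?_, fun i j => ?_⟩
  · simp only [isCycle, Bool.and_eq_true, Nat.ble_eq] at hl
    exact hl.1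
  · rw [polygonOf, polygonOf, point_inj h (entry_lt_size hl i) (entry_lt_size hl j),
      entry_eq_iff hl]

variable (hc : 0 < c) (hc' : c < M.cls.length)
include hc hc'

theorem adj_iff (hi : i < M.size) (hj : j < M.size) :
    Adj M.points (M.scalar c) (M.point i) (M.point j) ↔ M.code i j = c := by
  refine ⟨fun e => (inner_eq_scalar_iff h hi hj hc').1 e.2.2.2, fun e =>
    ⟨⟨i, hi, rfl⟩, ⟨j, hj, rfl⟩, fun e' => ?_, (inner_eq_scalar_iff h hi hj hc').2 e⟩⟩
  rw [point_inj h hi hj, ← code_eq_zero_iff h hi hj] at e'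
  omega

variable (hd : 0 < d) (hd' : d < M.cls.length)
include hd hd'

theorem corner_iff (hi : i < M.size) (hj : j < M.size) (hk : k < M.size) :
    Corner M.points (M.scalar c) (M.scalar d) (M.point i) (M.point j) (M.point k) ↔
      M.isCorner c d i j k = true := by
  simp only [isCorner, Bool.and_eq_true, Nat.beq_eq]
  rw [Corner, adj_iff h hc hc' hi hj, adj_iff h hc hc' hj hk, ← adj_iff h hd hd' hi hk, Adj]
  exact and_congr_right fun _ => and_congr_right fun _ =>
    ⟨fun e => ⟨⟨i, hi, rfl⟩, ⟨k, hk, rfl⟩, e⟩, fun e => e.2.2⟩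

theorem exists_of_gramCheck {x₀ y₀ z₀ : ℕ} (hg : M.gramCheck c d x₀ y₀ z₀ = true)
    (hx₀ : x₀ < M.size) (hy₀ : y₀ < M.size) (hz₀ : z₀ < M.size) (x y z : E3)
    (hxyz : Corner M.points (M.scalar c) (M.scalar d) x y z) (v : E3) (hv : v ∈ M.points) :
    ∃ v' ∈ M.points, inner ℝ v' x = (inner ℝ v (M.point x₀) : ℝ) ∧
      inner ℝ v' y = (inner ℝ v (M.point y₀) : ℝ) ∧
      inner ℝ v' z = (inner ℝ v (M.point z₀) : ℝ) := by
  obtain ⟨⟨i, hi, rfl⟩, ⟨j, hj, rfl⟩, -⟩ := hxyz.1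
  obtain ⟨-, ⟨k, hk, rfl⟩, -⟩ := hxyz.2.1
  obtain ⟨v, hv, rfl⟩ := hv
  simp only [gramCheck, allBelow_eq_true, not_or_eq_true, anyBelow_eq_true, Bool.and_eq_true,
    Nat.beq_eq] at hg
  obtain ⟨v', hv', h1, h2, h3⟩ := hg i hi j hj ((adj_iff h hc hc' hi hj).1 hxyz.1) k hk
    ((corner_iff h hc hc' hd hd' hi hj hk).1 hxyz) v hv
  exact ⟨_, ⟨v', hv', rfl⟩, (inner_eq_inner_iff h hv' hi hv hx₀).2 h1,
    (inner_eq_inner_iff h hv' hj hv hy₀).2 h2, (inner_eq_inner_iff h hv' hk hv hz₀).2 h3⟩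

theorem exists_of_twoCheck (ht : M.twoCheck c d = true) (x y : E3)
    (hxy : Adj M.points (M.scalar c) x y) :
    ∃ z z', z ≠ z' ∧ ∀ u, Corner M.points (M.scalar c) (M.scalar d) x y u ↔ u = z ∨ u = z' := by
  obtain ⟨⟨i, hi, rfl⟩, ⟨j, hj, rfl⟩, -⟩ := id hxy
  simp only [twoCheck, allBelow_eq_true, not_or_eq_true, anyBelow_eq_true, Bool.and_eq_true] at ht
  simp only [Nat.beq_eq, Bool.or_eq_true, Bool.not_eq_true', ← Bool.not_eq_true] at ht
  obtain ⟨k, hk, h1, k', hk', h2, h3, h4⟩ := ht i hi j hj ((adj_iff h hc hc' hi hj).1 hxy)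
  refine ⟨M.point k, M.point k', fun e => h3 ((point_inj h hk hk').1 e), fun u =>
    ⟨fun hu => ?_, ?_⟩⟩
  · obtain ⟨-, ⟨u, hu', rfl⟩, -⟩ := hu.2.1
    rw [point_inj h hu' hk, point_inj h hu' hk']
    exact h4 u hu' ((corner_iff h hc hc' hd hd' hi hj hu').1 hu)
  · rintro (rfl | rfl)
    exacts [(corner_iff h hc hc' hd hd' hi hj hk).2 h1, (corner_iff h hc hc' hd hd' hi hj hk').2 h2]

theorem linked_of_linkCheck (ht : M.linkCheck c d = true) (x y u : E3)
    (hxy : Adj M.points (M.scalar c) x y) (hxu : Adj M.points (M.scalar c) x u) :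
    y = u ∨ Corner M.points (M.scalar c) (M.scalar d) y x u ∨
      ∃ v, Corner M.points (M.scalar c) (M.scalar d) y x v ∧
        Corner M.points (M.scalar c) (M.scalar d) v x u := by
  obtain ⟨⟨i, hi, rfl⟩, ⟨j, hj, rfl⟩, -⟩ := id hxy
  obtain ⟨-, ⟨k, hk, rfl⟩, -⟩ := id hxu
  simp only [linkCheck, allBelow_eq_true, not_or_eq_true] at ht
  simp only [Nat.beq_eq, Bool.or_eq_true, anyBelow_eq_true, Bool.and_eq_true] at ht
  rcases ht i hi j hj ((adj_iff h hc hc' hi hj).1 hxy) k hk ((adj_iff h hc hc' hi hk).1 hxu) with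
    rfl | e | ⟨v, hv, e⟩
  · exact .inl rfl
  · exact .inr (.inl ((corner_iff h hc hc' hd hd' hj hi hk).2 e))
  · exact .inr (.inr ⟨_, (corner_iff h hc hc' hd hd' hj hi hv).2 e.1,
      (corner_iff h hc hc' hd hd' hv hi hk).2 e.2⟩)

omit hd hd' in
theorem connected_of_connectedCheck (hl : M.connectedCheck c l = true) :
    ∃ x₀ ∈ M.points, ∀ S : Set E3, x₀ ∈ S →
      (∀ x y, Adj M.points (M.scalar c) x y → x ∈ S → y ∈ S) → M.points ⊆ S := by
  simp only [connectedCheck, allBelow_eq_true, anyBelow_eq_true, Bool.and_eq_true,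
    Nat.beq_eq, Bool.or_eq_true, Nat.ble_eq, List.all_eq_true, Nat.blt_eq] at hl
  obtain ⟨h0, hlt, hall, hadj⟩ := hl
  have hlt' : ∀ j < l.length, l.getD j 0 < M.size := fun j hj => by
    rw [List.getD_eq_getElem _ _ hj]
    exact hlt _ (List.getElem_mem hj)
  refine ⟨M.point (l.getD 0 0), ⟨_, hlt' 0 h0, rfl⟩, fun S hS hstep => ?_⟩
  have key : ∀ j, j < l.length → M.point (l.getD j 0) ∈ S := by
    intro j
    induction j using Nat.strong_induction_on with
    | _ j ih =>
      intro hj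
      rcases hadj j hj with rfl | ⟨i, hi, e⟩
      · exact hS
      · exact hstep _ _ ((adj_iff h hc hc' (hlt' i (hi.trans hj)) (hlt' j hj)).2 e)
          (ih i hi (hi.trans hj))
  rintro _ ⟨i, hi, rfl⟩
  obtain ⟨j, hj, rfl⟩ := hall i hi
  exact key j hj

/-! ### Faces -/

omit hc hc' hd hd' h in
-- Paths are built backwards from the last vertex, so the induction keeps the end `x` and the part
-- `l` already built arbitrary.
theorem test_of_allPaths {test : List ℕ → Bool} {k x : ℕ} (ht : M.allPaths c test k x l = true)
    (g : ℕ → ℕ) (hg : ∀ i, g i < M.size) (hgk : g k = x)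
    (hadj : ∀ i < k, M.code (g i) (g (i + 1)) = c) :
    test ((List.range (k + 1)).map g ++ l) = true := by
  induction k generalizing x l with
  | zero => simpa [allPaths, ← hgk] using ht
  | succ k ih =>
    simp only [allPaths, allBelow_eq_true, not_or_eq_true, Nat.beq_eq] at ht
    have := ih (ht (g k) (hg k) (by rw [← hgk]; exact hadj k k.lt_succ_self)) rfl
      fun i hi => hadj i (hi.trans k.lt_succ_self)
    rw [List.range_succ, List.map_append, List.append_assoc]
    simpa [hgk] using this

omit hd hd' in
-- One period of a face cycle is among the paths enumerated. It is closed, simple and planar, which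
-- leaves only the alternative of the test that states the conclusion.
theorem faceTest_of_faceCycle {a : ℤ → E3} {p : ℕ} (hp : p = w.length)
    (ht : M.faceCheck c d w = true)
    (ha : FaceCycle M.points (M.scalar c) p a) (g : ℤ → ℕ) (hg : ∀ i, g i < M.size)
    (hag : ∀ i, a i = M.point (g i)) :
    M.code (g 0) (g 2) = d ∧ ((∀ i : ℕ, i < 3 → g i = w.getD i 0) →
      ∀ i : ℕ, i < p → g i = w.getD i 0) := by
  have hp3 := ha.cyc.1
  set L := (List.range p).map fun i : ℕ => g i with hL
  have hLlen : L.length = p := by simp [hL]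
  have hLget : ∀ i < p, L.getD i 0 = g i := fun i hi => by
    rw [List.getD_eq_getElem _ _ (by omega)]
    simp [hL]
  have hadj : ∀ i, M.code (g i) (g (i + 1)) = c := fun i => by
    rw [← adj_iff h hc hc' (hg _) (hg _), ← hag, ← hag]
    exact ha.adj i
  have key : M.faceTest c d w L = true := by
    simp only [faceCheck, allBelow_eq_true] at ht
    have := test_of_allPaths (ht (g ((p - 1 : ℕ) : ℤ)) (hg _)) (fun i : ℕ => g i) (fun i => hg _)
      (by rw [hp]) fun i _ => by
        have := hadj i
        push_cast
        exact this
    rwa [← hp, Nat.sub_add_cancel (by omega), List.append_nil] at this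
  have hclosed : M.code (g ((p - 1 : ℕ) : ℤ)) (g 0) = c := by
    have h1 := hadj ((p - 1 : ℕ) : ℤ)
    have h2 : a (((p - 1 : ℕ) : ℤ) + 1) = a 0 := (ha.cyc.2 _ _).2 ⟨1, by omega⟩
    rw [hag, hag, point_inj h (hg _) (hg _)] at h2
    rwa [h2] at h1
  have hdist : distinct L = true := by
    rw [distinct_eq_true, hL, List.nodup_map_iff_inj_on List.nodup_range]
    intro i hi j hj e
    have h1 : a i = a j := by rw [hag, hag, e]
    rw [ha.cyc.2] at h1
    have := Int.eq_zero_of_abs_lt_dvd h1 (by rw [List.mem_range] at hi hj; rw [abs_lt]; omega)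
    omega
  have hplan : ((L.drop 3).all fun u => planar (M.coord (L.getD 0 0)) (M.coord (L.getD 1 0))
      (M.coord (L.getD 2 0)) (M.coord u)) = true := by
    rw [List.all_eq_true]
    intro u hu
    obtain ⟨j, -, rfl⟩ := List.mem_map.1 (List.mem_of_mem_drop hu)
    rw [hLget 0 (by omega), hLget 1 (by omega), hLget 2 (by omega)]
    exact planar_of_coplanar ha.planar ⟨_, hag _⟩ ⟨_, hag _⟩ ⟨_, hag _⟩ ⟨_, hag _⟩
  rw [faceTest, not_or_eq_true, not_or_eq_true, hplan, Bool.not_true, Bool.or_false,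
    Bool.and_eq_true, not_or_eq_true, Nat.beq_eq, Nat.beq_eq, sameList_eq_true, sameList_eq_true,
    ← hp, hLget _ (by omega), hLget _ (by omega), hLget _ (by omega)] at key
  obtain ⟨h1, h2⟩ := key hclosed hdist
  refine ⟨h1, fun h3 i hi => ?_⟩
  rw [← hLget i hi, h2 (List.ext_getElem (by simp [hLlen, hp]) fun j hj hj' => ?_)]
  have hj3 : j < 3 := by
    rw [List.length_take] at hj
    omega
  have := h3 j hj3
  rw [← hLget j (by omega), List.getD_eq_getElem _ _ (by omega),
    List.getD_eq_getElem _ _ (by omega)] at this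
  simpa using this

end valid

/-- On a sphere of radius zero consecutive vertices of the face would coincide. -/
theorem pos_of_faceCycle (h : M.valid = true) {p : ℕ} {a : ℤ → E3} {γ : ℝ}
    (ha : FaceCycle M.points γ p a) : 0 < √(M.scalar 0) := by
  refine (Real.sqrt_nonneg _).lt_of_ne' fun e => ?_
  have : ∀ i, a i = 0 := fun i => by
    obtain ⟨⟨j, hj, e'⟩, -⟩ := ha.adj i
    rw [← norm_eq_zero, e', norm_point h hj, e]
  exact (ha.adj 0).2.2.1 (by rw [this, this])

theorem faceCycle_of_baseCheck (h : M.valid = true) (hc : 0 < c) (hc' : c < M.cls.length)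
    (hw : M.baseCheck c w = true) :
    FaceCycle M.points (M.scalar c) w.length (M.polygonOf w) := by
  simp only [baseCheck, Bool.and_eq_true, allBelow_eq_true, List.all_eq_true, Nat.beq_eq,
    Bool.not_eq_true', decide_eq_false_iff_not] at hw
  obtain ⟨hcyc, -, -, hne, hplan, hadj⟩ := hw
  refine ⟨isCyc_polygonOf h hcyc, fun i => ?_, coplanar_of_planar hne ?_⟩
  · rw [polygonOf, polygonOf, adj_iff h hc hc' (entry_lt_size hcyc _) (entry_lt_size hcyc _)]
    have := entry_add hcyc i 1
    push_cast at this
    rw [this]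
    exact hadj _ (entry_lt hcyc i rfl)
  · rintro _ ⟨i, rfl⟩
    refine ⟨_, rfl, hplan _ ?_⟩
    rw [entry, List.getD_eq_getElem _ _ (entry_lt hcyc i rfl)]
    exact List.getElem_mem _

theorem entry_eq_getD (h : M.isCycle l = true) {i : ℕ} (hi : i < 3) : entry l i = l.getD i 0 := by
  simp only [isCycle, Bool.and_eq_true, Nat.ble_eq] at h
  rw [entry_natCast, Nat.mod_eq_of_lt (by omega)]

theorem isCycle_of_baseCheck (hw : M.baseCheck c w = true) : M.isCycle w = true := by
  simp only [baseCheck, Bool.and_eq_true] at hw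
  exact hw.1

/-! ### Regularity -/

theorem cornerSystem (h : M.regularCheck c d w z l = true) :
    CornerSystem M.points (M.scalar c) (M.scalar d) w.length (M.polygonOf w) √(M.scalar 0) := by
  simp only [regularCheck, Bool.and_eq_true, Nat.blt_eq] at h
  obtain ⟨hc, hc', hd, hd', hM, hw, -, hcon, hgram, htwo, hlink, hface⟩ := h
  have hbase := faceCycle_of_baseCheck hM hc hc' hw
  have hcyc := isCycle_of_baseCheck hw
  have e0 : entry w 0 = w.getD 0 0 := entry_eq_getD hcyc (by norm_num)
  have e1 : entry w 1 = w.getD 1 0 := entry_eq_getD hcyc (by norm_num)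
  have e2 : entry w 2 = w.getD 2 0 := entry_eq_getD hcyc (by norm_num)
  rw [← e0, ← e1, ← e2] at hgram
  have hidx : ∀ a, FaceCycle M.points (M.scalar c) w.length a →
      ∃ g : ℤ → ℕ, (∀ i, g i < M.size) ∧ ∀ i, a i = M.point (g i) := fun a ha => by
    choose g hg hag using fun i => (ha.adj i).1
    exact ⟨g, hg, hag⟩
  refine
    { finite := by rw [points_eq_image]; exact Finset.finite_toSet _
      pos := pos_of_faceCycle hM hbase
      norm_eq := ?_
      sum_eq := finsum_points hM
      base := hbase
      span := fun n h0 h1 h2 => eq_zero_of_inner ?_ h0 h1 h2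
      corner := fun a ha => ?_
      unique := fun a ha a0 a1 a2 => ?_
      gram := exists_of_gramCheck hM hc hc' hd hd' hgram (entry_lt_size hcyc 0)
        (entry_lt_size hcyc 1) (entry_lt_size hcyc 2)
      two := exists_of_twoCheck hM hc hc' hd hd' htwo
      link := linked_of_linkCheck hM hc hc' hd hd' hlink
      connected := connected_of_connectedCheck hM hc hc' hcon }
  · rintro _ ⟨i, hi, rfl⟩
    exact norm_point hM hi
  · simp only [baseCheck, Bool.and_eq_true, Bool.not_eq_true', decide_eq_false_iff_not] at hw
    rw [e0, e1, e2]
    exact hw.2.2.1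
  · obtain ⟨g, hg, hag⟩ := hidx a ha
    rw [hag, hag, inner_point hM (hg _) (hg _),
      (faceTest_of_faceCycle hM hc hc' rfl hface ha g hg hag).1]
  · obtain ⟨g, hg, hag⟩ := hidx a ha
    have hkey := (faceTest_of_faceCycle hM hc hc' rfl hface ha g hg hag).2
    have hent : ∀ i : ℤ, a i = M.polygonOf w i → g i = entry w i := fun i hi => by
      rwa [hag, polygonOf, point_inj hM (hg _) (entry_lt_size hcyc _)] at hi
    have hall := hkey fun i hi => by
      interval_cases i
      exacts [(hent 0 a0).trans e0, (hent 1 a1).trans e1, (hent 2 a2).trans e2]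
    funext i
    have hlt := entry_lt hcyc i rfl
    -- The check compares one period only; other indices are reduced to it.
    have : a i = a ((i % w.length).toNat : ℕ) := (ha.cyc.2 _ _).2 (by
      rw [Int.toNat_of_nonneg (Int.emod_nonneg _ (by omega))]
      exact Int.dvd_self_sub_emod)
    rw [this, hag, hall _ hlt]
    rfl

theorem centredRegular (h : M.regularCheck c d w z l = true) :
    (ofVertices M.points (M.scalar c) w.length).CentredRegular (M.polygonOf w) √(M.scalar 0) := by
  refine (cornerSystem h).centredRegular ?_
  simp only [regularCheck, Bool.and_eq_true] at h
  have hw := h.2.2.2.2.2.1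
  refine exists_balance (isCycle_of_baseCheck hw) ?_
  simp only [baseCheck, Bool.and_eq_true] at hw
  exact hw.2.1

theorem petrieDual_centredRegular (h : M.regularCheck c d w z l = true) :
    (ofVertices M.points (M.scalar c) w.length).petrieDual.CentredRegular (M.polygonOf z)
      √(M.scalar 0) := by
  have hsys := cornerSystem h
  have hwbal := (centredRegular h).balanced
  simp only [regularCheck, Bool.and_eq_true, Nat.blt_eq] at h
  obtain ⟨hc, hc', hd, hd', hM, hw, hz, -⟩ := h
  have hwcyc := isCycle_of_baseCheck hw
  simp only [petrieCheck, Bool.and_eq_true, allBelow_eq_true, Bool.not_eq_true',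
    ← Bool.not_eq_true, Nat.beq_eq] at hz
  obtain ⟨hzcyc, hzbal, hz⟩ := hz
  refine hsys.petrieDual_centredRegular (isCyc_polygonOf hM hzcyc) (fun i => ?_) (fun i => ?_)
    hwbal (exists_balance hzcyc hzbal)
  · have h0 := entry_add hzcyc i 0
    have h1 := entry_add hzcyc i 1
    have h2 := entry_add hzcyc i 2
    push_cast at h0 h1 h2
    rw [add_zero, add_zero, Nat.mod_eq_of_lt (entry_lt hzcyc i rfl)] at h0
    rw [polygonOf, polygonOf, polygonOf, corner_iff hM hc hc' hd hd' (entry_lt_size hzcyc _)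
      (entry_lt_size hzcyc _) (entry_lt_size hzcyc _), h0, h1, h2]
    exact (hz _ (entry_lt hzcyc i rfl)).1
  · have h0 := entry_add hzcyc i 0
    have h3 := entry_add hzcyc i 3
    have e0 : entry w 0 = w.getD 0 0 := entry_eq_getD hwcyc (by norm_num)
    have e3 : entry w 3 = w.getD (3 % w.length) 0 := entry_natCast w 3
    push_cast at h0 h3
    rw [add_zero, add_zero, Nat.mod_eq_of_lt (entry_lt hzcyc i rfl)] at h0
    rw [polygonOf, polygonOf, polygonOf, polygonOf, Ne, inner_eq_inner_iff hM
      (entry_lt_size hzcyc _) (entry_lt_size hzcyc _) (entry_lt_size hwcyc _)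
      (entry_lt_size hwcyc _), h0, h3, e0, e3]
    exact (hz _ (entry_lt hzcyc i rfl)).2

end InnerTable

/-! ### The tables of the classical polyhedra -/

namespace InnerTable

/-- The vertices of the tetrahedron. -/
def tetrahedronTable : InnerTable where
  size := 4
  vec :=
    [((1, 0), (1, 0), (1, 0)), ((1, 0), (-1, 0), (-1, 0)), ((-1, 0), (1, 0), (-1, 0)), ((-1, 0),
    (-1, 0), (1, 0))]
  cls := [(3, 0), (-1, 0)]
  table := 5025265095240

/-- The vertices of the octahedron. -/
def octahedronTable : InnerTable where
  size := 6
  vec :=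
    [((1, 0), (0, 0), (0, 0)), ((-1, 0), (0, 0), (0, 0)), ((0, 0), (1, 0), (0, 0)), ((0, 0), (-1,
    0), (0, 0)), ((0, 0), (0, 0), (1, 0)), ((0, 0), (0, 0), (-1, 0))]
  cls := [(1, 0), (-1, 0), (0, 0)]
  table := 6519152515880156014613448959112

/-- The vertices of the cube. -/
def cubeTable : InnerTable where
  size := 8
  vec :=
    [((1, 0), (1, 0), (1, 0)), ((1, 0), (1, 0), (-1, 0)), ((1, 0), (-1, 0), (1, 0)), ((1, 0), (-1,
    0), (-1, 0)), ((-1, 0), (1, 0), (1, 0)), ((-1, 0), (1, 0), (-1, 0)), ((-1, 0), (-1, 0), (1, 0)),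
    ((-1, 0), (-1, 0), (-1, 0))]
  cls := [(3, 0), (1, 0), (-1, 0), (-3, 0)]
  table := 113651279542044454134515631251428246538759374469054665800

/-- The vertices of the icosahedron. -/
def icosahedronTable : InnerTable where
  size := 12
  vec :=
    [((0, 0), (1, 0), (0, 1)), ((0, 1), (0, 0), (1, 0)), ((1, 0), (0, 1), (0, 0)), ((0, 0), (1, 0),
    (0, -1)), ((0, -1), (0, 0), (1, 0)), ((1, 0), (0, -1), (0, 0)), ((0, 0), (-1, 0), (0, 1)), ((0,
    1), (0, 0), (-1, 0)), ((-1, 0), (0, 1), (0, 0)), ((0, 0), (-1, 0), (0, -1)), ((0, -1), (0, 0),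
    (-1, 0)), ((-1, 0), (0, -1), (0, 0))]
  cls := [(2, 1), (0, 1), (0, -1), (-2, -1)]
  table := 201094085938523953643338810845618988821494022185921406152793138023884258369585770416166083653659104029951688127035235288417113160

/-- The vertices of the dodecahedron. -/
def dodecahedronTable : InnerTable where
  size := 20
  vec :=
    [((1, 0), (1, 0), (1, 0)), ((1, 0), (1, 0), (-1, 0)), ((1, 0), (-1, 0), (1, 0)), ((1, 0), (-1,
    0), (-1, 0)), ((-1, 0), (1, 0), (1, 0)), ((-1, 0), (1, 0), (-1, 0)), ((-1, 0), (-1, 0), (1, 0)),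
    ((-1, 0), (-1, 0), (-1, 0)), ((0, 0), (-1, 1), (0, 1)), ((0, 1), (0, 0), (-1, 1)), ((-1, 1), (0,
    1), (0, 0)), ((0, 0), (-1, 1), (0, -1)), ((0, -1), (0, 0), (-1, 1)), ((-1, 1), (0, -1), (0, 0)),
    ((0, 0), (1, -1), (0, 1)), ((0, 1), (0, 0), (1, -1)), ((1, -1), (0, 1), (0, 0)), ((0, 0), (1,
    -1), (0, -1)), ((0, -1), (0, 0), (1, -1)), ((1, -1), (0, -1), (0, 0))]
  cls := [(3, 0), (1, 0), (-1, 0), (-3, 0), (-1, 2), (1, -2)]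
  table := 324838029024927921154174010576062221549662311592172053258988917964143505104056880423132959647781740584024692477784430407097767875890545542068699273548801023707654982570732441966726566070378253943171554689937992566471353025869463954728837000641056014887335955723257180918597403650851400413724139453512973076781161625129916288346538761674838168559195166326985800

/-- In these checks the two numbers are the positions in `cls` of the inner products for edges and
for corners. The lists are a face, a Petrie polygon, and an ordering of the vertices in which each
after the first is adjacent to an earlier one. -/
theorem tetrahedron_check : tetrahedronTable.regularCheck 1 1 [0, 1, 2]
    [0, 1, 2, 3]
    [0, 1, 2, 3] = true := by
  decide +kernel

theorem octahedron_check : octahedronTable.regularCheck 2 2 [0, 2, 4]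
    [0, 2, 4, 1, 3, 5]
    [0, 2, 1, 3, 4, 5] = true := by
  decide +kernel

theorem cube_check : cubeTable.regularCheck 1 2 [0, 1, 3, 2]
    [0, 1, 3, 7, 6, 4]
    [0, 1, 2, 3, 4, 5, 6, 7] = true := by
  decide +kernel

theorem icosahedron_check : icosahedronTable.regularCheck 1 1 [0, 1, 2]
    [0, 1, 2, 7, 3, 9, 10, 11, 4, 6]
    [0, 1, 2, 3, 4, 5, 6, 7, 8, 9, 10, 11] = true := by
  decide +kernel

theorem dodecahedron_check : dodecahedronTable.regularCheck 4 1 [0, 8, 4, 16, 10]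
    [0, 8, 4, 12, 18, 7, 17, 3, 15, 9]
    [0, 8, 4, 9, 2, 10, 1, 11, 5, 12, 6, 13, 3, 14, 15, 16, 17, 7, 18, 19] = true := by
  decide +kernel

/-- The edges are those of the icosahedron; the corner value `-φ` in place of `φ` selects pentagons
instead of triangles. -/
theorem greatDodecahedron_check : icosahedronTable.regularCheck 1 2 [0, 1, 5, 11, 4]
    [0, 1, 5, 9, 10, 8]
    [0, 1, 2, 3, 4, 5, 6, 7, 8, 9, 10, 11] = true := by
  decide +kernel

theorem smallStellatedDodecahedron_check : icosahedronTable.regularCheck 2 1 [0, 3, 1, 8, 7]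
    [0, 3, 1, 9, 6, 10]
    [0, 3, 1, 4, 2, 5, 6, 7, 8, 9, 10, 11] = true := by
  decide +kernel

theorem greatIcosahedron_check : icosahedronTable.regularCheck 2 2 [0, 3, 5]
    [0, 3, 5, 4, 2, 9, 6, 8, 7, 11]
    [0, 3, 1, 4, 2, 5, 6, 7, 8, 9, 10, 11] = true := by
  decide +kernel

theorem greatStellatedDodecahedron_check : dodecahedronTable.regularCheck 5 1 [0, 17, 4, 15, 18]
    [0, 17, 4, 13, 10, 7, 8, 3, 16, 19]
    [0, 17, 4, 13, 5, 9, 7, 8, 3, 10, 6, 11, 2, 12, 1, 14, 15, 16, 18, 19] = true := by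
  decide +kernel

end InnerTable

/-! ### Identification of the classical polyhedra -/

namespace InnerTable

open GoldenInt GoldenVec Skeletal

theorem mem_points {M : InnerTable} (h : M.size = M.vec.length) {x : E3} :
    x ∈ M.points ↔ ∃ v ∈ M.vec, x = toE3 v := by
  constructor
  · rintro ⟨i, hi, rfl⟩
    rw [h] at hi
    refine ⟨_, List.getElem_mem hi, ?_⟩
    rw [point, coord, List.getD_eq_getElem _ _ hi]
  · rintro ⟨v, hv, rfl⟩
    obtain ⟨i, hi, rfl⟩ := List.getElem_of_mem hv
    exact ⟨i, h ▸ hi, by rw [point, coord, List.getD_eq_getElem _ _ hi]⟩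

theorem val_zero_zero : val (0, 0) = 0 := by simp [val]

theorem val_one : val (1, 0) = 1 := by simp [val]

theorem val_neg_one : val (-1, 0) = -1 := by simp [val]

theorem val_goldenRatio : val (0, 1) = Real.goldenRatio := by simp [val]

theorem val_neg_goldenRatio : val (0, -1) = -Real.goldenRatio := by simp [val]

/-- From `φ ^ 2 = φ + 1`, that is `(φ - 1) * φ = 1`. -/
theorem val_inv_goldenRatio : val (-1, 1) = Real.goldenRatio⁻¹ := by
  apply eq_inv_of_mul_eq_one_left
  simp only [val]
  push_cast
  linear_combination Real.goldenRatio_sq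

theorem val_neg_inv_goldenRatio : val (1, -1) = -Real.goldenRatio⁻¹ := by
  rw [← val_inv_goldenRatio]
  simp only [val]
  push_cast
  ring

theorem val_sqrt_five : val (-1, 2) = √5 := by
  simp only [val, Real.goldenRatio]
  push_cast
  ring

theorem val_neg_sqrt_five : val (1, -2) = -√5 := by
  rw [← val_sqrt_five]
  simp only [val]
  push_cast
  ring

theorem mem_cubeVerts {x : E3} : x ∈ cubeVerts ↔ x = !₂[1, 1, 1] ∨ x = !₂[1, 1, -1] ∨
    x = !₂[1, -1, 1] ∨ x = !₂[1, -1, -1] ∨ x = !₂[-1, 1, 1] ∨ x = !₂[-1, 1, -1] ∨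
    x = !₂[-1, -1, 1] ∨ x = !₂[-1, -1, -1] := by
  have ext_iff : ∀ a b c : ℝ, x = !₂[a, b, c] ↔ x 0 = a ∧ x 1 = b ∧ x 2 = c := fun a b c => by
    constructor
    · rintro rfl
      simp
    · rintro ⟨rfl, rfl, rfl⟩
      ext i
      fin_cases i <;> rfl
  simp only [ext_iff, cubeVerts, Set.mem_ofPred_eq, Fin.forall_fin_succ]
  simp
  tauto

theorem mem_cyclicPoints {a b : ℝ} {x : E3} : x ∈ cyclicPoints a b ↔
    x = !₂[0, a, b] ∨ x = !₂[b, 0, a] ∨ x = !₂[a, b, 0] ∨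
    x = !₂[0, a, -b] ∨ x = !₂[-b, 0, a] ∨ x = !₂[a, -b, 0] ∨
    x = !₂[0, -a, b] ∨ x = !₂[b, 0, -a] ∨ x = !₂[-a, b, 0] ∨
    x = !₂[0, -a, -b] ∨ x = !₂[-b, 0, -a] ∨ x = !₂[-a, -b, 0] := by
  simp [cyclicPoints, or_and_right, exists_or, or_assoc]

theorem cubeTable_points : cubeTable.points = cubeVerts := by
  ext x
  rw [mem_points rfl, mem_cubeVerts]
  simp [cubeTable, toE3, val_one, val_neg_one]

theorem tetrahedronTable_points : tetrahedronTable.points = tetrahedronVerts := by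
  ext x
  rw [mem_points rfl, tetrahedronVerts, Set.mem_ofPred_eq, mem_cubeVerts]
  simp only [tetrahedronTable, toE3, List.mem_cons, List.not_mem_nil, or_false, exists_eq_or_imp,
    exists_eq_left, val_one, val_neg_one]
  constructor
  · rintro (rfl | rfl | rfl | rfl) <;> simp
  · rintro ⟨rfl | rfl | rfl | rfl | rfl | rfl | rfl | rfl, h⟩ <;> simp at h ⊢ <;> norm_num at h

theorem octahedronTable_points : octahedronTable.points = octahedronVerts := by
  ext x
  rw [mem_points rfl, octahedronVerts, Set.mem_ofPred_eq]
  simp [octahedronTable, toE3, val_one, val_neg_one, val_zero_zero, or_and_right, exists_or]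
  tauto

theorem icosahedronTable_points : icosahedronTable.points = icosahedronVerts := by
  ext x
  rw [mem_points rfl, icosahedronVerts, mem_cyclicPoints]
  simp [icosahedronTable, toE3, val_one, val_neg_one, val_zero_zero, val_goldenRatio,
    val_neg_goldenRatio]

theorem dodecahedronTable_points : dodecahedronTable.points = dodecahedronVerts := by
  ext x
  rw [mem_points rfl, dodecahedronVerts, Set.mem_union, mem_cubeVerts, mem_cyclicPoints]
  simp [dodecahedronTable, toE3, val_one, val_neg_one, val_zero_zero, val_goldenRatio,
    val_neg_goldenRatio, val_inv_goldenRatio, val_neg_inv_goldenRatio, or_assoc]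

end InnerTable

namespace Skeletal

/-- A figure with a closed polygon of odd length along its edges has no proper colouring of the
vertices by two colours. -/
theorem not_bipartite {Q : Skeletal} {p : ℕ} {a : ℤ → E3} (hp : Odd p) (ha : IsCyc p a)
    (hadj : ∀ i, s(a i, a (i + 1)) ∈ Q.edges) :
    ¬ ∃ c : E3 → Prop, ∀ x y, s(x, y) ∈ Q.edges → (c x ↔ ¬ c y) := by
  rintro ⟨c, hc⟩
  -- Colours alternate along the polygon, so after an odd number of steps it could not return to its
  -- start.
  have key : ∀ n : ℕ, c (a n) ↔ (Even n ↔ c (a 0)) := by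
    intro n
    induction n with
    | zero => simp
    | succ n ih =>
      have := hc _ _ (hadj n)
      rw [Nat.even_add_one]
      push_cast
      tauto
  have h0 : a p = a 0 := (ha.2 _ _).2 (by simp)
  have := key p
  rw [h0] at this
  have hne := Nat.not_even_iff_odd.2 hp
  tauto

end Skeletal

/-! ### The eighteen polyhedra and their families -/

namespace InnerTable

open GoldenInt GoldenVec Skeletal

variable {M : InnerTable} {c d : ℕ} {w z l : List ℕ} {Q : Skeletal}

theorem valid_of_regularCheck (h : M.regularCheck c d w z l = true) : M.valid = true := by
  simp only [regularCheck, Bool.and_eq_true] at h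
  exact h.2.2.2.2.1

theorem edge_iff
    (hQ : Q = ofVertices M.points (M.scalar c) w.length ∨
      Q = (ofVertices M.points (M.scalar c) w.length).petrieDual) {x y : E3} :
    s(x, y) ∈ Q.edges ↔ Adj M.points (M.scalar c) x y := by
  rcases hQ with rfl | rfl <;> exact mem_ofVertices_edges (p := w.length)

theorem exists_centredRegular (h : M.regularCheck c d w z l = true)
    (hQ : Q = ofVertices M.points (M.scalar c) w.length ∨
      Q = (ofVertices M.points (M.scalar c) w.length).petrieDual) :
    ∃ v, (v = w ∨ v = z) ∧ Q.CentredRegular (M.polygonOf v) √(M.scalar 0) := by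
  rcases hQ with rfl | rfl
  exacts [⟨w, .inl rfl, centredRegular h⟩, ⟨z, .inr rfl, petrieDual_centredRegular h⟩]

/-- The crossing construction for a regular polyhedron with faces of odd length. -/
theorem cross_regular (h : M.regularCheck c d w z l = true) (hp : Odd w.length)
    (hQ : Q = ofVertices M.points (M.scalar c) w.length ∨
      Q = (ofVertices M.points (M.scalar c) w.length).petrieDual) :
    Q.IsRegular ∧
    (∀ t : ℝ, 0 < t → t ≠ 1 →
      (Q.cross t).IsRegularOfIndexTwo ∧ (Q.cross t).vertexOrbits.ncard = 2 ∧
      ∀ F ∈ (Q.cross t).faces, ¬ Coplanar ℝ (polygonVertices F)) ∧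
    (∀ t u : ℝ, 0 < t → t ≠ 1 → 0 < u → u ≠ 1 → (Q.cross t).Similar (Q.cross u) →
      u = t ∨ u = t⁻¹) := by
  obtain ⟨v, -, hv⟩ := exists_centredRegular h hQ
  have hbase := (cornerSystem h).base
  -- A Petrie dual has the edges of the original polyhedron, so a face of the latter serves as odd
  -- cycle in both cases.
  have hodd := not_bipartite (Q := Q) hp hbase.cyc fun i => (edge_iff hQ).2 (hbase.adj i)
  exact ⟨hv.isRegular, fun t ht ht1 => hv.cross_spec ht ht1 hodd,
    fun t u ht ht1 hu hu1 => hv.cross_similar hodd ht ht1 hu hu1⟩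

/-- Three signs `x i * y i` with sum 1 include exactly one -1, so their product is -1. -/
theorem coordProd_eq_neg {x y : E3} (hx : x ∈ cubeVerts) (hy : y ∈ cubeVerts)
    (h : inner ℝ x y = 1) : coordProd x = - coordProd y := by
  have sq : ∀ v ∈ cubeVerts, ∀ i, v i * v i = 1 := fun v hv i => by
    rcases hv i with e | e <;> rw [e] <;> norm_num
  have hy2 : coordProd y * coordProd y = 1 := by
    rcases coordProd_eq_of_mem_cubeVerts hy with e | e <;> rw [e] <;> norm_num
  have hxy : coordProd x * coordProd y = -1 := by
    have hs : ∀ i, x i * y i = 1 ∨ x i * y i = -1 := fun i => by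
      rcases hx i with e | e <;> rcases hy i with e' | e' <;> rw [e, e'] <;> norm_num
    have hprod : coordProd x * coordProd y = (x 0 * y 0) * (x 1 * y 1) * (x 2 * y 2) := by
      simp only [coordProd]
      ring
    simp only [PiLp.inner_apply, Fin.sum_univ_three, RCLike.inner_apply, conj_trivial,
      mul_comm (y _)] at h
    rcases hs 0 with h0 | h0 <;> rcases hs 1 with h1 | h1 <;> rcases hs 2 with h2 | h2 <;>
      rw [h0, h1, h2] at h hprod <;> linarith
  linear_combination coordProd y * hxy - coordProd x * hy2

/-- The rescaling construction for the cube and its Petrie dual. -/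
theorem rescaleHalf_regular
    (hQ : Q = ofVertices cubeVerts 1 4 ∨ Q = (ofVertices cubeVerts 1 4).petrieDual) :
    Q.IsRegular ∧
    (∀ t : ℝ, 0 < t → t ≠ 1 →
      (Q.rescaleHalf t).IsRegularOfIndexTwo ∧ (Q.rescaleHalf t).vertexOrbits.ncard = 2 ∧
      ∀ F ∈ (Q.rescaleHalf t).faces, ¬ Coplanar ℝ (polygonVertices F)) ∧
    (∀ t u : ℝ, 0 < t → t ≠ 1 → 0 < u → u ≠ 1 → (Q.rescaleHalf t).Similar (Q.rescaleHalf u) →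
      u = t ∨ u = t⁻¹) := by
  have hV : Q.verts = cubeVerts := by rcases hQ with rfl | rfl <;> rfl
  have hE : ∀ x y, s(x, y) ∈ Q.edges → coordProd x = - coordProd y := fun x y hxy => by
    have hxy' : Adj cubeVerts 1 x y := by
      rcases hQ with rfl | rfl <;> exact mem_ofVertices_edges (p := 4).1 hxy
    exact coordProd_eq_neg hxy'.1 hxy'.2.1 hxy'.2.2.2
  have hS : ∑ᶠ x ∈ tetrahedronVerts, x = 0 := by
    rw [← tetrahedronTable_points]
    exact finsum_points (valid_of_regularCheck tetrahedron_check)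
  rw [← cubeTable_points, ← val_one] at hQ
  obtain ⟨v, hv0, hv⟩ := exists_centredRegular cube_check hQ
  -- Both the face and the Petrie polygon in the check start at the point `(1, 1, 1)`.
  have hw : coordProd (cubeTable.polygonOf v 0) = 1 := by
    have : cubeTable.polygonOf v 0 = toE3 ((1, 0), (1, 0), (1, 0)) := by
      rcases hv0 with rfl | rfl <;> rfl
    rw [this]
    simp [toE3, coordProd, val_one]
  exact ⟨hv.isRegular, fun t ht ht1 => hv.rescaleHalf_spec hV hE hw hS ht ht1,
    fun t u ht ht1 hu hu1 => hv.rescaleHalf_similar hV hE hw hS ht ht1 hu hu1⟩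

end InnerTable

open InnerTable in
theorem lemma10 (k : ClassicalPolyhedron) (Q : Skeletal)
    (hQ : Q = k.toSkeletal ∨ Q = k.toSkeletal.petrieDual) :
    Q.IsRegular ∧
    (∀ t : ℝ, 0 < t → t ≠ 1 →
      (indexTwoFamily k Q t).IsRegularOfIndexTwo ∧
      (indexTwoFamily k Q t).vertexOrbits.ncard = 2 ∧
      ∀ F ∈ (indexTwoFamily k Q t).faces, ¬ Coplanar ℝ (polygonVertices F)) ∧
    (∀ t u : ℝ, 0 < t → t ≠ 1 → 0 < u → u ≠ 1 →
      (indexTwoFamily k Q t).Similar (indexTwoFamily k Q u) → u = t ∨ u = t⁻¹) := by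
  cases k <;> simp only [ClassicalPolyhedron.toSkeletal] at hQ
  -- Written as `val` of a golden integer, the inner product agrees by unfolding with the entry of
  -- the table to which the check refers; likewise the family unfolds to `cross`.
  · rw [← tetrahedronTable_points, ← val_neg_one] at hQ
    exact cross_regular tetrahedron_check (by decide) hQ
  · rw [← octahedronTable_points, ← val_zero_zero] at hQ
    exact cross_regular octahedron_check (by decide) hQ
  · exact rescaleHalf_regular hQ
  · rw [← icosahedronTable_points, ← val_goldenRatio] at hQ
    exact cross_regular icosahedron_check (by decide) hQ
  · rw [← dodecahedronTable_points, ← val_sqrt_five] at hQ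
    exact cross_regular dodecahedron_check (by decide) hQ
  · rw [← icosahedronTable_points, ← val_goldenRatio] at hQ
    exact cross_regular greatDodecahedron_check (by decide) hQ
  · rw [← icosahedronTable_points, ← val_neg_goldenRatio] at hQ
    exact cross_regular smallStellatedDodecahedron_check (by decide) hQ
  · rw [← icosahedronTable_points, ← val_neg_goldenRatio] at hQ
    exact cross_regular greatIcosahedron_check (by decide) hQ
  · rw [← dodecahedronTable_points, ← val_neg_sqrt_five] at hQ
    exact cross_regular greatStellatedDodecahedron_check (by decide) hQ
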